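/- **Conventions.** Let $k$ be a field of characteristic $0$ and $\lambda\in k$; all spaces, algebras and tensor products are over $k$. A *braiding* on a vector space $V$ is a linear map $\sigma:V\otimes V\to V\otimes V$ (not necessarily invertible) with $\sigma_1\sigma_2\sigma_1=\sigma_2\sigma_1\sigma_2$ on $V^{\otimes3}$, where $\sigma_1=\sigma\otimes\mathrm{id}$, $\sigma_2=\mathrm{id}\otimes\sigma$. A *braided commutative unital algebra* $(A,\mu,\sigma)$ is an associative algebra with product $\mu$, unit $1_A$ and a braiding $\sigma$ on $A$ such that $$(\mathrm{id}\otimes\mu)\sigma_1\sigma_2=\sigma(\mu\otimes\mathrm{id}),\quad (\mu\otimes\mathrm{id})\sigma_2\sigma_1=\sigma(\mathrm{id}\otimes\mu),\quad \sigma(a\otimes1_A)=1_A\otimes a,\quad \sigma(1_A\otimes a)=a\otimes 1_A,\quad \mu\sigma=\mu .$$ A *homomorphism of braided unital algebras* is a linear map $f$ that preserves products and units and satisfies $(f\otimes f)\sigma=\sigma'(f\otimes f)$. Let $\mathcal S_\lambda$ be the category of *strongly braided commutative unital Rota-Baxter algebras of weight $\lambda$*: its objects are triples $(R,P,\tau)$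 where $(R,\tau)$ is a braided commutative unital algebra and $P:R\to R$ is linear with $$P(x)P(y)=P(xP(y))+P(P(x)y)+\lambda P(xy),\qquad \tau(P\otimes\mathrm{id})=(\mathrm{id}\otimes P)\tau,\qquad \tau(\mathrm{id}\otimes P)=(P\otimes\mathrm{id})\tau,$$ and its morphisms $(R,P,\tau)\to(R',P',\tau')$ are the homomorphisms $f$ of braided unital algebras with $fP=P'f$. **Construction.** Let $(A,\mu,\sigma)$ be a braided commutative unital algebra. For $i,j\ge 0$ let $\beta_{i,j}:A^{\otimes i}\otimes A^{\otimes j}\to A^{\otimes j}\otimes A^{\otimes i}$ be the map obtained by replacing each $s_l$ by $\sigma_l=\mathrm{id}^{\otimes(l-1)}\otimes\sigma\otimes\mathrm{id}^{\otimes(i+j-l-1)}$ in a reduced expression of the permutation $\chi_{i,j}\in\mathfrak S_{i+j}$ given by $\chi_{i,j}(r)=j+r$ for $r\le i$ and $\chi_{i,j}(i+r)=r$ for $r\le j$ (so $\beta_{0,j}$ and $\beta_{i,0}$ are identities). Define $*_{(i,j)}:A^{\otimes i}\otimes A^{\otimes j}\to\bigoplus_{n\ge0}A^{\otimes n}$ recursively: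 $1_k\in A^{\otimes 0}=k$ is neutral, and for $i,j>0$ $$*_{(i,j)}=(\mathrm{id}_A\otimes *_{(i-1,j)})+(\mathrm{id}_A\otimes *_{(i,j-1)})(\beta_{i,1}\otimes\mathrm{id}_A^{\otimes(j-1)})+\lambda(\mu\otimes *_{(i-1,j-1)})(\mathrm{id}_A\otimes\beta_{i-1,1}\otimes\mathrm{id}_A^{\otimes(j-1)}).$$ Let Ш$_\sigma(A)=\bigoplus_{n\ge1}A^{\otimes n}=A\otimes\bigoplus_{n\ge0}A^{\otimes n}$, with product $\diamond_{\sigma,\lambda}$ given on $A^{\otimes(m+1)}\otimes A^{\otimes(n+1)}$ by $$(\mu\otimes *_{(m,n)})(\mathrm{id}_A\otimes\beta_{m,1}\otimes\mathrm{id}_A^{\otimes n}),$$ with the braiding $\beta$ whose components are the $\beta_{i,j}$, $i,j\ge1$, with the operator $P(x_0\otimes\cdots\otimes x_n)=1_A\otimes x_0\otimes\cdots\otimes x_n$, and with the embedding $j_A:A\to$ Ш$_\sigma(A)$ onto the summand $A^{\otimes1}$. **Theorem.** Let $(A,\mu,\sigma)$ be a braided commutative unital algebra with $\sigma^2=\mathrm{id}_A^{\otimes2}$.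 Then (Ш$_\sigma(A),\diamond_{\sigma,\lambda},P,\beta)$, with unit $j_A(1_A)$, is the free object over $A$ in $\mathcal S_\lambda$. That is: it is an object of $\mathcal S_\lambda$; $j_A$ is a homomorphism of braided unital algebras; and for every $(R,P_R,\tau)$ in $\mathcal S_\lambda$ and every homomorphism of braided unital algebras $\varphi:A\to R$ there is a unique morphism $\bar\varphi:$ Ш$_\sigma(A)\to R$ in $\mathcal S_\lambda$ with $\bar\varphi\, j_A=\varphi$. -/

import Mathlib

open scoped TensorProduct DirectSum

namespace BraidedRB

universe u v w

/-! Braided algebras and Rota-Baxter algebras. An algebra is a module `V` with a product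
`μ : V ⊗ V → V` and a unit `e : V`. Threefold tensors are bracketed as `V ⊗ (V ⊗ V)`. -/

section Structures

variable {k : Type u} [CommRing k] {V : Type v} [AddCommGroup V] [Module k V]

/-- `σ₁ = σ ⊗ id` on `V ⊗ V ⊗ V`. -/
noncomputable def op₁ (σ : V ⊗[k] V →ₗ[k] V ⊗[k] V) :
    V ⊗[k] (V ⊗[k] V) →ₗ[k] V ⊗[k] (V ⊗[k] V) :=
  (TensorProduct.assoc k V V V).toLinearMap ∘ₗ σ.rTensor V ∘ₗ
    (TensorProduct.assoc k V V V).symm.toLinearMap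

/-- `σ₂ = id ⊗ σ` on `V ⊗ V ⊗ V`. -/
noncomputable def op₂ (σ : V ⊗[k] V →ₗ[k] V ⊗[k] V) :
    V ⊗[k] (V ⊗[k] V) →ₗ[k] V ⊗[k] (V ⊗[k] V) :=
  σ.lTensor V

/-- Braidings, that is, Yang-Baxter operators. Invertibility is not required. -/
def IsBraiding (σ : V ⊗[k] V →ₗ[k] V ⊗[k] V) : Prop :=
  op₁ σ ∘ₗ op₂ σ ∘ₗ op₁ σ = op₂ σ ∘ₗ op₁ σ ∘ₗ op₂ σ

/-- `(V, μ, e)` is an associative unital algebra. -/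
structure IsUnitalAlgebra (μ : V ⊗[k] V →ₗ[k] V) (e : V) : Prop where
  assoc : ∀ x y z : V, μ (μ (x ⊗ₜ y) ⊗ₜ z) = μ (x ⊗ₜ μ (y ⊗ₜ z))
  one_mul : ∀ x : V, μ (e ⊗ₜ x) = x
  mul_one : ∀ x : V, μ (x ⊗ₜ e) = x

/-- `(V, μ, e, σ)` is a braided unital algebra. -/
structure IsBraidedUnitalAlgebra (μ : V ⊗[k] V →ₗ[k] V) (e : V)
    (σ : V ⊗[k] V →ₗ[k] V ⊗[k] V) : Prop where
  algebra : IsUnitalAlgebra μ e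
  braiding : IsBraiding σ
  /-- `(id ⊗ μ) σ₁ σ₂ = σ (μ ⊗ id)` -/
  braid_mul_left : μ.lTensor V ∘ₗ op₁ σ ∘ₗ op₂ σ =
    σ ∘ₗ μ.rTensor V ∘ₗ (TensorProduct.assoc k V V V).symm.toLinearMap
  /-- `(μ ⊗ id) σ₂ σ₁ = σ (id ⊗ μ)` -/
  braid_mul_right :
    μ.rTensor V ∘ₗ (TensorProduct.assoc k V V V).symm.toLinearMap ∘ₗ op₂ σ ∘ₗ op₁ σ =
      σ ∘ₗ μ.lTensor V
  braid_one_right : ∀ x : V, σ (x ⊗ₜ e) = e ⊗ₜ x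
  braid_one_left : ∀ x : V, σ (e ⊗ₜ x) = x ⊗ₜ e

/-- `(V, μ, e, σ)` is a braided commutative unital algebra. -/
structure IsBraidedCommUnitalAlgebra (μ : V ⊗[k] V →ₗ[k] V) (e : V)
    (σ : V ⊗[k] V →ₗ[k] V ⊗[k] V) : Prop extends IsBraidedUnitalAlgebra μ e σ where
  comm : μ ∘ₗ σ = μ

/-- `P` is a Rota-Baxter operator of weight `lam` on `(V, μ)`. -/
def IsRotaBaxter (lam : k) (μ : V ⊗[k] V →ₗ[k] V) (P : V →ₗ[k] V) : Prop :=
  ∀ x y : V, μ (P x ⊗ₜ P y) = P (μ (x ⊗ₜ P y)) + P (μ (P x ⊗ₜ y)) + lam • P (μ (x ⊗ₜ y))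

/-- `(V, μ, e, σ, P)` is a strongly braided commutative unital Rota-Baxter algebra of
weight `lam`, that is, an object of the category in question. -/
structure IsStronglyBraidedCommRotaBaxter (lam : k) (μ : V ⊗[k] V →ₗ[k] V) (e : V)
    (σ : V ⊗[k] V →ₗ[k] V ⊗[k] V) (P : V →ₗ[k] V) : Prop
    extends IsBraidedCommUnitalAlgebra μ e σ where
  rotaBaxter : IsRotaBaxter lam μ P
  /-- right weak: `σ (P ⊗ id) = (id ⊗ P) σ` -/
  right_weak : σ ∘ₗ P.rTensor V = P.lTensor V ∘ₗ σ
  /-- left weak: `σ (id ⊗ P) = (P ⊗ id) σ` -/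
  left_weak : σ ∘ₗ P.lTensor V = P.rTensor V ∘ₗ σ

variable {W : Type w} [AddCommGroup W] [Module k W]

/-- Homomorphisms of braided unital algebras. -/
structure IsBraidedAlgebraHom
    (μ : V ⊗[k] V →ₗ[k] V) (e : V) (σ : V ⊗[k] V →ₗ[k] V ⊗[k] V)
    (μ' : W ⊗[k] W →ₗ[k] W) (e' : W) (τ : W ⊗[k] W →ₗ[k] W ⊗[k] W)
    (f : V →ₗ[k] W) : Prop where
  map_mul : ∀ x y : V, f (μ (x ⊗ₜ y)) = μ' (f x ⊗ₜ f y)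
  map_one : f e = e'
  map_braid : TensorProduct.map f f ∘ₗ σ = τ ∘ₗ TensorProduct.map f f

/-- Homomorphisms of braided unital Rota-Baxter algebras, that is, morphisms of the category
in question. -/
structure IsBraidedRotaBaxterHom
    (μ : V ⊗[k] V →ₗ[k] V) (e : V) (σ : V ⊗[k] V →ₗ[k] V ⊗[k] V) (P : V →ₗ[k] V)
    (μ' : W ⊗[k] W →ₗ[k] W) (e' : W) (τ : W ⊗[k] W →ₗ[k] W ⊗[k] W) (P' : W →ₗ[k] W)
    (f : V →ₗ[k] W) : Prop extends IsBraidedAlgebraHom μ e σ μ' e' τ f where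
  map_op : f ∘ₗ P = P' ∘ₗ f

end Structures

/-! The braided mixable shuffle algebra. -/

section Construction

variable (k : Type u) [CommRing k] (A : Type v) [AddCommGroup A] [Module k A]

/-- Prepending a tensor factor: `A ⊗ A^{⊗n} ≃ A^{⊗(n+1)}`. -/
noncomputable def cons (n : ℕ) : A ⊗[k] (⨂[k]^n A) ≃ₗ[k] ⨂[k]^(n + 1) A :=
  (TensorProduct.congr (PiTensorProduct.subsingletonEquiv (R := k) (s := fun _ => A)
      (0 : Fin 1)).symm (LinearEquiv.refl k _)).trans
    (TensorPower.mulEquiv.trans (TensorPower.cast k A (Nat.add_comm 1 n)))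

theorem cons_tmul_tprod (n : ℕ) (a : A) (v : Fin n → A) :
    cons k A n (a ⊗ₜ PiTensorProduct.tprod k v) =
      PiTensorProduct.tprod k (Fin.cons a v : Fin (n + 1) → A) := by
  have h : TensorPower.mulEquiv (R := k) (M := A)
      ((PiTensorProduct.tprod k fun _ : Fin 1 => a) ⊗ₜ[k] PiTensorProduct.tprod k v) =
      PiTensorProduct.tprod k (Fin.append (fun _ : Fin 1 => a) v) :=
    TensorPower.tprod_mul_tprod k _ _
  simp only [cons, LinearEquiv.trans_apply, TensorProduct.congr_tmul, LinearEquiv.refl_apply,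
    PiTensorProduct.subsingletonEquiv_symm_apply']
  rw [h, TensorPower.cast_tprod]
  congr 1
  rw [Fin.append_left_eq_cons]
  ext i
  simp

/-- The space `T(A) = ⊕_{n ≥ 0} A^{⊗n}`, underlying the quantum quasi-shuffle algebra. -/
abbrev TensorSpace : Type _ := ⨁ n : ℕ, ⨂[k]^n A

/-- The space `⊕_{n ≥ 1} A^{⊗n}`, underlying the braided mixable shuffle algebra. Its component
of index `n` is `A^{⊗(n+1)}`. -/
abbrev Sha : Type _ := ⨁ n : ℕ, ⨂[k]^(n + 1) A

/-- `a ⊗ x ↦ a ⊗ x`, as a map `A ⊗ T(A) → T(A)`. -/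
noncomputable def consT : A ⊗[k] TensorSpace k A →ₗ[k] TensorSpace k A :=
  DirectSum.toModule k ℕ _ (fun n =>
    DirectSum.lof k ℕ (fun n => ⨂[k]^n A) (n + 1) ∘ₗ (cons k A n).toLinearMap) ∘ₗ
  (TensorProduct.directSumRight k k A (fun n : ℕ => ⨂[k]^n A)).toLinearMap

/-- The identification `A ⊗ T(A) → ⊕_{n ≥ 1} A^{⊗n}`, `a ⊗ x ↦ a ⊗ x`. -/
noncomputable def consSha : A ⊗[k] TensorSpace k A →ₗ[k] Sha k A :=
  DirectSum.toModule k ℕ _ (fun n =>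
    DirectSum.lof k ℕ (fun n => ⨂[k]^(n + 1) A) n ∘ₗ (cons k A n).toLinearMap) ∘ₗ
  (TensorProduct.directSumRight k k A (fun n : ℕ => ⨂[k]^n A)).toLinearMap

/-- The embedding `j : A → ⊕_{n ≥ 1} A^{⊗n}` onto the component of degree one. -/
noncomputable def shaι : A →ₗ[k] Sha k A :=
  DirectSum.lof k ℕ (fun n => ⨂[k]^(n + 1) A) 0 ∘ₗ
    (PiTensorProduct.subsingletonEquiv (R := k) (s := fun _ => A)
      (0 : Fin 1)).symm.toLinearMap

variable {k A}

/-- The operator `P(x₀ ⊗ ⋯ ⊗ xₙ) = e ⊗ x₀ ⊗ ⋯ ⊗ xₙ`. -/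
noncomputable def shaP (e : A) : Sha k A →ₗ[k] Sha k A :=
  DirectSum.toModule k ℕ _ (fun n =>
    DirectSum.lof k ℕ (fun n => ⨂[k]^(n + 1) A) (n + 1) ∘ₗ (cons k A (n + 1)).toLinearMap ∘ₗ
      TensorProduct.mk k A (⨂[k]^(n + 1) A) e)

/-- `β_{n,1} : A^{⊗n} ⊗ A → A ⊗ A^{⊗n}`, moving the last factor to the front by
`σ₁ σ₂ ⋯ σₙ`. -/
noncomputable def betaOne (σ : A ⊗[k] A →ₗ[k] A ⊗[k] A) :
    (n : ℕ) → (⨂[k]^n A) ⊗[k] A →ₗ[k] A ⊗[k] (⨂[k]^n A)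
  | 0 => (TensorProduct.comm k (⨂[k]^0 A) A).toLinearMap
  | n + 1 =>
    (cons k A n).toLinearMap.lTensor A ∘ₗ
    (TensorProduct.assoc k A A (⨂[k]^n A)).toLinearMap ∘ₗ
    σ.rTensor (⨂[k]^n A) ∘ₗ
    (TensorProduct.assoc k A A (⨂[k]^n A)).symm.toLinearMap ∘ₗ
    (betaOne σ n).lTensor A ∘ₗ
    (TensorProduct.assoc k A (⨂[k]^n A) A).toLinearMap ∘ₗ
    (cons k A n).symm.toLinearMap.rTensor A

/-- `β_{m,n} : A^{⊗m} ⊗ A^{⊗n} → A^{⊗n} ⊗ A^{⊗m}`, the lift of the block permutation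
`χ_{m,n}` (which moves the first `m` places behind the last `n`) along its reduced expression
`(s_n ⋯ s_{n+m-1}) ⋯ (s_2 ⋯ s_{m+1}) (s_1 ⋯ s_m)` of length `m n`: the factors of
`A^{⊗n}` are moved to the left through `A^{⊗m}` one after the other. -/
noncomputable def beta (σ : A ⊗[k] A →ₗ[k] A ⊗[k] A) (m : ℕ) :
    (n : ℕ) → (⨂[k]^m A) ⊗[k] (⨂[k]^n A) →ₗ[k] (⨂[k]^n A) ⊗[k] (⨂[k]^m A)
  | 0 => (TensorProduct.comm k (⨂[k]^m A) (⨂[k]^0 A)).toLinearMap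
  | n + 1 =>
    (cons k A n).toLinearMap.rTensor (⨂[k]^m A) ∘ₗ
    (TensorProduct.assoc k A (⨂[k]^n A) (⨂[k]^m A)).symm.toLinearMap ∘ₗ
    (beta σ m n).lTensor A ∘ₗ
    (TensorProduct.assoc k A (⨂[k]^m A) (⨂[k]^n A)).toLinearMap ∘ₗ
    (betaOne σ m).rTensor (⨂[k]^n A) ∘ₗ
    (TensorProduct.assoc k (⨂[k]^m A) A (⨂[k]^n A)).symm.toLinearMap ∘ₗ
    (cons k A n).symm.toLinearMap.lTensor (⨂[k]^m A)

/-- `id ⊗ β_{m,1} ⊗ id` as a map `A^{⊗(m+1)} ⊗ A^{⊗(n+1)} → (A ⊗ A) ⊗ (A^{⊗m} ⊗ A^{⊗n})`. -/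
noncomputable def midBraid (σ : A ⊗[k] A →ₗ[k] A ⊗[k] A) (m n : ℕ) :
    (⨂[k]^(m + 1) A) ⊗[k] (⨂[k]^(n + 1) A) →ₗ[k]
      (A ⊗[k] A) ⊗[k] ((⨂[k]^m A) ⊗[k] (⨂[k]^n A)) :=
  (TensorProduct.assoc k A A ((⨂[k]^m A) ⊗[k] (⨂[k]^n A))).symm.toLinearMap ∘ₗ
  ((TensorProduct.assoc k A (⨂[k]^m A) (⨂[k]^n A)).toLinearMap ∘ₗ
    (betaOne σ m).rTensor (⨂[k]^n A) ∘ₗ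
    (TensorProduct.assoc k (⨂[k]^m A) A (⨂[k]^n A)).symm.toLinearMap).lTensor A ∘ₗ
  (TensorProduct.assoc k A (⨂[k]^m A) (A ⊗[k] (⨂[k]^n A))).toLinearMap ∘ₗ
  TensorProduct.map (cons k A m).symm.toLinearMap (cons k A n).symm.toLinearMap

/-- The component `*_{(i,j)} : A^{⊗i} ⊗ A^{⊗j} → T(A)` of the quantum quasi-shuffle product
of weight `lam`. The unit of `k = A^{⊗0}` is neutral, and for `i, j > 0`
`*_{(i,j)} = (id ⊗ *_{(i-1,j)}) + (id ⊗ *_{(i,j-1)}) (β_{i,1} ⊗ id)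
  + lam (μ ⊗ *_{(i-1,j-1)}) (id ⊗ β_{i-1,1} ⊗ id)`. -/
noncomputable def quasiShuffle (lam : k) (μ : A ⊗[k] A →ₗ[k] A) (σ : A ⊗[k] A →ₗ[k] A ⊗[k] A) :
    (i j : ℕ) → (⨂[k]^i A) ⊗[k] (⨂[k]^j A) →ₗ[k] TensorSpace k A
  | 0, j =>
    DirectSum.lof k ℕ (fun n => ⨂[k]^n A) j ∘ₗ
    (TensorProduct.lid k (⨂[k]^j A)).toLinearMap ∘ₗ
    (PiTensorProduct.isEmptyEquiv (R := k) (s := fun _ => A) (Fin 0)).toLinearMap.rTensor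
      (⨂[k]^j A)
  | i + 1, 0 =>
    DirectSum.lof k ℕ (fun n => ⨂[k]^n A) (i + 1) ∘ₗ
    (TensorProduct.rid k (⨂[k]^(i + 1) A)).toLinearMap ∘ₗ
    (PiTensorProduct.isEmptyEquiv (R := k) (s := fun _ => A) (Fin 0)).toLinearMap.lTensor
      (⨂[k]^(i + 1) A)
  | i + 1, j + 1 =>
    (consT k A ∘ₗ
      (quasiShuffle lam μ σ i (j + 1)).lTensor A ∘ₗ
      (TensorProduct.assoc k A (⨂[k]^i A) (⨂[k]^(j + 1) A)).toLinearMap ∘ₗ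
      (cons k A i).symm.toLinearMap.rTensor (⨂[k]^(j + 1) A)) +
    (consT k A ∘ₗ
      (quasiShuffle lam μ σ (i + 1) j).lTensor A ∘ₗ
      (TensorProduct.assoc k A (⨂[k]^(i + 1) A) (⨂[k]^j A)).toLinearMap ∘ₗ
      (betaOne σ (i + 1)).rTensor (⨂[k]^j A) ∘ₗ
      (TensorProduct.assoc k (⨂[k]^(i + 1) A) A (⨂[k]^j A)).symm.toLinearMap ∘ₗ
      (cons k A j).symm.toLinearMap.lTensor (⨂[k]^(i + 1) A)) +
    lam • (consT k A ∘ₗ TensorProduct.map μ (quasiShuffle lam μ σ i j) ∘ₗ midBraid σ i j)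

/-- The linear map on `⊕_{m,n} A^{⊗(m+1)} ⊗ A^{⊗(n+1)}` with the given components. -/
noncomputable def shaLift₂ {X : Type w} [AddCommMonoid X] [Module k X]
    (f : (m n : ℕ) → (⨂[k]^(m + 1) A) ⊗[k] (⨂[k]^(n + 1) A) →ₗ[k] X) :
    Sha k A ⊗[k] Sha k A →ₗ[k] X :=
  DirectSum.toModule k (ℕ × ℕ) X (fun p => f p.1 p.2) ∘ₗ
  (TensorProduct.directSum k k (fun m : ℕ => ⨂[k]^(m + 1) A)
    (fun n : ℕ => ⨂[k]^(n + 1) A)).toLinearMap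

/-- The braiding `β` on `⊕_{n ≥ 1} A^{⊗n}`, with components `β_{m+1,n+1}`. -/
noncomputable def shaBraid (σ : A ⊗[k] A →ₗ[k] A ⊗[k] A) :
    Sha k A ⊗[k] Sha k A →ₗ[k] Sha k A ⊗[k] Sha k A :=
  shaLift₂ fun m n =>
    TensorProduct.map (DirectSum.lof k ℕ (fun n => ⨂[k]^(n + 1) A) n)
      (DirectSum.lof k ℕ (fun n => ⨂[k]^(n + 1) A) m) ∘ₗ beta σ (m + 1) (n + 1)

/-- The product `⋄` of weight `lam` on `⊕_{n ≥ 1} A^{⊗n}`, with components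
`(μ ⊗ *_{(m,n)}) (id ⊗ β_{m,1} ⊗ id)` on `A^{⊗(m+1)} ⊗ A^{⊗(n+1)}`. -/
noncomputable def shaMul (lam : k) (μ : A ⊗[k] A →ₗ[k] A) (σ : A ⊗[k] A →ₗ[k] A ⊗[k] A) :
    Sha k A ⊗[k] Sha k A →ₗ[k] Sha k A :=
  shaLift₂ fun m n =>
    consSha k A ∘ₗ TensorProduct.map μ (quasiShuffle lam μ σ m n) ∘ₗ midBraid σ m n

end Construction

end BraidedRB

/-! Write T for ⊕_{n≥0} A^{⊗n}, o for its unit, c : A ⊗ T → T for prepending a letter and * for the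
quasi-shuffle product. The algebra in question is V = A ⊗ T with P(w) = e ⊗ c(w). Since a ⊗ x = j(a)
⋄ (e ⊗ x) and e ⊗ c(w) = P(w), V is generated from A by products and P. A morphism extending φ must
therefore be a ⊗ x ↦ φ(a)ρ(x), where ρ(o) = 1 and ρ(c(a ⊗ x)) = P_R(φ(a)ρ(x)). This recursion proves
uniqueness and also defines the candidate.

The Rota-Baxter identity on V is the recursion of *: P(u) ⋄ P(v) = e ⊗ (c(u) * c(v)), and the three
summands of c(u) * c(v) are c(u ⋄ P(v)), c(P(u) ⋄ v) and λ c(u ⋄ v) (`mulPart_rotaBaxter`). The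
remaining axioms rest on the map δ : T ⊗ A → A ⊗ T that moves a letter to the left through a word.
Induction on words makes δ compatible with the unit, braiding and product of A, and then with *
(`delta_unit`, `delta_sigma`, `delta_mul`, `delta_shuffle`). Associativity of * is an induction on
three words, with one case for each nonempty set of first letters that merge into the first letter
of the product (`shuffle_assoc`). The braiding B of T is iterated δ and inherits the Yang-Baxter
equation (`braid_yang_baxter`). If σ² = id, then the map ε moving a letter to the right is inverse
to δ, and B² = id. This gives braided commutativity, and it transfers naturality from δ to ε, hence
to the braiding of V (`shuffle_braid`, `braidPart_mulPart`).

For existence, ρ is multiplicative because the Rota-Baxter identity in R has the shape of the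
recursion of * (`rho_shuffle`). Some terms require moving φ(b) past ρ(x). This is possible because
μ_R τ = μ_R and τ(ρ ⊗ φ) = (φ ⊗ ρ)δ, and the latter holds because P_R commutes with τ
(`tau_rho_phi`).

Every identity is proved with an arbitrary spectator factor M on the right. All tensors are then
bracketed to the right, operations further inside are whiskerings, and inductions can hide the
untouched factors in M. Taking M = k recovers the plain axioms. -/

namespace BraidedRB

/-! ### Right-bracketed tensor calculus with a spectator factor -/

section Strict

variable {k : Type*} [CommRing k]
variable {X Y Z W M N : Type*} [AddCommGroup X] [Module k X] [AddCommGroup Y] [Module k Y]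
  [AddCommGroup Z] [Module k Z] [AddCommGroup W] [Module k W] [AddCommGroup M] [Module k M]
  [AddCommGroup N] [Module k N]

/-- Whiskering on the left. -/
local infixr:81 " ◁ " => LinearMap.lTensor

/-- A map `X ⊗ Y → Z ⊗ W`, applied to the first two factors of a right-bracketed tensor product. -/
noncomputable def act₂ (f : X ⊗[k] Y →ₗ[k] Z ⊗[k] W) :
    X ⊗[k] (Y ⊗[k] M) →ₗ[k] Z ⊗[k] (W ⊗[k] M) :=
  (TensorProduct.assoc k Z W M).toLinearMap ∘ₗ f.rTensor M ∘ₗ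
    (TensorProduct.assoc k X Y M).symm.toLinearMap

/-- A map `X ⊗ Y → Z`, applied to the first two factors of a right-bracketed tensor product. -/
noncomputable def act₁ (f : X ⊗[k] Y →ₗ[k] Z) : X ⊗[k] (Y ⊗[k] M) →ₗ[k] Z ⊗[k] M :=
  f.rTensor M ∘ₗ (TensorProduct.assoc k X Y M).symm.toLinearMap

theorem act₂_tmul (f : X ⊗[k] Y →ₗ[k] Z ⊗[k] W) (x : X) (y : Y) (m : M) :
    act₂ f (x ⊗ₜ (y ⊗ₜ m)) = TensorProduct.assoc k Z W M (f (x ⊗ₜ y) ⊗ₜ m) := by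
  simp [act₂]

theorem act₁_tmul (f : X ⊗[k] Y →ₗ[k] Z) (x : X) (y : Y) (m : M) :
    act₁ f (x ⊗ₜ (y ⊗ₜ m)) = f (x ⊗ₜ y) ⊗ₜ m := by
  simp [act₁]

theorem act₂_assoc (f : X ⊗[k] Y →ₗ[k] Z ⊗[k] W) (t : X ⊗[k] Y) (m : M) :
    act₂ f (TensorProduct.assoc k X Y M (t ⊗ₜ m)) =
      TensorProduct.assoc k Z W M (f t ⊗ₜ m) := by
  simp [act₂]

theorem act₁_assoc (f : X ⊗[k] Y →ₗ[k] Z) (t : X ⊗[k] Y) (m : M) :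
    act₁ f (TensorProduct.assoc k X Y M (t ⊗ₜ m)) = f t ⊗ₜ m := by
  simp [act₁]

/-- Interchange law: `f` touches only the first two factors and `g` only the tail. With
`act₁_lTensor` and `rTensor_lTensor` it is the move that slides disjoint operations past one another
in every later computation. -/
theorem act₂_lTensor (f : X ⊗[k] Y →ₗ[k] Z ⊗[k] W) (g : M →ₗ[k] N)
    (u : X ⊗[k] (Y ⊗[k] M)) :
    act₂ f ((X ◁ Y ◁ g) u) = (Z ◁ W ◁ g) (act₂ f u) := by
  suffices h : act₂ f ∘ₗ (X ◁ Y ◁ g) = (Z ◁ W ◁ g) ∘ₗ act₂ f from LinearMap.congr_fun h u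
  ext x y m
  simp only [TensorProduct.AlgebraTensorModule.curry_apply, LinearMap.restrictScalars_self,
    TensorProduct.curry_apply, LinearMap.comp_apply, LinearMap.lTensor_tmul, act₂_tmul]
  induction f (x ⊗ₜ y) with
  | zero => simp
  | tmul z w => simp
  | add a b ha hb => simp only [TensorProduct.add_tmul, map_add, ha, hb]

theorem act₁_lTensor (f : X ⊗[k] Y →ₗ[k] Z) (g : M →ₗ[k] N) (u : X ⊗[k] (Y ⊗[k] M)) :
    act₁ f ((X ◁ Y ◁ g) u) = (Z ◁ g) (act₁ f u) := by
  suffices h : act₁ f ∘ₗ (X ◁ Y ◁ g) = (Z ◁ g) ∘ₗ act₁ f from LinearMap.congr_fun h u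
  ext x y m
  simp [act₁_tmul]

theorem rTensor_lTensor (f : X →ₗ[k] Z) (g : M →ₗ[k] N) (u : X ⊗[k] M) :
    f.rTensor N ((X ◁ g) u) = (Z ◁ g) (f.rTensor M u) := by
  suffices h : f.rTensor N ∘ₗ (X ◁ g) = (Z ◁ g) ∘ₗ f.rTensor M from LinearMap.congr_fun h u
  ext x m
  simp

/-! Whiskering of identities between composites. -/

variable {M₀ M₁ M₂ M₃ M₄ M₅ M₆ M₇ M₈ : Type*}
  [AddCommGroup M₀] [Module k M₀] [AddCommGroup M₁] [Module k M₁]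
  [AddCommGroup M₂] [Module k M₂] [AddCommGroup M₃] [Module k M₃]
  [AddCommGroup M₄] [Module k M₄] [AddCommGroup M₅] [Module k M₅]
  [AddCommGroup M₆] [Module k M₆] [AddCommGroup M₇] [Module k M₇]
  [AddCommGroup M₈] [Module k M₈]

section Whisker

variable (X)

/-- The two indices count the maps composed on either side of the identity, 0 standing for the
identity map. Results stay in the form of whiskered factors, so that they can be used for further
rewriting. -/
theorem whisker₂₀ {f : M₁ →ₗ[k] M₀} {g : M₀ →ₗ[k] M₁}
    (h : ∀ u, f (g u) = u) (u : X ⊗[k] M₀) : (X ◁ f) ((X ◁ g) u) = u := by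
  have e : f ∘ₗ g = LinearMap.id := LinearMap.ext h
  simpa [LinearMap.lTensor_comp] using LinearMap.congr_fun (congrArg (LinearMap.lTensor X) e) u

theorem whisker₂₁ {f : M₁ →ₗ[k] M₂} {g : M₀ →ₗ[k] M₁} {f' : M₀ →ₗ[k] M₂}
    (h : ∀ u, f (g u) = f' u) (u : X ⊗[k] M₀) : (X ◁ f) ((X ◁ g) u) = (X ◁ f') u := by
  have e : f ∘ₗ g = f' := LinearMap.ext h
  rw [← e, LinearMap.lTensor_comp, LinearMap.comp_apply]

theorem whisker₂₂ {f : M₁ →ₗ[k] M₂} {g : M₀ →ₗ[k] M₁} {f' : M₃ →ₗ[k] M₂} {g' : M₀ →ₗ[k] M₃}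
    (h : ∀ u, f (g u) = f' (g' u)) (u : X ⊗[k] M₀) :
    (X ◁ f) ((X ◁ g) u) = (X ◁ f') ((X ◁ g') u) := by
  have e : f ∘ₗ g = f' ∘ₗ g' := LinearMap.ext h
  simpa [LinearMap.lTensor_comp] using LinearMap.congr_fun (congrArg (LinearMap.lTensor X) e) u

theorem whisker₂₃ {f : M₁ →ₗ[k] M₂} {g : M₀ →ₗ[k] M₁} {f' : M₄ →ₗ[k] M₂} {g' : M₃ →ₗ[k] M₄}
    {h' : M₀ →ₗ[k] M₃} (h : ∀ u, f (g u) = f' (g' (h' u))) (u : X ⊗[k] M₀) :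
    (X ◁ f) ((X ◁ g) u) = (X ◁ f') ((X ◁ g') ((X ◁ h') u)) := by
  have e : f ∘ₗ g = f' ∘ₗ g' ∘ₗ h' := LinearMap.ext h
  simpa [LinearMap.lTensor_comp] using LinearMap.congr_fun (congrArg (LinearMap.lTensor X) e) u

theorem whisker₃₃ {f : M₁ →ₗ[k] M₂} {g : M₅ →ₗ[k] M₁} {j : M₀ →ₗ[k] M₅}
    {f' : M₄ →ₗ[k] M₂} {g' : M₃ →ₗ[k] M₄}
    {h' : M₀ →ₗ[k] M₃} (h : ∀ u, f (g (j u)) = f' (g' (h' u))) (u : X ⊗[k] M₀) :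
    (X ◁ f) ((X ◁ g) ((X ◁ j) u)) = (X ◁ f') ((X ◁ g') ((X ◁ h') u)) := by
  have e : f ∘ₗ g ∘ₗ j = f' ∘ₗ g' ∘ₗ h' := LinearMap.ext h
  simpa [LinearMap.lTensor_comp] using LinearMap.congr_fun (congrArg (LinearMap.lTensor X) e) u

theorem whisker₃₂ {f : M₁ →ₗ[k] M₂} {g : M₅ →ₗ[k] M₁} {j : M₀ →ₗ[k] M₅}
    {f' : M₃ →ₗ[k] M₂} {g' : M₀ →ₗ[k] M₃}
    (h : ∀ u, f (g (j u)) = f' (g' u)) (u : X ⊗[k] M₀) :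
    (X ◁ f) ((X ◁ g) ((X ◁ j) u)) = (X ◁ f') ((X ◁ g') u) := by
  have e : f ∘ₗ g ∘ₗ j = f' ∘ₗ g' := LinearMap.ext h
  simpa [LinearMap.lTensor_comp] using LinearMap.congr_fun (congrArg (LinearMap.lTensor X) e) u

end Whisker

theorem lTensor_act₂ (X' : Type*) [AddCommGroup X'] [Module k X']
    (f : X ⊗[k] Y →ₗ[k] Z ⊗[k] W) (g : M →ₗ[k] N) (u : X' ⊗[k] (X ⊗[k] (Y ⊗[k] M))) :
    (X' ◁ act₂ f) ((X' ◁ X ◁ Y ◁ g) u) = (X' ◁ Z ◁ W ◁ g) ((X' ◁ act₂ f) u) :=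
  whisker₂₂ X' (act₂_lTensor f g) u

theorem lTensor_act₁ (X' : Type*) [AddCommGroup X'] [Module k X']
    (f : X ⊗[k] Y →ₗ[k] Z) (g : M →ₗ[k] N) (u : X' ⊗[k] (X ⊗[k] (Y ⊗[k] M))) :
    (X' ◁ act₁ f) ((X' ◁ X ◁ Y ◁ g) u) = (X' ◁ Z ◁ g) ((X' ◁ act₁ f) u) :=
  whisker₂₂ X' (act₁_lTensor f g) u

theorem lTensor_lTensor_act₂ (X' Y' : Type*) [AddCommGroup X'] [Module k X'] [AddCommGroup Y']
    [Module k Y'] (f : X ⊗[k] Y →ₗ[k] Z ⊗[k] W) (g : M →ₗ[k] N)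
    (u : X' ⊗[k] (Y' ⊗[k] (X ⊗[k] (Y ⊗[k] M)))) :
    (X' ◁ Y' ◁ act₂ f) ((X' ◁ Y' ◁ X ◁ Y ◁ g) u) =
      (X' ◁ Y' ◁ Z ◁ W ◁ g) ((X' ◁ Y' ◁ act₂ f) u) :=
  whisker₂₂ X' (lTensor_act₂ Y' f g) u

theorem lTensor_lTensor_act₁ (X' Y' : Type*) [AddCommGroup X'] [Module k X'] [AddCommGroup Y']
    [Module k Y'] (f : X ⊗[k] Y →ₗ[k] Z) (g : M →ₗ[k] N)
    (u : X' ⊗[k] (Y' ⊗[k] (X ⊗[k] (Y ⊗[k] M)))) :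
    (X' ◁ Y' ◁ act₁ f) ((X' ◁ Y' ◁ X ◁ Y ◁ g) u) =
      (X' ◁ Y' ◁ Z ◁ g) ((X' ◁ Y' ◁ act₁ f) u) :=
  whisker₂₂ X' (lTensor_act₁ Y' f g) u

end Strict

/-! ### Translating the axioms to and from their spectator forms -/

section Bridge

variable {k : Type*} [CommRing k]
variable {V W M N : Type*} [AddCommGroup V] [Module k V] [AddCommGroup W] [Module k W]
  [AddCommGroup M] [Module k M] [AddCommGroup N] [Module k N]

/-- Whiskering on the left. -/
local infixr:81 " ◁ " => LinearMap.lTensor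

/-- Right-bracketing of `(V ⊗ (V ⊗ V)) ⊗ M`. -/
noncomputable def assoc₃ : (V ⊗[k] (V ⊗[k] V)) ⊗[k] M ≃ₗ[k] V ⊗[k] (V ⊗[k] (V ⊗[k] M)) :=
  (TensorProduct.assoc k V (V ⊗[k] V) M).trans
    (TensorProduct.congr (LinearEquiv.refl k V) (TensorProduct.assoc k V V M))

theorem assoc₃_tmul (x y z : V) (m : M) :
    assoc₃ ((x ⊗ₜ (y ⊗ₜ z)) ⊗ₜ m) = x ⊗ₜ[k] (y ⊗ₜ[k] (z ⊗ₜ[k] m)) := by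
  simp [assoc₃]

/-- Because N ⊗ k ≅ N, an identity with spectator k is as strong as the one without. -/
theorem eq_of_tmul_one {x y : N} (h : x ⊗ₜ[k] (1 : k) = y ⊗ₜ[k] (1 : k)) : x = y := by
  simpa using congrArg (TensorProduct.rid k N) h

theorem eq_of_assoc_tmul_one {x y : V ⊗[k] V}
    (h : TensorProduct.assoc k V V k (x ⊗ₜ[k] (1 : k)) =
      TensorProduct.assoc k V V k (y ⊗ₜ[k] (1 : k))) : x = y :=
  eq_of_tmul_one ((TensorProduct.assoc k V V k).injective h)

theorem eq_of_assoc₃_tmul_one {x y : V ⊗[k] (V ⊗[k] V)}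
    (h : assoc₃ (x ⊗ₜ[k] (1 : k)) = assoc₃ (y ⊗ₜ[k] (1 : k))) : x = y :=
  eq_of_tmul_one (assoc₃.injective h)

/-- This and the next three lemmas form the dictionary between the operators used to state the
axioms and those of the spectator calculus. -/
theorem act₂_assoc₃ (σ : V ⊗[k] V →ₗ[k] V ⊗[k] V) (w : V ⊗[k] (V ⊗[k] V)) (m : M) :
    act₂ σ (assoc₃ (w ⊗ₜ m)) = assoc₃ (op₁ σ w ⊗ₜ m) := by
  induction w with
  | zero => simp
  | add a b ha hb => simp only [TensorProduct.add_tmul, map_add, ha, hb]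
  | tmul x w =>
    induction w with
    | zero => simp
    | add a b ha hb =>
      simp only [TensorProduct.add_tmul, TensorProduct.tmul_add, map_add, ha, hb]
    | tmul y z =>
      rw [assoc₃_tmul, act₂_tmul]
      simp only [op₁, LinearMap.comp_apply, LinearEquiv.coe_coe, TensorProduct.assoc_symm_tmul,
        LinearMap.rTensor_tmul]
      induction σ (x ⊗ₜ y) with
      | zero => simp
      | add a b ha hb => simp only [TensorProduct.add_tmul, map_add, ha, hb]
      | tmul p q => simp [assoc₃_tmul]

theorem lTensor_act₂_assoc₃ (σ : V ⊗[k] V →ₗ[k] V ⊗[k] V) (w : V ⊗[k] (V ⊗[k] V)) (m : M) :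
    (V ◁ act₂ σ) (assoc₃ (w ⊗ₜ m)) = assoc₃ (op₂ σ w ⊗ₜ m) := by
  induction w with
  | zero => simp
  | add a b ha hb => simp only [TensorProduct.add_tmul, map_add, ha, hb]
  | tmul x w => simp [assoc₃, op₂, act₂_assoc]

theorem act₁_assoc₃ (μ : V ⊗[k] V →ₗ[k] V) (w : V ⊗[k] (V ⊗[k] V)) (m : M) :
    act₁ μ (assoc₃ (w ⊗ₜ m)) =
      TensorProduct.assoc k V V M
        (μ.rTensor V ((TensorProduct.assoc k V V V).symm w) ⊗ₜ m) := by
  induction w with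
  | zero => simp
  | add a b ha hb => simp only [TensorProduct.add_tmul, map_add, ha, hb]
  | tmul x w =>
    induction w with
    | zero => simp
    | add a b ha hb =>
      simp only [TensorProduct.add_tmul, TensorProduct.tmul_add, map_add, ha, hb]
    | tmul y z => simp [assoc₃_tmul, act₁_tmul]

theorem lTensor_act₁_assoc₃ (μ : V ⊗[k] V →ₗ[k] V) (w : V ⊗[k] (V ⊗[k] V)) (m : M) :
    (V ◁ act₁ μ) (assoc₃ (w ⊗ₜ m)) = TensorProduct.assoc k V V M (μ.lTensor V w ⊗ₜ m) := by
  induction w with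
  | zero => simp
  | add a b ha hb => simp only [TensorProduct.add_tmul, map_add, ha, hb]
  | tmul x w => simp [assoc₃, act₁_assoc]

/-- Here `w` need not be a pure tensor: the axioms are equalities of maps on V ⊗ V ⊗ V and apply to
`w` as it stands. -/
theorem exists_assoc₃ {P : V ⊗[k] (V ⊗[k] (V ⊗[k] M)) → Prop}
    (hadd : ∀ a b, P a → P b → P (a + b))
    (h : ∀ w m, P (assoc₃ (w ⊗ₜ m))) (u : V ⊗[k] (V ⊗[k] (V ⊗[k] M))) : P u := by
  obtain ⟨w, rfl⟩ := assoc₃.surjective u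
  induction w with
  | zero => simpa using h 0 0
  | add a b ha hb => rw [map_add]; exact hadd _ _ ha hb
  | tmul w m => exact h w m

theorem exists_assoc₂ {P : V ⊗[k] (V ⊗[k] M) → Prop}
    (hadd : ∀ a b, P a → P b → P (a + b))
    (h : ∀ (w : V ⊗[k] V) (m : M), P (TensorProduct.assoc k V V M (w ⊗ₜ m)))
    (u : V ⊗[k] (V ⊗[k] M)) : P u := by
  obtain ⟨w, rfl⟩ := (TensorProduct.assoc k V V M).surjective u
  induction w with
  | zero => simpa using h 0 0
  | add a b ha hb => rw [map_add]; exact hadd _ _ ha hb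
  | tmul w m => exact h w m

/-! Consequences of the axioms in the presence of further tensor factors on the right. -/

section Axioms

variable {μ : V ⊗[k] V →ₗ[k] V} {e : V} {σ : V ⊗[k] V →ₗ[k] V ⊗[k] V} {P : V →ₗ[k] V}

theorem IsBraiding.act₂ (h : IsBraiding σ) (u : V ⊗[k] (V ⊗[k] (V ⊗[k] M))) :
    act₂ σ ((V ◁ act₂ σ) (BraidedRB.act₂ σ u)) =
      (V ◁ BraidedRB.act₂ σ) (BraidedRB.act₂ σ ((V ◁ BraidedRB.act₂ σ) u)) := by
  induction u using exists_assoc₃ with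
  | hadd a b ha hb => simp only [map_add, ha, hb]
  | h w m =>
    have := LinearMap.congr_fun h w
    simp only [LinearMap.comp_apply] at this
    simp only [act₂_assoc₃, lTensor_act₂_assoc₃, this]

theorem isBraiding_of_act₂ (h : ∀ u : V ⊗[k] (V ⊗[k] (V ⊗[k] k)),
    act₂ σ ((V ◁ act₂ σ) (act₂ σ u)) = (V ◁ act₂ σ) (act₂ σ ((V ◁ act₂ σ) u))) :
    IsBraiding σ := by
  refine LinearMap.ext fun w => eq_of_assoc₃_tmul_one ?_
  simpa only [act₂_assoc₃, lTensor_act₂_assoc₃, LinearMap.comp_apply] using h (assoc₃ (w ⊗ₜ 1))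

theorem IsUnitalAlgebra.act₁_act₁ (h : IsUnitalAlgebra μ e)
    (u : V ⊗[k] (V ⊗[k] (V ⊗[k] M))) :
    act₁ μ (act₁ μ u) = act₁ μ ((V ◁ act₁ μ) u) := by
  suffices h : act₁ μ ∘ₗ act₁ μ = act₁ μ ∘ₗ (V ◁ act₁ μ) from LinearMap.congr_fun h u
  ext x y z m
  simp [act₁_tmul, h.assoc]

theorem IsUnitalAlgebra.act₁_one_tmul (h : IsUnitalAlgebra μ e) (u : V ⊗[k] M) :
    act₁ μ (e ⊗ₜ u) = u := by
  induction u with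
  | zero => simp
  | add a b ha hb => simp only [TensorProduct.tmul_add, map_add, ha, hb]
  | tmul x m => simp [act₁_tmul, h.one_mul]

theorem IsUnitalAlgebra.act₁_lTensor_one (h : IsUnitalAlgebra μ e) (u : V ⊗[k] M) :
    act₁ μ ((V ◁ TensorProduct.mk k V M e) u) = u := by
  induction u with
  | zero => simp
  | add a b ha hb => simp only [map_add, ha, hb]
  | tmul x m => simp [act₁_tmul, h.mul_one]

namespace IsBraidedUnitalAlgebra

theorem act₂_act₁ (h : IsBraidedUnitalAlgebra μ e σ) (u : V ⊗[k] (V ⊗[k] (V ⊗[k] M))) :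
    act₂ σ (act₁ μ u) = (V ◁ act₁ μ) (act₂ σ ((V ◁ act₂ σ) u)) := by
  induction u using exists_assoc₃ with
  | hadd a b ha hb => simp only [map_add, ha, hb]
  | h w m =>
    have := LinearMap.congr_fun h.braid_mul_left w
    simp only [LinearMap.comp_apply, LinearEquiv.coe_coe] at this
    simp only [act₂_assoc₃, lTensor_act₂_assoc₃, act₁_assoc₃, lTensor_act₁_assoc₃, this,
      act₂_assoc]

theorem act₂_lTensor_act₁ (h : IsBraidedUnitalAlgebra μ e σ)
    (u : V ⊗[k] (V ⊗[k] (V ⊗[k] M))) :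
    act₂ σ ((V ◁ act₁ μ) u) = act₁ μ ((V ◁ act₂ σ) (act₂ σ u)) := by
  induction u using exists_assoc₃ with
  | hadd a b ha hb => simp only [map_add, ha, hb]
  | h w m =>
    have := LinearMap.congr_fun h.braid_mul_right w
    simp only [LinearMap.comp_apply, LinearEquiv.coe_coe] at this
    simp only [act₂_assoc₃, lTensor_act₂_assoc₃, act₁_assoc₃, lTensor_act₁_assoc₃, this,
      act₂_assoc]

theorem act₂_lTensor_one (h : IsBraidedUnitalAlgebra μ e σ) (u : V ⊗[k] M) :
    act₂ σ ((V ◁ TensorProduct.mk k V M e) u) = e ⊗ₜ u := by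
  induction u with
  | zero => simp
  | add a b ha hb => simp only [TensorProduct.tmul_add, map_add, ha, hb]
  | tmul x m => simp [act₂_tmul, h.braid_one_right]

theorem act₂_one_tmul (h : IsBraidedUnitalAlgebra μ e σ) (u : V ⊗[k] M) :
    act₂ σ (e ⊗ₜ u) = (V ◁ TensorProduct.mk k V M e) u := by
  induction u with
  | zero => simp
  | add a b ha hb => simp only [TensorProduct.tmul_add, map_add, ha, hb]
  | tmul x m => simp [act₂_tmul, h.braid_one_left]

end IsBraidedUnitalAlgebra

theorem IsBraidedCommUnitalAlgebra.act₁_act₂ (h : IsBraidedCommUnitalAlgebra μ e σ)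
    (u : V ⊗[k] (V ⊗[k] M)) : act₁ μ (act₂ σ u) = act₁ μ u := by
  induction u using exists_assoc₂ with
  | hadd a b ha hb => simp only [map_add, ha, hb]
  | h w m => simp only [act₂_assoc, act₁_assoc, ← LinearMap.comp_apply, h.comm]

theorem act₂_act₂_of_involutive (h : σ ∘ₗ σ = LinearMap.id) (u : V ⊗[k] (V ⊗[k] M)) :
    act₂ σ (act₂ σ u) = u := by
  induction u using exists_assoc₂ with
  | hadd a b ha hb => simp only [map_add, ha, hb]
  | h w m => simp only [act₂_assoc, ← LinearMap.comp_apply, h, LinearMap.id_apply]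

namespace IsStronglyBraidedCommRotaBaxter

variable {lam : k}

theorem act₂_rTensor (h : IsStronglyBraidedCommRotaBaxter lam μ e σ P)
    (u : V ⊗[k] (V ⊗[k] M)) :
    act₂ σ (P.rTensor (V ⊗[k] M) u) = (V ◁ P.rTensor M) (act₂ σ u) := by
  induction u using exists_assoc₂ with
  | hadd a b ha hb => simp only [map_add, ha, hb]
  | h w m =>
    have e₁ : P.rTensor (V ⊗[k] M) (TensorProduct.assoc k V V M (w ⊗ₜ m)) =
        TensorProduct.assoc k V V M (P.rTensor V w ⊗ₜ m) := by
      induction w with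
      | zero => simp
      | add a b ha hb => simp only [TensorProduct.add_tmul, map_add, ha, hb]
      | tmul x y => simp
    have e₂ : ∀ t : V ⊗[k] V, (V ◁ P.rTensor M) (TensorProduct.assoc k V V M (t ⊗ₜ m)) =
        TensorProduct.assoc k V V M (P.lTensor V t ⊗ₜ m) := by
      intro t
      induction t with
      | zero => simp
      | add a b ha hb => simp only [TensorProduct.add_tmul, map_add, ha, hb]
      | tmul x y => simp
    have := LinearMap.congr_fun h.right_weak w
    simp only [LinearMap.comp_apply] at this
    rw [e₁, act₂_assoc, act₂_assoc, e₂, this]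

theorem act₂_lTensor_rTensor (h : IsStronglyBraidedCommRotaBaxter lam μ e σ P)
    (u : V ⊗[k] (V ⊗[k] M)) :
    act₂ σ ((V ◁ P.rTensor M) u) = P.rTensor (V ⊗[k] M) (act₂ σ u) := by
  induction u using exists_assoc₂ with
  | hadd a b ha hb => simp only [map_add, ha, hb]
  | h w m =>
    have e₁ : ∀ t : V ⊗[k] V, P.rTensor (V ⊗[k] M) (TensorProduct.assoc k V V M (t ⊗ₜ m)) =
        TensorProduct.assoc k V V M (P.rTensor V t ⊗ₜ m) := by
      intro t
      induction t with
      | zero => simp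
      | add a b ha hb => simp only [TensorProduct.add_tmul, map_add, ha, hb]
      | tmul x y => simp
    have e₂ : (V ◁ P.rTensor M) (TensorProduct.assoc k V V M (w ⊗ₜ m)) =
        TensorProduct.assoc k V V M (P.lTensor V w ⊗ₜ m) := by
      induction w with
      | zero => simp
      | add a b ha hb => simp only [TensorProduct.add_tmul, map_add, ha, hb]
      | tmul x y => simp
    have := LinearMap.congr_fun h.left_weak w
    simp only [LinearMap.comp_apply] at this
    rw [e₂, act₂_assoc, act₂_assoc, e₁, this]

theorem act₁_rTensor_rTensor (h : IsStronglyBraidedCommRotaBaxter lam μ e σ P)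
    (u : V ⊗[k] (V ⊗[k] M)) :
    act₁ μ (P.rTensor (V ⊗[k] M) ((V ◁ P.rTensor M) u)) =
      P.rTensor M (act₁ μ ((V ◁ P.rTensor M) u)) +
      P.rTensor M (act₁ μ (P.rTensor (V ⊗[k] M) u)) + lam • P.rTensor M (act₁ μ u) := by
  suffices h : act₁ μ ∘ₗ P.rTensor (V ⊗[k] M) ∘ₗ (V ◁ P.rTensor M) =
      P.rTensor M ∘ₗ act₁ μ ∘ₗ (V ◁ P.rTensor M) +
      P.rTensor M ∘ₗ act₁ μ ∘ₗ P.rTensor (V ⊗[k] M) + lam • P.rTensor M ∘ₗ act₁ μ from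
    LinearMap.congr_fun h u
  ext x y m
  simp [act₁_tmul, h.rotaBaxter x y, TensorProduct.add_tmul, TensorProduct.smul_tmul']

end IsStronglyBraidedCommRotaBaxter

/-- Only compatibility with the braidings is assumed, because this is also applied to the inclusion
`γ` of V in T. -/
theorem act₂_map_of_comp_eq {τ : W ⊗[k] W →ₗ[k] W ⊗[k] W} {f : V →ₗ[k] W}
    (h : TensorProduct.map f f ∘ₗ σ = τ ∘ₗ TensorProduct.map f f) (u : V ⊗[k] (V ⊗[k] M)) :
    act₂ τ (f.rTensor (W ⊗[k] M) ((V ◁ f.rTensor M) u)) =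
      f.rTensor (W ⊗[k] M) ((V ◁ f.rTensor M) (act₂ σ u)) := by
  have e₁ : ∀ (t : V ⊗[k] V) (m : M), f.rTensor (W ⊗[k] M) ((V ◁ f.rTensor M)
      (TensorProduct.assoc k V V M (t ⊗ₜ m))) =
        TensorProduct.assoc k W W M (TensorProduct.map f f t ⊗ₜ m) := by
    intro t m
    induction t with
    | zero => simp
    | add a b ha hb => simp only [TensorProduct.add_tmul, map_add, ha, hb]
    | tmul x y => simp
  induction u using exists_assoc₂ with
  | hadd a b ha hb => simp only [map_add, ha, hb]
  | h w m =>
    have := LinearMap.congr_fun h w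
    simp only [LinearMap.comp_apply] at this
    rw [e₁, act₂_assoc, act₂_assoc, e₁, this]

theorem IsBraidedAlgebraHom.act₂_map {μ' : W ⊗[k] W →ₗ[k] W} {e' : W}
    {τ : W ⊗[k] W →ₗ[k] W ⊗[k] W} {f : V →ₗ[k] W}
    (h : IsBraidedAlgebraHom μ e σ μ' e' τ f) (u : V ⊗[k] (V ⊗[k] M)) :
    act₂ τ (f.rTensor (W ⊗[k] M) ((V ◁ f.rTensor M) u)) =
      f.rTensor (W ⊗[k] M) ((V ◁ f.rTensor M) (act₂ σ u)) :=
  act₂_map_of_comp_eq h.map_braid u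

theorem comp_eq_of_act₂_map {τ : W ⊗[k] W →ₗ[k] W ⊗[k] W} {f : V →ₗ[k] W}
    (h : ∀ u : V ⊗[k] (V ⊗[k] k), act₂ τ (f.rTensor (W ⊗[k] k) ((V ◁ f.rTensor k) u)) =
      f.rTensor (W ⊗[k] k) ((V ◁ f.rTensor k) (act₂ σ u))) :
    TensorProduct.map f f ∘ₗ σ = τ ∘ₗ TensorProduct.map f f := by
  have e₁ : ∀ t : V ⊗[k] V, f.rTensor (W ⊗[k] k) ((V ◁ f.rTensor k)
      (TensorProduct.assoc k V V k (t ⊗ₜ 1))) =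
        TensorProduct.assoc k W W k (TensorProduct.map f f t ⊗ₜ 1) := by
    intro t
    induction t with
    | zero => simp
    | add a b ha hb => simp only [TensorProduct.add_tmul, map_add, ha, hb]
    | tmul x y => simp
  refine LinearMap.ext fun w => eq_of_assoc_tmul_one ?_
  have := h (TensorProduct.assoc k V V k (w ⊗ₜ 1))
  rw [e₁, act₂_assoc, act₂_assoc, e₁] at this
  exact this.symm

/-- The axioms of a strongly braided commutative Rota-Baxter algebra, from their forms with one
further tensor factor `k` on the right. -/
theorem isStronglyBraidedCommRotaBaxter_of_act {lam : k}
    (assoc : ∀ u : V ⊗[k] (V ⊗[k] (V ⊗[k] k)), act₁ μ (act₁ μ u) = act₁ μ ((V ◁ act₁ μ) u))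
    (one_mul : ∀ u : V ⊗[k] k, act₁ μ (e ⊗ₜ u) = u)
    (mul_one : ∀ u : V ⊗[k] k, act₁ μ ((V ◁ TensorProduct.mk k V k e) u) = u)
    (braid : ∀ u : V ⊗[k] (V ⊗[k] (V ⊗[k] k)),
      act₂ σ ((V ◁ act₂ σ) (act₂ σ u)) = (V ◁ act₂ σ) (act₂ σ ((V ◁ act₂ σ) u)))
    (braid_mul : ∀ u : V ⊗[k] (V ⊗[k] (V ⊗[k] k)),
      act₂ σ (act₁ μ u) = (V ◁ act₁ μ) (act₂ σ ((V ◁ act₂ σ) u)))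
    (braid_lTensor_mul : ∀ u : V ⊗[k] (V ⊗[k] (V ⊗[k] k)),
      act₂ σ ((V ◁ act₁ μ) u) = act₁ μ ((V ◁ act₂ σ) (act₂ σ u)))
    (braid_lTensor_one : ∀ u : V ⊗[k] k, act₂ σ ((V ◁ TensorProduct.mk k V k e) u) = e ⊗ₜ u)
    (braid_one : ∀ u : V ⊗[k] k, act₂ σ (e ⊗ₜ u) = (V ◁ TensorProduct.mk k V k e) u)
    (comm : ∀ u : V ⊗[k] (V ⊗[k] k), act₁ μ (act₂ σ u) = act₁ μ u)
    (rotaBaxter : ∀ u : V ⊗[k] (V ⊗[k] k), act₁ μ (P.rTensor (V ⊗[k] k) ((V ◁ P.rTensor k) u)) =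
      P.rTensor k (act₁ μ ((V ◁ P.rTensor k) u)) +
      P.rTensor k (act₁ μ (P.rTensor (V ⊗[k] k) u)) + lam • P.rTensor k (act₁ μ u))
    (right_weak : ∀ u : V ⊗[k] (V ⊗[k] k),
      act₂ σ (P.rTensor (V ⊗[k] k) u) = (V ◁ P.rTensor k) (act₂ σ u))
    (left_weak : ∀ u : V ⊗[k] (V ⊗[k] k),
      act₂ σ ((V ◁ P.rTensor k) u) = P.rTensor (V ⊗[k] k) (act₂ σ u)) :
    IsStronglyBraidedCommRotaBaxter lam μ e σ P where
  algebra :=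
    { assoc := fun x y z => eq_of_tmul_one (by
        simpa only [act₁_tmul, LinearMap.lTensor_tmul] using assoc (x ⊗ₜ (y ⊗ₜ (z ⊗ₜ 1))))
      one_mul := fun x => eq_of_tmul_one (by
        simpa only [act₁_tmul] using one_mul (x ⊗ₜ 1))
      mul_one := fun x => eq_of_tmul_one (by
        simpa only [act₁_tmul, LinearMap.lTensor_tmul, TensorProduct.mk_apply] using
          mul_one (x ⊗ₜ 1)) }
  braiding := isBraiding_of_act₂ braid
  braid_mul_left := LinearMap.ext fun w => eq_of_assoc_tmul_one (by
    simpa only [act₂_assoc₃, lTensor_act₂_assoc₃, act₁_assoc₃, lTensor_act₁_assoc₃, act₂_assoc,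
      LinearMap.comp_apply, LinearEquiv.coe_coe] using (braid_mul (assoc₃ (w ⊗ₜ 1))).symm)
  braid_mul_right := LinearMap.ext fun w => eq_of_assoc_tmul_one (by
    simpa only [act₂_assoc₃, lTensor_act₂_assoc₃, act₁_assoc₃, lTensor_act₁_assoc₃, act₂_assoc,
      LinearMap.comp_apply, LinearEquiv.coe_coe] using
      (braid_lTensor_mul (assoc₃ (w ⊗ₜ 1))).symm)
  braid_one_right := fun x => eq_of_assoc_tmul_one (by
    simpa only [act₂_tmul, LinearMap.lTensor_tmul, TensorProduct.mk_apply,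
      TensorProduct.assoc_tmul] using braid_lTensor_one (x ⊗ₜ 1))
  braid_one_left := fun x => eq_of_assoc_tmul_one (by
    simpa only [act₂_tmul, LinearMap.lTensor_tmul, TensorProduct.mk_apply,
      TensorProduct.assoc_tmul] using braid_one (x ⊗ₜ 1))
  comm := LinearMap.ext fun w => eq_of_tmul_one (by
    simpa only [act₂_assoc, act₁_assoc, LinearMap.comp_apply] using
      comm (TensorProduct.assoc k V V k (w ⊗ₜ 1)))
  rotaBaxter := fun x y => eq_of_tmul_one (by
    simpa only [act₁_tmul, LinearMap.lTensor_tmul, LinearMap.rTensor_tmul, TensorProduct.add_tmul,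
      TensorProduct.smul_tmul'] using rotaBaxter (x ⊗ₜ (y ⊗ₜ 1)))
  right_weak := TensorProduct.ext' fun x y => eq_of_assoc_tmul_one (by
    have h := right_weak (x ⊗ₜ (y ⊗ₜ 1))
    simp only [act₂_tmul, LinearMap.rTensor_tmul] at h
    rw [LinearMap.comp_apply, LinearMap.rTensor_tmul, h, LinearMap.comp_apply]
    induction σ (x ⊗ₜ y) with
    | zero => simp
    | add a b ha hb => simp only [TensorProduct.add_tmul, map_add, ha, hb]
    | tmul x y => simp)
  left_weak := TensorProduct.ext' fun x y => eq_of_assoc_tmul_one (by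
    have h := left_weak (x ⊗ₜ (y ⊗ₜ 1))
    simp only [act₂_tmul, LinearMap.rTensor_tmul, LinearMap.lTensor_tmul] at h
    rw [LinearMap.comp_apply, LinearMap.lTensor_tmul, h, LinearMap.comp_apply]
    induction σ (x ⊗ₜ y) with
    | zero => simp
    | add a b ha hb => simp only [TensorProduct.add_tmul, map_add, ha, hb]
    | tmul x y => simp)

theorem IsBraidedAlgebraHom.act₁_map {μ' : W ⊗[k] W →ₗ[k] W} {e' : W}
    {τ : W ⊗[k] W →ₗ[k] W ⊗[k] W} {f : V →ₗ[k] W}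
    (h : IsBraidedAlgebraHom μ e σ μ' e' τ f) (u : V ⊗[k] (V ⊗[k] M)) :
    act₁ μ' (f.rTensor (W ⊗[k] M) ((V ◁ f.rTensor M) u)) = f.rTensor M (act₁ μ u) := by
  suffices h : act₁ μ' ∘ₗ f.rTensor (W ⊗[k] M) ∘ₗ (V ◁ f.rTensor M) = f.rTensor M ∘ₗ act₁ μ from
    LinearMap.congr_fun h u
  ext x y m
  simp [act₁_tmul, h.map_mul]

end Axioms

end Bridge

/-! ### Shuffle systems: recursion and induction on words -/

section ShuffleSystem

variable {k : Type*} [CommRing k]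
variable {A T M N : Type*} [AddCommGroup A] [Module k A] [AddCommGroup T] [Module k T]
  [AddCommGroup M] [Module k M] [AddCommGroup N] [Module k N]
variable {lam : k} {μ : A ⊗[k] A →ₗ[k] A} {e : A} {σ : A ⊗[k] A →ₗ[k] A ⊗[k] A}
  {o : T} {c : A ⊗[k] T →ₗ[k] T} {δ : T ⊗[k] A →ₗ[k] A ⊗[k] T} {ε : A ⊗[k] T →ₗ[k] T ⊗[k] A}
  {B : T ⊗[k] T →ₗ[k] T ⊗[k] T} {s : T ⊗[k] T →ₗ[k] T}

local infixr:81 " ◁ " => LinearMap.lTensor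

local notation "𝛔" => act₂ σ
local notation "𝛅" => act₂ δ
local notation "𝛆" => act₂ ε
local notation "𝐁" => act₂ B
local notation "𝛍" => act₁ μ
local notation "𝐜" => act₁ c
local notation "𝐬" => act₁ s

/-- The recursive description of the tensor space `T` over `A` (with unit `o` and prepending map
`c`), of the braidings `δ`, `ε`, `B` between `A` and `T`, and of the quasi-shuffle product `s`. -/
structure IsShuffleSystem (lam : k) (μ : A ⊗[k] A →ₗ[k] A) (σ : A ⊗[k] A →ₗ[k] A ⊗[k] A)
    (o : T) (c : A ⊗[k] T →ₗ[k] T) (δ : T ⊗[k] A →ₗ[k] A ⊗[k] T) (ε : A ⊗[k] T →ₗ[k] T ⊗[k] A)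
    (B : T ⊗[k] T →ₗ[k] T ⊗[k] T) (s : T ⊗[k] T →ₗ[k] T) : Prop where
  eq_top : ∀ S : Submodule k T, o ∈ S → (∀ a x, x ∈ S → c (a ⊗ₜ x) ∈ S) → S = ⊤
  exists_leftInverse : ∃ d : T →ₗ[k] A ⊗[k] T, d ∘ₗ c = LinearMap.id
  delta_one : ∀ a, δ (o ⊗ₜ a) = a ⊗ₜ o
  delta_cons : ∀ a x b, δ (c (a ⊗ₜ x) ⊗ₜ b) = (A ◁ c) (act₂ σ (a ⊗ₜ δ (x ⊗ₜ b)))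
  eps_one : ∀ a, ε (a ⊗ₜ o) = o ⊗ₜ a
  eps_cons : ∀ a b y, ε (a ⊗ₜ c (b ⊗ₜ y)) = act₁ c ((A ◁ ε) (act₂ σ (a ⊗ₜ (b ⊗ₜ y))))
  braid_one : ∀ x, B (x ⊗ₜ o) = o ⊗ₜ x
  braid_cons : ∀ x b y, B (x ⊗ₜ c (b ⊗ₜ y)) = act₁ c ((A ◁ B) (act₂ δ (x ⊗ₜ (b ⊗ₜ y))))
  one_shuffle : ∀ x, s (o ⊗ₜ x) = x
  shuffle_one : ∀ x, s (x ⊗ₜ o) = x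
  shuffle_cons : ∀ a x b y, s (c (a ⊗ₜ x) ⊗ₜ c (b ⊗ₜ y)) =
    c (a ⊗ₜ s (x ⊗ₜ c (b ⊗ₜ y))) + c ((A ◁ s) (act₂ δ (c (a ⊗ₜ x) ⊗ₜ (b ⊗ₜ y)))) +
      lam • c (act₁ μ ((A ◁ A ◁ s) ((A ◁ act₂ δ) (a ⊗ₜ (x ⊗ₜ (b ⊗ₜ y))))))

namespace IsShuffleSystem

variable (H : IsShuffleSystem lam μ σ o c δ ε B s)
include H

/-- Closure under sums and multiples makes the property a submodule, to which `eq_top` applies. This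
replaces induction on length, with no grading on T. -/
theorem induction {p : T → Prop} (hadd : ∀ x y, p x → p y → p (x + y))
    (hsmul : ∀ (r : k) x, p x → p (r • x)) (hone : p o)
    (hcons : ∀ a x, p x → p (c (a ⊗ₜ x))) (x : T) : p x := by
  let S : Submodule k T :=
    { carrier := {x | p x}
      add_mem' := fun {a b} => hadd a b
      zero_mem' := by
        have := hsmul 0 o hone
        rwa [zero_smul] at this
      smul_mem' := hsmul }
  have hS : S = ⊤ := H.eq_top S hone hcons
  have : x ∈ S := hS ▸ Submodule.mem_top
  exact this

/-- The inductive step is posed for an arbitrary tensor and whiskered maps, although only pure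
tensors are needed; it can then be proved by rewriting composites. -/
theorem ext₁ {F G : T ⊗[k] M →ₗ[k] N} (h₀ : ∀ m, F (o ⊗ₜ m) = G (o ⊗ₜ m))
    (step : ∀ u : A ⊗[k] (T ⊗[k] M), (A ◁ F) u = (A ◁ G) u → F (𝐜 u) = G (𝐜 u))
    (u : T ⊗[k] M) : F u = G u := by
  suffices h : ∀ x m, F (x ⊗ₜ m) = G (x ⊗ₜ m) from
    LinearMap.congr_fun (TensorProduct.ext' h) u
  intro x
  induction x using H.induction with
  | hadd x y hx hy => intro m; simp only [TensorProduct.add_tmul, map_add, hx, hy]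
  | hsmul r x hx => intro m; simp only [← TensorProduct.smul_tmul', map_smul, hx]
  | hone => exact h₀
  | hcons a x ih =>
    intro m
    simpa only [act₁_tmul] using step (a ⊗ₜ (x ⊗ₜ m)) (by simp only [LinearMap.lTensor_tmul, ih])

/-- Double induction shaped by the quasi-shuffle recursion. The hypotheses correspond to detaching
the first letter of the left word, of the right word, or of both; a letter of the right word has
been carried to the front by δ. -/
theorem ext₂ {F G : T ⊗[k] (T ⊗[k] M) →ₗ[k] N}
    (h₀ : ∀ u, F (o ⊗ₜ u) = G (o ⊗ₜ u))
    (h₁ : ∀ u, F ((T ◁ TensorProduct.mk k T M o) u) = G ((T ◁ TensorProduct.mk k T M o) u))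
    (step : ∀ u : A ⊗[k] (T ⊗[k] (A ⊗[k] (T ⊗[k] M))),
      (A ◁ F) ((A ◁ T ◁ 𝐜) u) = (A ◁ G) ((A ◁ T ◁ 𝐜) u) →
      (A ◁ F) (𝛅 (𝐜 u)) = (A ◁ G) (𝛅 (𝐜 u)) →
      (A ◁ A ◁ F) ((A ◁ 𝛅) u) = (A ◁ A ◁ G) ((A ◁ 𝛅) u) →
      F ((T ◁ 𝐜) (𝐜 u)) = G ((T ◁ 𝐜) (𝐜 u)))
    (u : T ⊗[k] (T ⊗[k] M)) : F u = G u := by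
  suffices h : ∀ y x m, F (x ⊗ₜ (y ⊗ₜ m)) = G (x ⊗ₜ (y ⊗ₜ m)) from
    LinearMap.congr_fun (TensorProduct.ext_threefold' fun x y m => h y x m) u
  intro y
  induction y using H.induction with
  | hadd x y hx hy =>
    intro z m; simp only [TensorProduct.add_tmul, TensorProduct.tmul_add, map_add, hx, hy]
  | hsmul r x hx =>
    intro z m; simp only [← TensorProduct.smul_tmul', TensorProduct.tmul_smul, map_smul, hx]
  | hone => exact fun x m => h₁ (x ⊗ₜ m)
  | hcons b y ihy =>
    intro x
    -- The hypothesis on `y` is needed for every left factor at once, since δ turns the left word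
    -- into a sum of other words.
    have hy : ∀ v, F ((T ◁ TensorProduct.mk k T M y) v) =
        G ((T ◁ TensorProduct.mk k T M y) v) := fun v =>
      LinearMap.congr_fun (f := F ∘ₗ (T ◁ TensorProduct.mk k T M y))
        (g := G ∘ₗ (T ◁ TensorProduct.mk k T M y)) (TensorProduct.ext' fun x m => ihy x m) v
    induction x using H.induction with
    | hadd x y hx hy => intro m; simp only [TensorProduct.add_tmul, map_add, hx, hy]
    | hsmul r x hx => intro m; simp only [← TensorProduct.smul_tmul', map_smul, hx]
    | hone => exact fun m => h₀ _
    | hcons a x ih =>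
      intro m
      -- δ does not touch `y`. Writing it as inserted by a map on the tail lets the interchange law
      -- bring the tensor into the form required by `hy`.
      have hu : a ⊗ₜ[k] (x ⊗ₜ[k] (b ⊗ₜ[k] (y ⊗ₜ[k] m))) =
          (A ◁ T ◁ A ◁ TensorProduct.mk k T M y) (a ⊗ₜ (x ⊗ₜ (b ⊗ₜ m))) := by simp
      have := step (a ⊗ₜ (x ⊗ₜ (b ⊗ₜ (y ⊗ₜ m))))
      simp only [act₁_tmul, LinearMap.lTensor_tmul] at this
      refine this (by rw [ih]) ?_ ?_
      · have h := congrArg (fun v => 𝐜 v) hu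
        simp only [act₁_tmul, act₁_lTensor] at h
        rw [h, act₂_lTensor]
        exact whisker₂₂ A hy _
      · have h : 𝛅 (x ⊗ₜ[k] (b ⊗ₜ[k] (y ⊗ₜ[k] m))) =
            (A ◁ T ◁ TensorProduct.mk k T M y) (𝛅 (x ⊗ₜ[k] (b ⊗ₜ[k] m))) := by
          rw [← act₂_lTensor]; simp
        rw [h, whisker₂₂ A hy]

/-! Recursions in the presence of further tensor factors on the right. -/

theorem act_delta_one (u : A ⊗[k] M) :
    𝛅 (o ⊗ₜ u) = (A ◁ TensorProduct.mk k T M o) u := by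
  induction u with
  | zero => simp
  | add a b ha hb => simp only [TensorProduct.tmul_add, map_add, ha, hb]
  | tmul x m => simp [act₂_tmul, H.delta_one]

theorem act_delta_cons (u : A ⊗[k] (T ⊗[k] (A ⊗[k] M))) :
    𝛅 (𝐜 u) = (A ◁ 𝐜) (𝛔 ((A ◁ 𝛅) u)) := by
  suffices h : act₂ δ ∘ₗ act₁ c = (A ◁ act₁ c) ∘ₗ act₂ σ ∘ₗ (A ◁ act₂ δ (M := M)) from
    LinearMap.congr_fun h u
  ext a x b m
  simp only [TensorProduct.AlgebraTensorModule.curry_apply, LinearMap.restrictScalars_self,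
    TensorProduct.curry_apply, LinearMap.comp_apply, LinearMap.lTensor_tmul, act₂_tmul, act₁_tmul,
    H.delta_cons]
  induction δ (x ⊗ₜ b) with
  | zero => simp
  | add p q hp hq => simp only [TensorProduct.add_tmul, TensorProduct.tmul_add, map_add, hp, hq]
  | tmul b x =>
    simp only [act₂_tmul, TensorProduct.assoc_tmul]
    induction σ (a ⊗ₜ b) with
    | zero => simp
    | add p q hp hq => simp only [TensorProduct.add_tmul, map_add, hp, hq]
    | tmul b a => simp [act₁_tmul]

theorem act_eps_one (u : A ⊗[k] M) :
    𝛆 ((A ◁ TensorProduct.mk k T M o) u) = o ⊗ₜ u := by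
  induction u with
  | zero => simp
  | add a b ha hb => simp only [TensorProduct.tmul_add, map_add, ha, hb]
  | tmul x m => simp [act₂_tmul, H.eps_one]

theorem act_eps_cons (u : A ⊗[k] (A ⊗[k] (T ⊗[k] M))) :
    𝛆 ((A ◁ 𝐜) u) = 𝐜 ((A ◁ 𝛆) (𝛔 u)) := by
  suffices h : act₂ ε ∘ₗ (A ◁ act₁ c (M := M)) = act₁ c ∘ₗ (A ◁ act₂ ε) ∘ₗ act₂ σ from
    LinearMap.congr_fun h u
  ext a b x m
  simp only [TensorProduct.AlgebraTensorModule.curry_apply, LinearMap.restrictScalars_self,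
    TensorProduct.curry_apply, LinearMap.comp_apply, LinearMap.lTensor_tmul, act₂_tmul, act₁_tmul,
    H.eps_cons]
  induction σ (a ⊗ₜ b) with
  | zero => simp
  | add p q hp hq => simp only [TensorProduct.add_tmul, map_add, hp, hq]
  | tmul b a =>
    simp only [act₂_tmul, TensorProduct.assoc_tmul, LinearMap.lTensor_tmul]
    induction ε (a ⊗ₜ x) with
    | zero => simp
    | add p q hp hq => simp only [TensorProduct.add_tmul, TensorProduct.tmul_add, map_add, hp, hq]
    | tmul b a => simp [act₁_tmul]

theorem act_braid_one (u : T ⊗[k] M) :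
    𝐁 ((T ◁ TensorProduct.mk k T M o) u) = o ⊗ₜ u := by
  induction u with
  | zero => simp
  | add a b ha hb => simp only [TensorProduct.tmul_add, map_add, ha, hb]
  | tmul x m => simp [act₂_tmul, H.braid_one]

theorem act_braid_cons (u : T ⊗[k] (A ⊗[k] (T ⊗[k] M))) :
    𝐁 ((T ◁ 𝐜) u) = 𝐜 ((A ◁ 𝐁) (𝛅 u)) := by
  suffices h : act₂ B ∘ₗ (T ◁ act₁ c (M := M)) = act₁ c ∘ₗ (A ◁ act₂ B) ∘ₗ act₂ δ from
    LinearMap.congr_fun h u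
  ext a b x m
  simp only [TensorProduct.AlgebraTensorModule.curry_apply, LinearMap.restrictScalars_self,
    TensorProduct.curry_apply, LinearMap.comp_apply, LinearMap.lTensor_tmul, act₂_tmul, act₁_tmul,
    H.braid_cons]
  induction δ (a ⊗ₜ b) with
  | zero => simp
  | add p q hp hq => simp only [TensorProduct.add_tmul, map_add, hp, hq]
  | tmul b a =>
    simp only [act₂_tmul, TensorProduct.assoc_tmul, LinearMap.lTensor_tmul]
    induction B (a ⊗ₜ x) with
    | zero => simp
    | add p q hp hq => simp only [TensorProduct.add_tmul, TensorProduct.tmul_add, map_add, hp, hq]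
    | tmul b a => simp [act₁_tmul]

theorem act_one_shuffle (u : T ⊗[k] M) : 𝐬 (o ⊗ₜ u) = u := by
  induction u with
  | zero => simp
  | add a b ha hb => simp only [TensorProduct.tmul_add, map_add, ha, hb]
  | tmul x m => simp [act₁_tmul, H.one_shuffle]

theorem act_shuffle_one (u : T ⊗[k] M) : 𝐬 ((T ◁ TensorProduct.mk k T M o) u) = u := by
  induction u with
  | zero => simp
  | add a b ha hb => simp only [map_add, ha, hb]
  | tmul x m => simp [act₁_tmul, H.shuffle_one]

theorem act_shuffle_cons (u : A ⊗[k] (T ⊗[k] (A ⊗[k] (T ⊗[k] M)))) :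
    𝐬 ((T ◁ 𝐜) (𝐜 u)) = 𝐜 ((A ◁ 𝐬) ((A ◁ T ◁ 𝐜) u) + (A ◁ 𝐬) (𝛅 (𝐜 u)) +
      lam • 𝛍 ((A ◁ A ◁ 𝐬) ((A ◁ 𝛅) u))) := by
  suffices h : act₁ s ∘ₗ (T ◁ act₁ c (M := M)) ∘ₗ act₁ c =
      act₁ c ∘ₗ ((A ◁ act₁ s) ∘ₗ (A ◁ T ◁ act₁ c) + (A ◁ act₁ s) ∘ₗ act₂ δ ∘ₗ act₁ c +
        lam • act₁ μ ∘ₗ (A ◁ A ◁ act₁ s) ∘ₗ (A ◁ act₂ δ)) from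
    LinearMap.congr_fun h u
  ext a x b y m
  simp only [TensorProduct.AlgebraTensorModule.curry_apply, LinearMap.restrictScalars_self,
    TensorProduct.curry_apply, LinearMap.comp_apply, LinearMap.lTensor_tmul, act₂_tmul, act₁_tmul,
    H.shuffle_cons, LinearMap.add_apply, LinearMap.smul_apply, map_add, map_smul,
    TensorProduct.add_tmul, ← TensorProduct.smul_tmul']
  congr 1
  · congr 1
    induction δ (c (a ⊗ₜ x) ⊗ₜ b) with
    | zero => simp
    | add p q hp hq => simp only [TensorProduct.add_tmul, map_add, hp, hq]
    | tmul b a => simp [act₁_tmul]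
  · congr 1
    induction δ (x ⊗ₜ b) with
    | zero => simp
    | add p q hp hq =>
      simp only [TensorProduct.add_tmul, TensorProduct.tmul_add, map_add, hp, hq]
    | tmul b a => simp [act₁_tmul]

end IsShuffleSystem

/-! ### Moving a letter through a word -/

namespace IsShuffleSystem

variable (H : IsShuffleSystem lam μ σ o c δ ε B s) (hA : IsBraidedCommUnitalAlgebra μ e σ)

include H

theorem lTensor_delta_cons (X : Type*) [AddCommGroup X] [Module k X]
    (u : X ⊗[k] (A ⊗[k] (T ⊗[k] (A ⊗[k] M)))) :
    (X ◁ 𝛅) ((X ◁ 𝐜) u) = (X ◁ A ◁ 𝐜) ((X ◁ 𝛔) ((X ◁ A ◁ 𝛅) u)) :=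
  whisker₂₃ X H.act_delta_cons u

include hA

/-- The unit of `A` passes through `T`. -/
theorem delta_unit (u : T ⊗[k] M) : 𝛅 ((T ◁ TensorProduct.mk k A M e) u) = e ⊗ₜ u := by
  refine H.ext₁ (F := act₂ δ ∘ₗ (T ◁ TensorProduct.mk k A M e))
    (G := TensorProduct.mk k A (T ⊗[k] M) e) (fun m => ?_) (fun u ih => ?_) u
  · simp [H.act_delta_one]
  · simp only [LinearMap.lTensor_comp, LinearMap.comp_apply, TensorProduct.mk_apply] at ih ⊢
    rw [← act₁_lTensor, H.act_delta_cons, ih, hA.act₂_lTensor_one, LinearMap.lTensor_tmul]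

/-- The braiding `δ` is natural with respect to `σ`. -/
theorem delta_sigma (u : T ⊗[k] (A ⊗[k] (A ⊗[k] M))) :
    𝛔 ((A ◁ 𝛅) (𝛅 u)) = (A ◁ 𝛅) (𝛅 ((T ◁ 𝛔) u)) := by
  refine H.ext₁ (F := act₂ σ ∘ₗ (A ◁ act₂ δ) ∘ₗ act₂ δ)
    (G := (A ◁ act₂ δ) ∘ₗ act₂ δ ∘ₗ (T ◁ act₂ σ)) (fun m => ?_) (fun u ih => ?_) u
  · simp only [LinearMap.comp_apply, LinearMap.lTensor_tmul, H.act_delta_one]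
    have := whisker₂₂ A (f := 𝛅) (g := TensorProduct.mk k T (A ⊗[k] M) o)
      (f' := (A ◁ TensorProduct.mk k T M o)) (g' := LinearMap.id) H.act_delta_one
    simp only [LinearMap.lTensor_id, LinearMap.id_apply] at this
    rw [this, this, act₂_lTensor]
  · simp only [LinearMap.lTensor_comp, LinearMap.comp_apply] at ih ⊢
    -- Two letters cross the first letter of the word: this is the Yang-Baxter equation for σ,
    -- followed by the induction hypothesis on the tail.
    rw [H.act_delta_cons, H.lTensor_delta_cons, ← act₁_lTensor, H.act_delta_cons,
      H.lTensor_delta_cons, act₂_lTensor, ← act₂_lTensor σ (𝛅),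
      hA.braiding.act₂, ih, act₂_lTensor σ (𝛅)]

/-- The braiding `δ` is natural with respect to the product of `A`. -/
theorem delta_mul (u : T ⊗[k] (A ⊗[k] (A ⊗[k] M))) :
    𝛅 ((T ◁ 𝛍) u) = 𝛍 ((A ◁ 𝛅) (𝛅 u)) := by
  refine H.ext₁ (F := act₂ δ ∘ₗ (T ◁ act₁ μ))
    (G := act₁ μ ∘ₗ (A ◁ act₂ δ) ∘ₗ act₂ δ) (fun m => ?_) (fun u ih => ?_) u
  · simp only [LinearMap.comp_apply, LinearMap.lTensor_tmul, H.act_delta_one]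
    have := whisker₂₂ A (f := 𝛅) (g := TensorProduct.mk k T (A ⊗[k] M) o)
      (f' := (A ◁ TensorProduct.mk k T M o)) (g' := LinearMap.id) H.act_delta_one
    simp only [LinearMap.lTensor_id, LinearMap.id_apply] at this
    rw [this, act₁_lTensor]
  · simp only [LinearMap.lTensor_comp, LinearMap.comp_apply] at ih ⊢
    -- At the first letter of the word the claim is the axiom σ(id ⊗ μ) = (μ ⊗ id)σ₂σ₁.
    rw [H.act_delta_cons, H.lTensor_delta_cons, ← act₁_lTensor, H.act_delta_cons, ih,
      hA.act₂_lTensor_act₁, act₁_lTensor, ← act₂_lTensor σ (𝛅)]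

end IsShuffleSystem

namespace IsShuffleSystem

variable (H : IsShuffleSystem lam μ σ o c δ ε B s) (hA : IsBraidedCommUnitalAlgebra μ e σ)

include H

theorem lTensor_shuffle_cons (X : Type*) [AddCommGroup X] [Module k X]
    (u : X ⊗[k] (A ⊗[k] (T ⊗[k] (A ⊗[k] (T ⊗[k] M))))) :
    (X ◁ 𝐬) ((X ◁ T ◁ 𝐜) ((X ◁ 𝐜) u)) = (X ◁ 𝐜) ((X ◁ A ◁ 𝐬) ((X ◁ A ◁ T ◁ 𝐜) u) +
      (X ◁ A ◁ 𝐬) ((X ◁ 𝛅) ((X ◁ 𝐜) u)) +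
      lam • (X ◁ 𝛍) ((X ◁ A ◁ A ◁ 𝐬) ((X ◁ A ◁ 𝛅) u))) := by
  have e : act₁ s ∘ₗ (T ◁ act₁ c (M := M)) ∘ₗ act₁ c =
      act₁ c ∘ₗ ((A ◁ act₁ s) ∘ₗ (A ◁ T ◁ act₁ c) + (A ◁ act₁ s) ∘ₗ act₂ δ ∘ₗ act₁ c +
        lam • act₁ μ ∘ₗ (A ◁ A ◁ act₁ s) ∘ₗ (A ◁ act₂ δ)) :=
    LinearMap.ext H.act_shuffle_cons
  simpa only [LinearMap.lTensor_comp, LinearMap.lTensor_add, LinearMap.lTensor_smul,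
    LinearMap.comp_apply, LinearMap.add_apply, LinearMap.smul_apply] using
    LinearMap.congr_fun (congrArg (LinearMap.lTensor X) e) u

theorem lTensor_one_shuffle (X : Type*) [AddCommGroup X] [Module k X]
    (u : X ⊗[k] (T ⊗[k] M)) :
    (X ◁ 𝐬) ((X ◁ TensorProduct.mk k T (T ⊗[k] M) o) u) = u :=
  whisker₂₀ X (f := 𝐬) (g := TensorProduct.mk k T (T ⊗[k] M) o) H.act_one_shuffle u

theorem lTensor_delta_one (X : Type*) [AddCommGroup X] [Module k X]
    (u : X ⊗[k] (A ⊗[k] M)) :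
    (X ◁ 𝛅) ((X ◁ TensorProduct.mk k T (A ⊗[k] M) o) u) =
      (X ◁ A ◁ TensorProduct.mk k T M o) u :=
  whisker₂₁ X (f := 𝛅) (g := TensorProduct.mk k T (A ⊗[k] M) o) H.act_delta_one u

theorem lTensor_shuffle_one (X : Type*) [AddCommGroup X] [Module k X]
    (u : X ⊗[k] (T ⊗[k] M)) :
    (X ◁ 𝐬) ((X ◁ T ◁ TensorProduct.mk k T M o) u) = u :=
  whisker₂₀ X H.act_shuffle_one u

include hA

/-- The braiding `δ` is natural with respect to the quasi-shuffle product. -/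
theorem delta_shuffle (u : T ⊗[k] (T ⊗[k] (A ⊗[k] M))) :
    𝛅 (𝐬 u) = (A ◁ 𝐬) (𝛅 ((T ◁ 𝛅) u)) := by
  refine H.ext₂ (F := act₂ δ ∘ₗ act₁ s)
    (G := (A ◁ act₁ s) ∘ₗ act₂ δ ∘ₗ (T ◁ act₂ δ)) (fun u => ?_) (fun u => ?_)
    (fun u ihx ihy ihxy => ?_) u
  · simp only [LinearMap.comp_apply, LinearMap.lTensor_tmul, H.act_one_shuffle, H.act_delta_one,
      H.lTensor_one_shuffle]
  · simp only [LinearMap.comp_apply]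
    rw [H.act_shuffle_one, whisker₂₁ T (f := 𝛅) (g := TensorProduct.mk k T (A ⊗[k] M) o)
      H.act_delta_one, act₂_lTensor, H.lTensor_shuffle_one]
  · simp only [LinearMap.lTensor_comp, LinearMap.comp_apply] at ihx ihy ihxy ⊢
    rw [H.act_shuffle_cons, H.lTensor_delta_cons T, ← act₁_lTensor, ← act₁_lTensor,
      act₂_lTensor, H.act_delta_cons (_ + _), H.act_delta_cons ((A ◁ T ◁ 𝛔) _), H.lTensor_shuffle_cons]
    simp only [map_add, map_smul]
    rw [ihx, ihy, ← act₁_lTensor μ (𝛅), ihxy]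
    congr 1
    · congr 1
      · rw [act₂_lTensor, whisker₂₃ A (H.lTensor_delta_cons T), lTensor_act₂, act₂_lTensor]
      -- The first letter of the right word and the incoming letter both cross the left word. By
      -- `delta_sigma` they may be exchanged before or after doing so.
      · rw [act₂_lTensor, ← act₂_lTensor δ (𝛅), H.delta_sigma hA, ← act₁_lTensor,
          ← act₁_lTensor, H.act_delta_cons]
    -- Now the incoming letter meets a product of two letters; σ(μ ⊗ id) = (id ⊗ μ)σ₁σ₂ splits this
    -- into two crossings, and `delta_sigma` treats the inner one.
    · rw [hA.act₂_act₁, lTensor_act₂, act₂_lTensor, ← lTensor_act₂ A δ (𝛅),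
        whisker₃₃ A (H.delta_sigma hA), act₂_lTensor]

end IsShuffleSystem

/-! ### Associativity of the quasi-shuffle product -/

/-- The three summands of the quasi-shuffle recursion: the first letter of the product comes from
the left factor. -/
noncomputable def leftPart (c : A ⊗[k] T →ₗ[k] T) (s : T ⊗[k] T →ₗ[k] T) :
    A ⊗[k] (T ⊗[k] (A ⊗[k] (T ⊗[k] M))) →ₗ[k] A ⊗[k] (T ⊗[k] M) :=
  (A ◁ act₁ s) ∘ₗ (A ◁ T ◁ act₁ c)

/-- The first letter of the product comes from the right factor. -/
noncomputable def rightPart (c : A ⊗[k] T →ₗ[k] T) (δ : T ⊗[k] A →ₗ[k] A ⊗[k] T)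
    (s : T ⊗[k] T →ₗ[k] T) :
    A ⊗[k] (T ⊗[k] (A ⊗[k] (T ⊗[k] M))) →ₗ[k] A ⊗[k] (T ⊗[k] M) :=
  (A ◁ act₁ s) ∘ₗ act₂ δ ∘ₗ act₁ c

/-- The first letter of the product is the product of the two first letters. -/
noncomputable def mulPart (μ : A ⊗[k] A →ₗ[k] A) (δ : T ⊗[k] A →ₗ[k] A ⊗[k] T)
    (s : T ⊗[k] T →ₗ[k] T) :
    A ⊗[k] (T ⊗[k] (A ⊗[k] (T ⊗[k] M))) →ₗ[k] A ⊗[k] (T ⊗[k] M) :=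
  act₁ μ ∘ₗ (A ◁ A ◁ act₁ s) ∘ₗ (A ◁ act₂ δ)

/-- The quasi-shuffle recursion. -/
noncomputable def recPart (lam : k) (μ : A ⊗[k] A →ₗ[k] A) (c : A ⊗[k] T →ₗ[k] T)
    (δ : T ⊗[k] A →ₗ[k] A ⊗[k] T) (s : T ⊗[k] T →ₗ[k] T) :
    A ⊗[k] (T ⊗[k] (A ⊗[k] (T ⊗[k] M))) →ₗ[k] A ⊗[k] (T ⊗[k] M) :=
  leftPart c s + rightPart c δ s + lam • mulPart μ δ s

theorem recPart_apply (u : A ⊗[k] (T ⊗[k] (A ⊗[k] (T ⊗[k] M)))) :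
    recPart lam μ c δ s u = leftPart c s u + rightPart c δ s u + lam • mulPart μ δ s u :=
  rfl

theorem lTensor_recPart (X : Type*) [AddCommGroup X] [Module k X]
    (u : X ⊗[k] (T ⊗[k] (A ⊗[k] (T ⊗[k] (A ⊗[k] (T ⊗[k] M)))))) :
    (X ◁ T ◁ recPart lam μ c δ s) u = (X ◁ T ◁ leftPart c s) u + (X ◁ T ◁ rightPart c δ s) u +
      lam • (X ◁ T ◁ mulPart μ δ s) u := by
  simp only [recPart, LinearMap.lTensor_add, LinearMap.lTensor_smul, LinearMap.add_apply,
      LinearMap.smul_apply]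

namespace IsShuffleSystem

variable (H : IsShuffleSystem lam μ σ o c δ ε B s) (hA : IsBraidedCommUnitalAlgebra μ e σ)

include H

/-- There are seven induction hypotheses, one for each nonempty set of words losing their first
letter, with the detached letters carried to the front. They are what the expansion of a triple
quasi-shuffle product calls for. -/
theorem ext₃ {F G : T ⊗[k] (T ⊗[k] (T ⊗[k] M)) →ₗ[k] N}
    (h₀ : ∀ u, F (o ⊗ₜ u) = G (o ⊗ₜ u))
    (h₁ : ∀ u, F ((T ◁ TensorProduct.mk k T (T ⊗[k] M) o) u) =
      G ((T ◁ TensorProduct.mk k T (T ⊗[k] M) o) u))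
    (h₂ : ∀ u, F ((T ◁ T ◁ TensorProduct.mk k T M o) u) =
      G ((T ◁ T ◁ TensorProduct.mk k T M o) u))
    (step : ∀ u : A ⊗[k] (T ⊗[k] (A ⊗[k] (T ⊗[k] (A ⊗[k] (T ⊗[k] M))))),
      (A ◁ F) ((A ◁ T ◁ T ◁ 𝐜) ((A ◁ T ◁ 𝐜) u)) = (A ◁ G) ((A ◁ T ◁ T ◁ 𝐜) ((A ◁ T ◁ 𝐜) u)) →
      (A ◁ F) ((A ◁ T ◁ T ◁ 𝐜) (𝛅 (𝐜 u))) = (A ◁ G) ((A ◁ T ◁ T ◁ 𝐜) (𝛅 (𝐜 u))) →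
      (A ◁ A ◁ F) ((A ◁ A ◁ T ◁ T ◁ 𝐜) ((A ◁ 𝛅) u)) =
        (A ◁ A ◁ G) ((A ◁ A ◁ T ◁ T ◁ 𝐜) ((A ◁ 𝛅) u)) →
      (A ◁ F) (𝛅 ((T ◁ 𝛅) ((T ◁ 𝐜) (𝐜 u)))) = (A ◁ G) (𝛅 ((T ◁ 𝛅) ((T ◁ 𝐜) (𝐜 u)))) →
      (A ◁ A ◁ F) ((A ◁ 𝛅) ((A ◁ T ◁ 𝛅) ((A ◁ T ◁ 𝐜) u))) =
        (A ◁ A ◁ G) ((A ◁ 𝛅) ((A ◁ T ◁ 𝛅) ((A ◁ T ◁ 𝐜) u))) →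
      (A ◁ A ◁ F) ((A ◁ 𝛅) (𝛅 ((T ◁ A ◁ 𝛅) (𝐜 u)))) =
        (A ◁ A ◁ G) ((A ◁ 𝛅) (𝛅 ((T ◁ A ◁ 𝛅) (𝐜 u)))) →
      (A ◁ A ◁ A ◁ F) ((A ◁ A ◁ 𝛅) ((A ◁ 𝛅) ((A ◁ T ◁ A ◁ 𝛅) u))) =
        (A ◁ A ◁ A ◁ G) ((A ◁ A ◁ 𝛅) ((A ◁ 𝛅) ((A ◁ T ◁ A ◁ 𝛅) u))) →
      F ((T ◁ T ◁ 𝐜) ((T ◁ 𝐜) (𝐜 u))) = G ((T ◁ T ◁ 𝐜) ((T ◁ 𝐜) (𝐜 u))))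
    (u : T ⊗[k] (T ⊗[k] (T ⊗[k] M))) : F u = G u := by
  suffices h : ∀ z y x m, F (x ⊗ₜ (y ⊗ₜ (z ⊗ₜ m))) = G (x ⊗ₜ (y ⊗ₜ (z ⊗ₜ m))) by
    suffices h' : F = G by rw [h']
    ext x y z m
    exact h z y x m
  intro z
  induction z using H.induction with
  | hadd x y hx hy =>
    intro z w m; simp only [TensorProduct.add_tmul, TensorProduct.tmul_add, map_add, hx, hy]
  | hsmul r x hx =>
    intro z w m; simp only [← TensorProduct.smul_tmul', TensorProduct.tmul_smul, map_smul, hx]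
  | hone => exact fun y x m => h₂ (x ⊗ₜ (y ⊗ₜ m))
  | hcons d z ihz =>
  have hz : ∀ v, F ((T ◁ T ◁ TensorProduct.mk k T M z) v) =
      G ((T ◁ T ◁ TensorProduct.mk k T M z) v) := fun v =>
    LinearMap.congr_fun (f := F ∘ₗ (T ◁ T ◁ TensorProduct.mk k T M z))
      (g := G ∘ₗ (T ◁ T ◁ TensorProduct.mk k T M z))
      (TensorProduct.ext_threefold' fun x y m => ihz y x m) v
  intro y
  induction y using H.induction with
  | hadd x y hx hy =>
    intro z m; simp only [TensorProduct.add_tmul, TensorProduct.tmul_add, map_add, hx, hy]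
  | hsmul r x hx =>
    intro z m; simp only [← TensorProduct.smul_tmul', TensorProduct.tmul_smul, map_smul, hx]
  | hone => exact fun x m => h₁ (x ⊗ₜ (_ ⊗ₜ m))
  | hcons b y ihy =>
  -- The tail of the second word and the whole third word are packed into the spectator, which makes
  -- the hypothesis on `y` a statement about all of T ⊗ M.
  let g : M →ₗ[k] T ⊗[k] (A ⊗[k] (T ⊗[k] M)) :=
    TensorProduct.mk k T _ y ∘ₗ TensorProduct.mk k A _ d ∘ₗ TensorProduct.mk k T M z
  have hy : ∀ v, F ((T ◁ T ◁ 𝐜) ((T ◁ g) v)) = G ((T ◁ T ◁ 𝐜) ((T ◁ g) v)) := fun v =>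
    LinearMap.congr_fun (f := F ∘ₗ (T ◁ T ◁ 𝐜) ∘ₗ (T ◁ g))
      (g := G ∘ₗ (T ◁ T ◁ 𝐜) ∘ₗ (T ◁ g))
      (TensorProduct.ext' fun x m => by simpa [g, act₁_tmul] using ihy x m) v
  intro x
  induction x using H.induction with
  | hadd x y hx hy => intro m; simp only [TensorProduct.add_tmul, map_add, hx, hy]
  | hsmul r x hx => intro m; simp only [← TensorProduct.smul_tmul', map_smul, hx]
  | hone => exact fun m => h₀ _
  | hcons a x ih =>
  intro m
  have hu : a ⊗ₜ[k] (x ⊗ₜ[k] (b ⊗ₜ[k] (y ⊗ₜ[k] (d ⊗ₜ[k] (z ⊗ₜ[k] m))))) =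
      (A ◁ T ◁ A ◁ g) (a ⊗ₜ (x ⊗ₜ (b ⊗ₜ m))) := by simp [g]
  have hu' : a ⊗ₜ[k] (x ⊗ₜ[k] (b ⊗ₜ[k] (y ⊗ₜ[k] (d ⊗ₜ[k] (z ⊗ₜ[k] m))))) =
      (A ◁ T ◁ A ◁ T ◁ A ◁ TensorProduct.mk k T M z)
        (a ⊗ₜ (x ⊗ₜ (b ⊗ₜ (y ⊗ₜ (d ⊗ₜ m))))) := by simp
  have hu'' : (A ◁ T ◁ 𝐜) (a ⊗ₜ[k] (x ⊗ₜ[k] (b ⊗ₜ[k] (y ⊗ₜ[k] (d ⊗ₜ[k] (z ⊗ₜ[k] m)))))) =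
      (A ◁ T ◁ T ◁ A ◁ TensorProduct.mk k T M z)
        (a ⊗ₜ (x ⊗ₜ (c (b ⊗ₜ y) ⊗ₜ (d ⊗ₜ m)))) := by simp [act₁_tmul]
  have key := step (a ⊗ₜ (x ⊗ₜ (b ⊗ₜ (y ⊗ₜ (d ⊗ₜ (z ⊗ₜ m))))))
  have hF : F ((T ◁ T ◁ 𝐜) ((T ◁ 𝐜) (𝐜 (a ⊗ₜ (x ⊗ₜ (b ⊗ₜ (y ⊗ₜ (d ⊗ₜ (z ⊗ₜ m))))))))) =
    F (c (a ⊗ₜ x) ⊗ₜ (c (b ⊗ₜ y) ⊗ₜ (c (d ⊗ₜ z) ⊗ₜ m))) := by simp [act₁_tmul]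
  have hG : G ((T ◁ T ◁ 𝐜) ((T ◁ 𝐜) (𝐜 (a ⊗ₜ (x ⊗ₜ (b ⊗ₜ (y ⊗ₜ (d ⊗ₜ (z ⊗ₜ m))))))))) =
    G (c (a ⊗ₜ x) ⊗ₜ (c (b ⊗ₜ y) ⊗ₜ (c (d ⊗ₜ z) ⊗ₜ m))) := by simp [act₁_tmul]
  rw [hF, hG] at key
  -- If the third word loses its letter, `hz` applies; if the second does but not the third, `hy`
  -- applies; the one remaining case is `ih`.
  refine key ?_ ?_ ?_ ?_ ?_ ?_ ?_
  · simp only [LinearMap.lTensor_tmul, act₁_tmul, ih]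
  · rw [hu, act₁_lTensor, act₂_lTensor]
    exact whisker₃₃ A hy _
  · rw [hu, lTensor_act₂]
    exact whisker₃₃ A (fun v => whisker₃₃ A hy v) _
  · rw [hu', act₁_lTensor, lTensor_act₁, lTensor_act₂, act₂_lTensor]
    exact whisker₂₂ A hz _
  · rw [hu'', lTensor_lTensor_act₂, lTensor_act₂]
    exact whisker₂₂ A (fun v => whisker₂₂ A hz v) _
  · rw [hu', act₁_lTensor, lTensor_lTensor_act₂, act₂_lTensor, lTensor_act₂]
    exact whisker₂₂ A (fun v => whisker₂₂ A hz v) _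
  · have h : (A ◁ T ◁ A ◁ 𝛅) (a ⊗ₜ[k] (x ⊗ₜ[k] (b ⊗ₜ[k] (y ⊗ₜ[k] (d ⊗ₜ[k] (z ⊗ₜ[k] m)))))) =
        (A ◁ T ◁ A ◁ A ◁ T ◁ TensorProduct.mk k T M z)
          ((A ◁ T ◁ A ◁ 𝛅) (a ⊗ₜ (x ⊗ₜ (b ⊗ₜ (y ⊗ₜ (d ⊗ₜ m)))))) := by
      rw [hu']
      exact whisker₂₂ A (fun v => lTensor_lTensor_act₂ T A δ (TensorProduct.mk k T M z) v) _
    rw [h, lTensor_act₂, lTensor_lTensor_act₂]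
    exact whisker₂₂ A (fun v => whisker₂₂ A (fun v => whisker₂₂ A hz v) v) _

theorem act_shuffle_cons_eq (u : A ⊗[k] (T ⊗[k] (A ⊗[k] (T ⊗[k] M)))) :
    𝐬 ((T ◁ 𝐜) (𝐜 u)) =
      𝐜 (recPart lam μ c δ s u) :=
  H.act_shuffle_cons u

include hA

/-- Letters associate by associativity of μ and tails by that of *, while `delta_shuffle` and
`delta_mul` match the crossings. Associativity of * enters only as the hypothesis `h` on one tensor,
because this lemma serves inside the induction that proves it. -/
theorem mulPart_mulPart (u : A ⊗[k] (T ⊗[k] (A ⊗[k] (T ⊗[k] (A ⊗[k] (T ⊗[k] M))))))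
    (h : (A ◁ A ◁ A ◁ 𝐬) ((A ◁ A ◁ A ◁ 𝐬) ((A ◁ A ◁ 𝛅) ((A ◁ 𝛅) ((A ◁ T ◁ A ◁ 𝛅) u)))) =
      (A ◁ A ◁ A ◁ 𝐬) ((A ◁ A ◁ A ◁ T ◁ 𝐬)
        ((A ◁ A ◁ 𝛅) ((A ◁ 𝛅) ((A ◁ T ◁ A ◁ 𝛅) u))))) :
    mulPart μ δ s (mulPart μ δ s u) = mulPart μ δ s ((A ◁ T ◁ mulPart μ δ s) u) := by
  simp only [mulPart, LinearMap.lTensor_comp, LinearMap.comp_apply]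
  rw [← act₁_lTensor μ (𝛅), ← act₁_lTensor μ (A ◁ 𝐬),
    whisker₂₃ A (fun v => whisker₂₃ A (H.delta_shuffle hA) v),
    ← lTensor_act₂ A δ (𝛅), h, whisker₂₃ A (H.delta_mul hA),
    lTensor_act₂ A δ (A ◁ 𝐬), lTensor_lTensor_act₂ A A δ (𝐬), ← lTensor_act₁ A μ (𝐬),
    hA.algebra.act₁_act₁]

/-- The quasi-shuffle product is associative. -/
theorem shuffle_assoc (u : T ⊗[k] (T ⊗[k] (T ⊗[k] M))) : 𝐬 (𝐬 u) = 𝐬 ((T ◁ 𝐬) u) := by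
  refine H.ext₃ (F := act₁ s ∘ₗ act₁ s) (G := act₁ s ∘ₗ (T ◁ act₁ s)) (fun u => ?_)
    (fun u => ?_) (fun u => ?_) (fun u hx hy hxy hz hxz hyz hxyz => ?_) u
  · simp only [LinearMap.comp_apply, LinearMap.lTensor_tmul, H.act_one_shuffle]
  · simp only [LinearMap.comp_apply]
    rw [H.act_shuffle_one, H.lTensor_one_shuffle]
  · simp only [LinearMap.comp_apply]
    rw [act₁_lTensor, H.act_shuffle_one, H.lTensor_shuffle_one]
  · simp only [LinearMap.lTensor_comp, LinearMap.comp_apply] at hx hy hxy hz hxz hyz hxyz ⊢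
    -- The identities `e₁` to `e₇` compare the terms whose first letter is built from the first
    -- letters of the words numbered {1}, {2}, {1,2}, {3}, {1,3}, {2,3}, {1,2,3}, in this order.
    -- Together they exhaust both triple products.
    have e₁ : leftPart c s (leftPart c s u) = leftPart c s
        ((A ◁ T ◁ recPart lam μ c δ s) u) := by
      have h := whisker₃₂ A (fun v => whisker₃₂ T H.act_shuffle_cons_eq v) u
      simp only [leftPart, LinearMap.comp_apply] at h ⊢
      rw [← h, ← hx, lTensor_act₁]
    have e₂ : leftPart c s (rightPart c δ s u) =
        rightPart c δ s ((A ◁ T ◁ leftPart c s) u) := by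
      simp only [leftPart, rightPart, LinearMap.lTensor_comp, LinearMap.comp_apply]
      rw [act₁_lTensor, act₁_lTensor, act₂_lTensor, act₂_lTensor, ← hy, lTensor_act₁]
    have e₃ : leftPart c s (mulPart μ δ s u) = mulPart μ δ s ((A ◁ T ◁ leftPart c s) u) := by
      simp only [leftPart, mulPart, LinearMap.lTensor_comp, LinearMap.comp_apply]
      rw [lTensor_act₂, lTensor_act₂, ← hxy, ← act₁_lTensor μ (T ◁ 𝐜), ← act₁_lTensor μ (𝐬),
        lTensor_lTensor_act₁]
    have e₄ : rightPart c δ s (recPart lam μ c δ s u) =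
        rightPart c δ s ((A ◁ T ◁ rightPart c δ s) u) := by
      simp only [rightPart, LinearMap.lTensor_comp, LinearMap.comp_apply]
      have h := H.act_shuffle_cons_eq u
      rw [← h, H.delta_shuffle hA, hz, ← act₂_lTensor, act₁_lTensor, act₁_lTensor, act₁_lTensor]
    have e₅ : mulPart μ δ s (leftPart c s u) = mulPart μ δ s ((A ◁ T ◁ rightPart c δ s) u) := by
      simp only [leftPart, rightPart, mulPart, LinearMap.lTensor_comp, LinearMap.comp_apply]
      rw [whisker₂₃ A (H.delta_shuffle hA), hxz, lTensor_act₂]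
    have e₆ : mulPart μ δ s (rightPart c δ s u) = rightPart c δ s ((A ◁ T ◁ mulPart μ δ s) u) := by
      simp only [rightPart, mulPart, LinearMap.lTensor_comp, LinearMap.comp_apply]
      rw [whisker₂₃ A (H.delta_shuffle hA), ← act₂_lTensor δ (𝛅), hyz, act₁_lTensor c (𝛍),
        act₁_lTensor c (A ◁ A ◁ 𝐬), act₁_lTensor c (A ◁ 𝛅), H.delta_mul hA,
        act₂_lTensor δ (A ◁ 𝐬), lTensor_act₂ A δ (𝐬),
        ← act₁_lTensor μ (𝐬)]
    have e₇ := H.mulPart_mulPart hA u hxyz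
    rw [act₁_lTensor s (𝐜), H.act_shuffle_cons_eq, H.act_shuffle_cons_eq,
      whisker₃₂ T H.act_shuffle_cons_eq, ← act₁_lTensor, H.act_shuffle_cons_eq]
    refine congrArg (act₁ c) ?_
    rw [recPart_apply, e₄, recPart_apply (u := u), map_add, map_add, map_smul,
      e₁, e₂, e₃, map_add, map_add, map_smul, e₅, e₆, e₇, recPart_apply, lTensor_recPart]
    simp only [map_add, map_smul]
    module

end IsShuffleSystem

/-! ### The braiding of the tensor space -/

namespace IsShuffleSystem

variable (H : IsShuffleSystem lam μ σ o c δ ε B s) (hA : IsBraidedCommUnitalAlgebra μ e σ)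
  (hσ : σ ∘ₗ σ = LinearMap.id)

include H

/-- B recurses on its second argument and leaves the first arbitrary, so a single induction on the
last word suffices. The three variants below change only what stands to the left of that word. -/
theorem ext_snd {F G : T ⊗[k] (T ⊗[k] M) →ₗ[k] N}
    (h₁ : ∀ u, F ((T ◁ TensorProduct.mk k T M o) u) = G ((T ◁ TensorProduct.mk k T M o) u))
    (step : ∀ u : T ⊗[k] (A ⊗[k] (T ⊗[k] M)), (A ◁ F) (𝛅 u) = (A ◁ G) (𝛅 u) →
      F ((T ◁ 𝐜) u) = G ((T ◁ 𝐜) u))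
    (u : T ⊗[k] (T ⊗[k] M)) : F u = G u := by
  suffices h : ∀ y x m, F (x ⊗ₜ (y ⊗ₜ m)) = G (x ⊗ₜ (y ⊗ₜ m)) from
    LinearMap.congr_fun (TensorProduct.ext_threefold' fun x y m => h y x m) u
  intro y
  induction y using H.induction with
  | hadd x y hx hy =>
    intro z m; simp only [TensorProduct.add_tmul, TensorProduct.tmul_add, map_add, hx, hy]
  | hsmul r x hx =>
    intro z m; simp only [← TensorProduct.smul_tmul', TensorProduct.tmul_smul, map_smul, hx]
  | hone => exact fun x m => h₁ (x ⊗ₜ m)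
  | hcons b y ihy =>
    intro x m
    have hy : ∀ v, F ((T ◁ TensorProduct.mk k T M y) v) =
        G ((T ◁ TensorProduct.mk k T M y) v) := fun v =>
      LinearMap.congr_fun (f := F ∘ₗ (T ◁ TensorProduct.mk k T M y))
        (g := G ∘ₗ (T ◁ TensorProduct.mk k T M y)) (TensorProduct.ext' fun x m => ihy x m) v
    have key := step ((T ◁ A ◁ TensorProduct.mk k T M y) (x ⊗ₜ (b ⊗ₜ m)))
      (by rw [act₂_lTensor]; exact whisker₂₂ A hy _)
    simpa [act₁_tmul] using key

theorem ext_trd {F G : T ⊗[k] (T ⊗[k] (T ⊗[k] M)) →ₗ[k] N}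
    (h₁ : ∀ u, F ((T ◁ T ◁ TensorProduct.mk k T M o) u) =
      G ((T ◁ T ◁ TensorProduct.mk k T M o) u))
    (step : ∀ u : T ⊗[k] (T ⊗[k] (A ⊗[k] (T ⊗[k] M))),
      (A ◁ F) (𝛅 ((T ◁ 𝛅) u)) = (A ◁ G) (𝛅 ((T ◁ 𝛅) u)) →
      F ((T ◁ T ◁ 𝐜) u) = G ((T ◁ T ◁ 𝐜) u))
    (u : T ⊗[k] (T ⊗[k] (T ⊗[k] M))) : F u = G u := by
  suffices h : ∀ z y x m, F (x ⊗ₜ (y ⊗ₜ (z ⊗ₜ m))) = G (x ⊗ₜ (y ⊗ₜ (z ⊗ₜ m))) by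
    suffices h' : F = G by rw [h']
    ext x y z m
    exact h z y x m
  intro z
  induction z using H.induction with
  | hadd x y hx hy =>
    intro z w m; simp only [TensorProduct.add_tmul, TensorProduct.tmul_add, map_add, hx, hy]
  | hsmul r x hx =>
    intro z w m; simp only [← TensorProduct.smul_tmul', TensorProduct.tmul_smul, map_smul, hx]
  | hone => exact fun y x m => h₁ (x ⊗ₜ (y ⊗ₜ m))
  | hcons d z ihz =>
    intro y x m
    have hz : ∀ v, F ((T ◁ T ◁ TensorProduct.mk k T M z) v) =
        G ((T ◁ T ◁ TensorProduct.mk k T M z) v) := fun v =>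
      LinearMap.congr_fun (f := F ∘ₗ (T ◁ T ◁ TensorProduct.mk k T M z))
        (g := G ∘ₗ (T ◁ T ◁ TensorProduct.mk k T M z))
        (TensorProduct.ext_threefold' fun x y m => ihz y x m) v
    have key := step ((T ◁ T ◁ A ◁ TensorProduct.mk k T M z) (x ⊗ₜ (y ⊗ₜ (d ⊗ₜ m))))
      (by rw [lTensor_act₂, act₂_lTensor]; exact whisker₂₂ A hz _)
    simpa [act₁_tmul] using key

theorem ext_letter {F G : A ⊗[k] (T ⊗[k] M) →ₗ[k] N}
    (h₁ : ∀ u, F ((A ◁ TensorProduct.mk k T M o) u) = G ((A ◁ TensorProduct.mk k T M o) u))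
    (step : ∀ u : A ⊗[k] (A ⊗[k] (T ⊗[k] M)), (A ◁ F) (𝛔 u) = (A ◁ G) (𝛔 u) →
      F ((A ◁ 𝐜) u) = G ((A ◁ 𝐜) u))
    (u : A ⊗[k] (T ⊗[k] M)) : F u = G u := by
  suffices h : ∀ y x m, F (x ⊗ₜ (y ⊗ₜ m)) = G (x ⊗ₜ (y ⊗ₜ m)) from
    LinearMap.congr_fun (TensorProduct.ext_threefold' fun x y m => h y x m) u
  intro y
  induction y using H.induction with
  | hadd x y hx hy =>
    intro z m; simp only [TensorProduct.add_tmul, TensorProduct.tmul_add, map_add, hx, hy]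
  | hsmul r x hx =>
    intro z m; simp only [← TensorProduct.smul_tmul', TensorProduct.tmul_smul, map_smul, hx]
  | hone => exact fun x m => h₁ (x ⊗ₜ m)
  | hcons b y ihy =>
    intro x m
    have hy : ∀ v, F ((A ◁ TensorProduct.mk k T M y) v) =
        G ((A ◁ TensorProduct.mk k T M y) v) := fun v =>
      LinearMap.congr_fun (f := F ∘ₗ (A ◁ TensorProduct.mk k T M y))
        (g := G ∘ₗ (A ◁ TensorProduct.mk k T M y)) (TensorProduct.ext' fun x m => ihy x m) v
    have key := step ((A ◁ A ◁ TensorProduct.mk k T M y) (x ⊗ₜ (b ⊗ₜ m)))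
      (by rw [act₂_lTensor]; exact whisker₂₂ A hy _)
    simpa [act₁_tmul] using key

theorem ext_letter_snd {F G : A ⊗[k] (T ⊗[k] (T ⊗[k] M)) →ₗ[k] N}
    (h₁ : ∀ u, F ((A ◁ T ◁ TensorProduct.mk k T M o) u) =
      G ((A ◁ T ◁ TensorProduct.mk k T M o) u))
    (step : ∀ u : A ⊗[k] (T ⊗[k] (A ⊗[k] (T ⊗[k] M))),
      (A ◁ F) (𝛔 ((A ◁ 𝛅) u)) = (A ◁ G) (𝛔 ((A ◁ 𝛅) u)) →
      F ((A ◁ T ◁ 𝐜) u) = G ((A ◁ T ◁ 𝐜) u))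
    (u : A ⊗[k] (T ⊗[k] (T ⊗[k] M))) : F u = G u := by
  suffices h : ∀ z y x m, F (x ⊗ₜ (y ⊗ₜ (z ⊗ₜ m))) = G (x ⊗ₜ (y ⊗ₜ (z ⊗ₜ m))) by
    suffices h' : F = G by rw [h']
    ext x y z m
    exact h z y x m
  intro z
  induction z using H.induction with
  | hadd x y hx hy =>
    intro z w m; simp only [TensorProduct.add_tmul, TensorProduct.tmul_add, map_add, hx, hy]
  | hsmul r x hx =>
    intro z w m; simp only [← TensorProduct.smul_tmul', TensorProduct.tmul_smul, map_smul, hx]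
  | hone => exact fun y x m => h₁ (x ⊗ₜ (y ⊗ₜ m))
  | hcons d z ihz =>
    intro y x m
    have hz : ∀ v, F ((A ◁ T ◁ TensorProduct.mk k T M z) v) =
        G ((A ◁ T ◁ TensorProduct.mk k T M z) v) := fun v =>
      LinearMap.congr_fun (f := F ∘ₗ (A ◁ T ◁ TensorProduct.mk k T M z))
        (g := G ∘ₗ (A ◁ T ◁ TensorProduct.mk k T M z))
        (TensorProduct.ext_threefold' fun x y m => ihz y x m) v
    have key := step ((A ◁ T ◁ A ◁ TensorProduct.mk k T M z) (x ⊗ₜ (y ⊗ₜ (d ⊗ₜ m))))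
      (by rw [lTensor_act₂, act₂_lTensor]; exact whisker₂₂ A hz _)
    simpa [act₁_tmul] using key

/-- B recurses on the right word, so a unit on the left, unlike one on the right, calls for an
induction. -/
theorem braid_one_tmul (u : T ⊗[k] M) : 𝐁 (o ⊗ₜ u) = (T ◁ TensorProduct.mk k T M o) u := by
  refine H.ext₁ (F := act₂ B ∘ₗ TensorProduct.mk k T (T ⊗[k] M) o)
    (G := T ◁ TensorProduct.mk k T M o) (fun m => ?_) (fun u ih => ?_) u
  · simp only [LinearMap.comp_apply, TensorProduct.mk_apply, LinearMap.lTensor_tmul]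
    exact H.act_braid_one (o ⊗ₜ m)
  · simp only [LinearMap.lTensor_comp, LinearMap.comp_apply] at ih ⊢
    rw [TensorProduct.mk_apply, ← LinearMap.lTensor_tmul, H.act_braid_cons, H.act_delta_one, ih,
      act₁_lTensor]

theorem lTensor_braid_one (X : Type*) [AddCommGroup X] [Module k X] (u : X ⊗[k] (T ⊗[k] M)) :
    (X ◁ 𝐁) ((X ◁ T ◁ TensorProduct.mk k T M o) u) = (X ◁ TensorProduct.mk k T (T ⊗[k] M) o) u :=
  whisker₂₁ X (f' := TensorProduct.mk k T (T ⊗[k] M) o) H.act_braid_one u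

theorem lTensor_braid_cons (X : Type*) [AddCommGroup X] [Module k X]
    (u : X ⊗[k] (T ⊗[k] (A ⊗[k] (T ⊗[k] M)))) :
    (X ◁ 𝐁) ((X ◁ T ◁ 𝐜) u) = (X ◁ 𝐜) ((X ◁ A ◁ 𝐁) ((X ◁ 𝛅) u)) :=
  whisker₂₃ X H.act_braid_cons u

include hσ in
-- δ and ε apply copies of σ in opposite orders, so with σ² = id they cancel letter by letter.
theorem delta_eps (u : A ⊗[k] (T ⊗[k] M)) : 𝛅 (𝛆 u) = u := by
  refine H.ext_letter (F := act₂ δ ∘ₗ act₂ ε) (G := LinearMap.id) (fun m => ?_)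
    (fun u ih => ?_) u
  · simp only [LinearMap.comp_apply, LinearMap.id_apply]
    rw [H.act_eps_one, H.act_delta_one]
  · simp only [LinearMap.lTensor_comp, LinearMap.comp_apply, LinearMap.lTensor_id,
      LinearMap.id_apply] at ih ⊢
    rw [H.act_eps_cons, H.act_delta_cons, ih, act₂_act₂_of_involutive hσ]

include hσ in
theorem eps_delta (u : T ⊗[k] (A ⊗[k] M)) : 𝛆 (𝛅 u) = u := by
  refine H.ext₁ (F := act₂ ε ∘ₗ act₂ δ) (G := LinearMap.id) (fun m => ?_)
    (fun u ih => ?_) u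
  · simp only [LinearMap.comp_apply, LinearMap.id_apply]
    rw [H.act_delta_one, H.act_eps_one]
  · simp only [LinearMap.lTensor_comp, LinearMap.comp_apply, LinearMap.lTensor_id,
      LinearMap.id_apply] at ih ⊢
    rw [H.act_delta_cons, H.act_eps_cons, act₂_act₂_of_involutive hσ, ih]

/-- The dual recursion for the braiding of `T`. -/
theorem braid_cons_tmul (u : A ⊗[k] (T ⊗[k] (T ⊗[k] M))) :
    𝐁 (𝐜 u) = (T ◁ 𝐜) (𝛆 ((A ◁ 𝐁) u)) := by
  refine H.ext_letter_snd (F := act₂ B ∘ₗ act₁ c) (G := (T ◁ act₁ c) ∘ₗ act₂ ε ∘ₗ (A ◁ act₂ B))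
    (fun m => ?_) (fun u ih => ?_) u
  · simp only [LinearMap.comp_apply]
    rw [act₁_lTensor, H.act_braid_one, H.lTensor_braid_one, H.act_eps_one, LinearMap.lTensor_tmul]
  · simp only [LinearMap.lTensor_comp, LinearMap.comp_apply] at ih ⊢
    rw [act₁_lTensor, H.act_braid_cons, H.act_delta_cons, ih, H.lTensor_braid_cons,
      H.act_eps_cons, act₁_lTensor, ← act₂_lTensor σ (𝐁)]

include hσ in
-- The first B detaches a letter on the right by δ, and the second restores it through the dual
-- recursion by ε; what remains is εδ = id.
theorem braid_braid (u : T ⊗[k] (T ⊗[k] M)) : 𝐁 (𝐁 u) = u := by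
  refine H.ext_snd (F := act₂ B ∘ₗ act₂ B) (G := LinearMap.id)
    (fun m => ?_) (fun u ih => ?_) u
  · simp only [LinearMap.comp_apply, LinearMap.id_apply]
    rw [H.act_braid_one, H.braid_one_tmul]
  · simp only [LinearMap.lTensor_comp, LinearMap.comp_apply, LinearMap.lTensor_id,
      LinearMap.id_apply] at ih ⊢
    rw [H.act_braid_cons, H.braid_cons_tmul, ih, H.eps_delta hσ]

include hA in
-- A letter may cross two words before or after they are exchanged. At each letter of the second
-- word this reduces to `delta_sigma`.
theorem delta_braid (u : T ⊗[k] (T ⊗[k] (A ⊗[k] M))) :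
    (A ◁ 𝐁) (𝛅 ((T ◁ 𝛅) u)) = 𝛅 ((T ◁ 𝛅) (𝐁 u)) := by
  refine H.ext_snd (F := (A ◁ act₂ B) ∘ₗ act₂ δ ∘ₗ (T ◁ act₂ δ))
    (G := act₂ δ ∘ₗ (T ◁ act₂ δ) ∘ₗ act₂ B) (fun u => ?_) (fun u ih => ?_) u
  · simp only [LinearMap.comp_apply]
    rw [H.act_braid_one, LinearMap.lTensor_tmul, H.act_delta_one,
      whisker₂₁ T (f := 𝛅) (g := TensorProduct.mk k T (A ⊗[k] M) o) H.act_delta_one,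
      act₂_lTensor]
    exact H.lTensor_braid_one A _
  · simp only [LinearMap.lTensor_comp, LinearMap.comp_apply] at ih ⊢
    rw [H.act_braid_cons, ← act₁_lTensor, H.act_delta_cons, ← ih, H.lTensor_delta_cons T,
      act₂_lTensor, H.lTensor_braid_cons, ← H.delta_sigma hA, act₂_lTensor δ (𝛅), ← act₂_lTensor σ (𝐁)]

include hA in
/-- The braiding of `T` satisfies the Yang-Baxter equation. -/
theorem braid_yang_baxter (u : T ⊗[k] (T ⊗[k] (T ⊗[k] M))) :
    𝐁 ((T ◁ 𝐁) (𝐁 u)) = (T ◁ 𝐁) (𝐁 ((T ◁ 𝐁) u)) := by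
  refine H.ext_trd (F := act₂ B ∘ₗ (T ◁ act₂ B) ∘ₗ act₂ B)
    (G := (T ◁ act₂ B) ∘ₗ act₂ B ∘ₗ (T ◁ act₂ B)) (fun u => ?_) (fun u ih => ?_) u
  · simp only [LinearMap.comp_apply]
    rw [act₂_lTensor, H.lTensor_braid_one, H.lTensor_braid_one, H.act_braid_one, H.act_braid_one,
      LinearMap.lTensor_tmul]
  · simp only [LinearMap.lTensor_comp, LinearMap.comp_apply] at ih ⊢
    -- The first letter of the third word crosses the other two, which are being exchanged:
    -- `delta_braid` is the inductive step.
    rw [act₂_lTensor, H.lTensor_braid_cons, H.lTensor_braid_cons, H.act_braid_cons,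
      H.act_braid_cons, act₂_lTensor δ (𝐁), act₂_lTensor δ (𝐁), ← H.delta_braid hA, ih,
      act₁_lTensor]

include hA in
-- This is `delta_shuffle` repeated for each letter of the third word.
theorem braid_shuffle (u : T ⊗[k] (T ⊗[k] (T ⊗[k] M))) :
    𝐁 (𝐬 u) = (T ◁ 𝐬) (𝐁 ((T ◁ 𝐁) u)) := by
  refine H.ext_trd (F := act₂ B ∘ₗ act₁ s)
    (G := (T ◁ act₁ s) ∘ₗ act₂ B ∘ₗ (T ◁ act₂ B)) (fun u => ?_) (fun u ih => ?_) u
  · simp only [LinearMap.comp_apply]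
    rw [act₁_lTensor, H.act_braid_one, H.lTensor_braid_one, H.act_braid_one,
      LinearMap.lTensor_tmul]
  · simp only [LinearMap.lTensor_comp, LinearMap.comp_apply] at ih ⊢
    rw [act₁_lTensor, H.act_braid_cons, H.lTensor_braid_cons, H.delta_shuffle hA, ih,
      H.act_braid_cons, act₂_lTensor, act₁_lTensor]

include hA hσ in
/-- The quasi-shuffle product is braided commutative. -/
theorem shuffle_braid (u : T ⊗[k] (T ⊗[k] M)) : 𝐬 (𝐁 u) = 𝐬 u := by
  refine H.ext₂ (F := act₁ s ∘ₗ act₂ B) (G := act₁ s) (fun u => ?_) (fun u => ?_)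
    (fun u ihx ihy ihxy => ?_) u
  · simp only [LinearMap.comp_apply]
    rw [H.braid_one_tmul, H.act_shuffle_one, H.act_one_shuffle]
  · simp only [LinearMap.comp_apply]
    rw [H.act_braid_one, H.act_shuffle_one, H.act_one_shuffle]
  · simp only [LinearMap.lTensor_comp, LinearMap.comp_apply] at ihx ihy ihxy ⊢
    have e₀ : (A ◁ 𝐜) (𝛔 ((A ◁ 𝛅) u)) = 𝛅 (𝐜 u) := (H.act_delta_cons u).symm
    have e₁ : 𝐁 ((T ◁ 𝐜) (𝐜 u)) =
        (T ◁ 𝐜) (𝐜 ((A ◁ 𝛆) ((A ◁ A ◁ 𝐁) (𝛔 ((A ◁ 𝛅) u))))) := by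
      rw [H.act_braid_cons, H.act_delta_cons, whisker₂₃ A H.braid_cons_tmul, act₁_lTensor]
    have e₂ : (A ◁ 𝛅) ((A ◁ 𝛆) ((A ◁ A ◁ 𝐁) (𝛔 ((A ◁ 𝛅) u)))) =
        (A ◁ A ◁ 𝐁) (𝛔 ((A ◁ 𝛅) u)) := whisker₂₀ A (H.delta_eps hσ) _
    have e₃ : (A ◁ T ◁ 𝐜) ((A ◁ 𝛆) ((A ◁ A ◁ 𝐁) (𝛔 ((A ◁ 𝛅) u)))) =
        (A ◁ 𝐁) (𝛅 (𝐜 u)) := by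
      rw [← e₀, whisker₂₃ A H.braid_cons_tmul]
    -- Braiding swaps the first two summands of the recursion, where σ² = id undoes the double
    -- crossing, and it fixes the third because μσ = μ.
    rw [e₁, H.act_shuffle_cons, H.act_shuffle_cons, H.act_delta_cons, e₂, e₃, ihy,
      ← act₂_lTensor σ (𝐁), act₂_act₂_of_involutive hσ, ← H.lTensor_braid_cons, ihx,
      ← act₂_lTensor σ (𝐬), hA.act₁_act₂, ihxy]
    rw [add_comm ((A ◁ 𝐬) (𝛅 (𝐜 u)))]

end IsShuffleSystem

/-! ### Product, braiding and operator on A ⊗ T -/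

/-- The braiding of `A ⊗ T` with itself. -/
noncomputable def braidPart (σ : A ⊗[k] A →ₗ[k] A ⊗[k] A) (δ : T ⊗[k] A →ₗ[k] A ⊗[k] T)
    (ε : A ⊗[k] T →ₗ[k] T ⊗[k] A) (B : T ⊗[k] T →ₗ[k] T ⊗[k] T) :
    A ⊗[k] (T ⊗[k] (A ⊗[k] (T ⊗[k] M))) →ₗ[k] A ⊗[k] (T ⊗[k] (A ⊗[k] (T ⊗[k] M))) :=
  (A ◁ act₂ ε) ∘ₗ (A ◁ A ◁ act₂ B) ∘ₗ act₂ σ ∘ₗ (A ◁ act₂ δ)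

theorem braidPart_apply (u : A ⊗[k] (T ⊗[k] (A ⊗[k] (T ⊗[k] M)))) :
    braidPart σ δ ε B u = (A ◁ 𝛆) ((A ◁ A ◁ 𝐁) (𝛔 ((A ◁ 𝛅) u))) :=
  rfl

theorem mulPart_apply (u : A ⊗[k] (T ⊗[k] (A ⊗[k] (T ⊗[k] M)))) :
    mulPart μ δ s u = 𝛍 ((A ◁ A ◁ 𝐬) ((A ◁ 𝛅) u)) :=
  rfl

theorem braidPart_lTensor (g : M →ₗ[k] N) (u : A ⊗[k] (T ⊗[k] (A ⊗[k] (T ⊗[k] M)))) :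
    braidPart σ δ ε B ((A ◁ T ◁ A ◁ T ◁ g) u) = (A ◁ T ◁ A ◁ T ◁ g) (braidPart σ δ ε B u) := by
  simp only [braidPart_apply]
  rw [lTensor_act₂, act₂_lTensor, lTensor_lTensor_act₂, lTensor_act₂]

theorem mulPart_lTensor (g : M →ₗ[k] N) (u : A ⊗[k] (T ⊗[k] (A ⊗[k] (T ⊗[k] M)))) :
    mulPart μ δ s ((A ◁ T ◁ A ◁ T ◁ g) u) = (A ◁ T ◁ g) (mulPart μ δ s u) := by
  simp only [mulPart_apply]
  rw [lTensor_act₂, lTensor_lTensor_act₁, act₁_lTensor]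

namespace IsShuffleSystem

variable (H : IsShuffleSystem lam μ σ o c δ ε B s) (hA : IsBraidedCommUnitalAlgebra μ e σ)
  (hσ : σ ∘ₗ σ = LinearMap.id)

include H

/-- Since c is split, its injectivity survives tensoring with any module. -/
theorem act_cons_injective : Function.Injective (act₁ c : A ⊗[k] (T ⊗[k] M) →ₗ[k] T ⊗[k] M) := by
  obtain ⟨d, hd⟩ := H.exists_leftInverse
  have : ∀ u, ((TensorProduct.assoc k A T M).toLinearMap ∘ₗ d.rTensor M)
      (act₁ c u : T ⊗[k] M) = u := fun u => by
    obtain ⟨v, rfl⟩ := (TensorProduct.assoc k A T M).surjective u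
    simp only [act₁, LinearMap.comp_apply, LinearEquiv.coe_coe, LinearEquiv.symm_apply_apply,
      ← LinearMap.rTensor_comp_apply, hd, LinearMap.rTensor_id, LinearMap.id_apply]
  exact Function.LeftInverse.injective this

theorem lTensor_cons_injective (X : Type*) [AddCommGroup X] [Module k X] :
    Function.Injective (X ◁ act₁ c : X ⊗[k] (A ⊗[k] (T ⊗[k] M)) →ₗ[k] X ⊗[k] (T ⊗[k] M)) := by
  obtain ⟨d, hd⟩ := H.exists_leftInverse
  have : ∀ u, ((TensorProduct.assoc k A T M).toLinearMap ∘ₗ d.rTensor M)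
      (act₁ c u : T ⊗[k] M) = u := fun u => by
    obtain ⟨v, rfl⟩ := (TensorProduct.assoc k A T M).surjective u
    simp only [act₁, LinearMap.comp_apply, LinearEquiv.coe_coe, LinearEquiv.symm_apply_apply,
      ← LinearMap.rTensor_comp_apply, hd, LinearMap.rTensor_id, LinearMap.id_apply]
  exact Function.LeftInverse.injective (whisker₂₀ X this)

theorem lTensor_lTensor_cons_injective (X Y : Type*) [AddCommGroup X] [Module k X]
    [AddCommGroup Y] [Module k Y] : Function.Injective
      (X ◁ Y ◁ act₁ c : X ⊗[k] (Y ⊗[k] (A ⊗[k] (T ⊗[k] M))) →ₗ[k] X ⊗[k] (Y ⊗[k] (T ⊗[k] M))) := by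
  obtain ⟨d, hd⟩ := H.exists_leftInverse
  have : ∀ u, ((TensorProduct.assoc k A T M).toLinearMap ∘ₗ d.rTensor M)
      (act₁ c u : T ⊗[k] M) = u := fun u => by
    obtain ⟨v, rfl⟩ := (TensorProduct.assoc k A T M).surjective u
    simp only [act₁, LinearMap.comp_apply, LinearEquiv.coe_coe, LinearEquiv.symm_apply_apply,
      ← LinearMap.rTensor_comp_apply, hd, LinearMap.rTensor_id, LinearMap.id_apply]
  exact Function.LeftInverse.injective (whisker₂₀ X (whisker₂₀ Y this))

/-- B restricts along c to the braiding of A ⊗ T, so identities for B pass to `braidPart` by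
cancelling c. -/
theorem braid_cons_cons (u : A ⊗[k] (T ⊗[k] (A ⊗[k] (T ⊗[k] M)))) :
    𝐁 ((T ◁ 𝐜) (𝐜 u)) = (T ◁ 𝐜) (𝐜 (braidPart σ δ ε B u)) := by
  rw [H.act_braid_cons, H.act_delta_cons, whisker₂₃ A H.braid_cons_tmul, act₁_lTensor,
    braidPart_apply]

include hσ in
theorem braidPart_braidPart (u : A ⊗[k] (T ⊗[k] (A ⊗[k] (T ⊗[k] M)))) :
    braidPart σ δ ε B (braidPart σ δ ε B u) = u := by
  apply H.act_cons_injective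
  apply H.lTensor_cons_injective T
  rw [← H.braid_cons_cons, ← H.braid_cons_cons, H.braid_braid hσ]

include hA in
theorem braidPart_yang_baxter
    (u : A ⊗[k] (T ⊗[k] (A ⊗[k] (T ⊗[k] (A ⊗[k] (T ⊗[k] M)))))) :
    braidPart σ δ ε B ((A ◁ T ◁ braidPart σ δ ε B) (braidPart σ δ ε B u)) =
      (A ◁ T ◁ braidPart σ δ ε B) (braidPart σ δ ε B ((A ◁ T ◁ braidPart σ δ ε B) u)) := by
  have h₁ : ∀ v : A ⊗[k] (T ⊗[k] (A ⊗[k] (T ⊗[k] (A ⊗[k] (T ⊗[k] M))))),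
      𝐁 ((T ◁ T ◁ 𝐜) ((T ◁ 𝐜) (𝐜 v))) =
        (T ◁ T ◁ 𝐜) ((T ◁ 𝐜) (𝐜 (braidPart σ δ ε B v))) := fun v => by
    rw [act₂_lTensor, H.braid_cons_cons]
  have h₂ : ∀ v : A ⊗[k] (T ⊗[k] (A ⊗[k] (T ⊗[k] (A ⊗[k] (T ⊗[k] M))))),
      (T ◁ 𝐁) ((T ◁ T ◁ 𝐜) ((T ◁ 𝐜) (𝐜 v))) =
        (T ◁ T ◁ 𝐜) ((T ◁ 𝐜) (𝐜 ((A ◁ T ◁ braidPart σ δ ε B) v))) := fun v => by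
    rw [whisker₃₃ T H.braid_cons_cons, act₁_lTensor]
  apply H.act_cons_injective
  apply H.lTensor_cons_injective T
  apply H.lTensor_lTensor_cons_injective T T
  rw [← h₁, ← h₂, ← h₁, ← h₂, ← h₁, ← h₂, H.braid_yang_baxter hA]

include hA in
theorem mulPart_assoc (u : A ⊗[k] (T ⊗[k] (A ⊗[k] (T ⊗[k] (A ⊗[k] (T ⊗[k] M)))))) :
    mulPart μ δ s (mulPart μ δ s u) = mulPart μ δ s ((A ◁ T ◁ mulPart μ δ s) u) :=
  H.mulPart_mulPart hA u
    (whisker₂₂ A (whisker₂₂ A (whisker₂₂ A (H.shuffle_assoc hA))) _)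

include hA hσ in
-- The ε in the braiding cancels the δ in the product. Then `shuffle_braid` handles the tails and μσ
-- = μ the letters.
theorem mulPart_braidPart (u : A ⊗[k] (T ⊗[k] (A ⊗[k] (T ⊗[k] M)))) :
    mulPart μ δ s (braidPart σ δ ε B u) = mulPart μ δ s u := by
  rw [mulPart_apply, mulPart_apply, braidPart_apply, whisker₂₀ A (H.delta_eps hσ),
    whisker₂₁ A (whisker₂₁ A (H.shuffle_braid hA hσ)), ← act₂_lTensor, hA.act₁_act₂]

include hA hσ in
-- Naturality of δ read backwards, ε being its inverse; `eps_braid_delta` arises in the same way.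
theorem eps_mul (u : A ⊗[k] (A ⊗[k] (T ⊗[k] M))) : 𝛆 (𝛍 u) = (T ◁ 𝛍) (𝛆 ((A ◁ 𝛆) u)) := by
  have h := H.delta_mul hA (𝛆 ((A ◁ 𝛆) u))
  rw [H.delta_eps hσ, whisker₂₀ A (H.delta_eps hσ)] at h
  rw [← h, H.eps_delta hσ]

include hA hσ in
theorem eps_braid_delta (u : T ⊗[k] (A ⊗[k] (T ⊗[k] M))) :
    𝛆 ((A ◁ 𝐁) (𝛅 u)) = (T ◁ 𝛅) (𝐁 ((T ◁ 𝛆) u)) := by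
  have h := H.delta_braid hA ((T ◁ 𝛆) u)
  rw [whisker₂₀ T (H.delta_eps hσ)] at h
  rw [h, H.eps_delta hσ]

include hA hσ in
/-- The product of `A ⊗ T` passes through `T`. -/
theorem eps_braid_mulPart (u : A ⊗[k] (T ⊗[k] (A ⊗[k] (T ⊗[k] (T ⊗[k] M))))) :
    𝛆 ((A ◁ 𝐁) (mulPart μ δ s u)) =
      (T ◁ mulPart μ δ s) (𝛆 ((A ◁ 𝐁) ((A ◁ T ◁ 𝛆) ((A ◁ T ◁ A ◁ 𝐁) u)))) := by
  simp only [mulPart, LinearMap.comp_apply, LinearMap.lTensor_comp]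
  rw [← act₁_lTensor, H.eps_mul hA hσ, whisker₂₃ A (whisker₂₃ A (H.braid_shuffle hA)),
    lTensor_act₂ A ε (𝐬), act₂_lTensor ε (A ◁ 𝐬), ← lTensor_act₂ A δ (𝐁),
    whisker₃₃ A (H.eps_braid_delta hA hσ), act₂_lTensor ε (𝛅)]

/-- Passing an element of A ⊗ T through a nonempty word is its braiding with that word, seen in A ⊗
T. Hence `eps_braid_mulPart`, where the word is arbitrary, specialises to the braiding axiom of V
once c is cancelled. -/
theorem eps_braid_lTensor_cons (u : A ⊗[k] (T ⊗[k] (A ⊗[k] (T ⊗[k] M)))) :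
    𝛆 ((A ◁ 𝐁) ((A ◁ T ◁ 𝐜) u)) = 𝐜 (braidPart σ δ ε B u) := by
  rw [H.lTensor_braid_cons, H.act_eps_cons, act₂_lTensor σ (𝐁), braidPart_apply]

include hA hσ in
theorem braidPart_mulPart (u : A ⊗[k] (T ⊗[k] (A ⊗[k] (T ⊗[k] (A ⊗[k] (T ⊗[k] M)))))) :
    braidPart σ δ ε B (mulPart μ δ s u) =
      (A ◁ T ◁ mulPart μ δ s) (braidPart σ δ ε B ((A ◁ T ◁ braidPart σ δ ε B) u)) := by
  apply H.act_cons_injective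
  rw [← H.eps_braid_lTensor_cons, ← mulPart_lTensor, H.eps_braid_mulPart hA hσ,
    whisker₃₂ A (whisker₃₂ T H.eps_braid_lTensor_cons), H.eps_braid_lTensor_cons, ← act₁_lTensor]

include hA hσ in
-- The braiding is an involution, so inverting both sides of `braidPart_mulPart` turns one
-- compatibility with the product into the other.
theorem braidPart_lTensor_mulPart
    (u : A ⊗[k] (T ⊗[k] (A ⊗[k] (T ⊗[k] (A ⊗[k] (T ⊗[k] M)))))) :
    braidPart σ δ ε B ((A ◁ T ◁ mulPart μ δ s) u) =
      mulPart μ δ s ((A ◁ T ◁ braidPart σ δ ε B) (braidPart σ δ ε B u)) := by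
  have h := H.braidPart_mulPart hA hσ ((A ◁ T ◁ braidPart σ δ ε B) (braidPart σ δ ε B u))
  rw [whisker₂₀ A (whisker₂₀ T (H.braidPart_braidPart hσ)), H.braidPart_braidPart hσ] at h
  rw [← h, H.braidPart_braidPart hσ]

include hA in
theorem mulPart_one_tmul (u : A ⊗[k] (T ⊗[k] M)) : mulPart μ δ s (e ⊗ₜ (o ⊗ₜ u)) = u := by
  simp only [mulPart_apply, LinearMap.lTensor_tmul, H.act_delta_one, H.lTensor_one_shuffle,
    hA.algebra.act₁_one_tmul]

include hA in
theorem lTensor_delta_unit (X : Type*) [AddCommGroup X] [Module k X] (u : X ⊗[k] (T ⊗[k] M)) :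
    (X ◁ 𝛅) ((X ◁ T ◁ TensorProduct.mk k A M e) u) =
      (X ◁ TensorProduct.mk k A (T ⊗[k] M) e) u :=
  whisker₂₁ X (f' := TensorProduct.mk k A (T ⊗[k] M) e) (H.delta_unit hA) u

include hA in
theorem mulPart_lTensor_one (u : A ⊗[k] (T ⊗[k] M)) :
    mulPart μ δ s ((A ◁ T ◁ TensorProduct.mk k A (T ⊗[k] M) e)
      ((A ◁ T ◁ TensorProduct.mk k T M o) u)) = u := by
  rw [mulPart_apply, H.lTensor_delta_unit hA,
    whisker₂₂ A (f := A ◁ act₁ s) (g := TensorProduct.mk k A (T ⊗[k] (T ⊗[k] M)) e)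
      (f' := TensorProduct.mk k A (T ⊗[k] M) e) (g' := act₁ s)
      (fun v => LinearMap.lTensor_tmul _ _ _ _),
    H.lTensor_shuffle_one, hA.algebra.act₁_lTensor_one]

include hA in
theorem braidPart_lTensor_one (u : A ⊗[k] (T ⊗[k] M)) :
    braidPart σ δ ε B ((A ◁ T ◁ TensorProduct.mk k A (T ⊗[k] M) e)
      ((A ◁ T ◁ TensorProduct.mk k T M o) u)) = e ⊗ₜ (o ⊗ₜ u) := by
  rw [braidPart_apply, H.lTensor_delta_unit hA, hA.act₂_lTensor_one, LinearMap.lTensor_tmul,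
    H.lTensor_braid_one, LinearMap.lTensor_tmul, H.act_eps_one]

include hA hσ in
theorem braidPart_one_tmul (u : A ⊗[k] (T ⊗[k] M)) :
    braidPart σ δ ε B (e ⊗ₜ (o ⊗ₜ u)) = (A ◁ T ◁ TensorProduct.mk k A (T ⊗[k] M) e)
      ((A ◁ T ◁ TensorProduct.mk k T M o) u) := by
  rw [← H.braidPart_lTensor_one hA, H.braidPart_braidPart hσ]

include hA hσ in
theorem eps_unit (u : T ⊗[k] M) : 𝛆 (e ⊗ₜ u) = (T ◁ TensorProduct.mk k A M e) u := by
  rw [← H.delta_unit hA, H.eps_delta hσ]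

include hA hσ in
-- As P(w) = e ⊗ c(w), this is the condition that P passes through the braiding; it holds because e
-- and c each do.
theorem braidPart_one_cons (u : A ⊗[k] (T ⊗[k] (A ⊗[k] (T ⊗[k] M)))) :
    braidPart σ δ ε B (e ⊗ₜ 𝐜 u) =
      (A ◁ T ◁ TensorProduct.mk k A (T ⊗[k] M) e) ((A ◁ T ◁ 𝐜) (braidPart σ δ ε B u)) := by
  rw [braidPart_apply, LinearMap.lTensor_tmul, hA.act₂_one_tmul,
    whisker₂₂ A (f := A ◁ act₂ B) (g := TensorProduct.mk k A (T ⊗[k] (T ⊗[k] M)) e)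
      (f' := TensorProduct.mk k A (T ⊗[k] (T ⊗[k] M)) e) (g' := act₂ B)
      (fun v => LinearMap.lTensor_tmul _ _ _ _), H.act_delta_cons,
    whisker₂₁ A (f := act₂ ε) (g := TensorProduct.mk k A (T ⊗[k] (T ⊗[k] M)) e)
      (f' := T ◁ TensorProduct.mk k A (T ⊗[k] M) e) (H.eps_unit hA hσ),
    whisker₂₃ A H.braid_cons_tmul, braidPart_apply]

include hA hσ in
theorem braidPart_lTensor_one_cons (u : A ⊗[k] (T ⊗[k] (A ⊗[k] (T ⊗[k] M)))) :
    braidPart σ δ ε B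
      ((A ◁ T ◁ TensorProduct.mk k A (T ⊗[k] M) e) ((A ◁ T ◁ 𝐜) u)) =
      e ⊗ₜ 𝐜 (braidPart σ δ ε B u) := by
  have h := H.braidPart_one_cons hA hσ (braidPart σ δ ε B u)
  rw [H.braidPart_braidPart hσ] at h
  rw [← h, H.braidPart_braidPart hσ]

include hA in
-- The product u ⋄ P(v) is the first summand of the quasi-shuffle recursion; by `mulPart_one_cons`,
-- P(u) ⋄ v is the second. They turn that recursion into the Rota-Baxter identity.
theorem mulPart_lTensor_one_cons (u : A ⊗[k] (T ⊗[k] (A ⊗[k] (T ⊗[k] M)))) :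
    mulPart μ δ s ((A ◁ T ◁ TensorProduct.mk k A (T ⊗[k] M) e) ((A ◁ T ◁ 𝐜) u)) =
      leftPart c s u := by
  rw [mulPart_apply, H.lTensor_delta_unit hA,
    whisker₂₂ A (f := A ◁ act₁ s) (g := TensorProduct.mk k A (T ⊗[k] (T ⊗[k] M)) e)
      (f' := TensorProduct.mk k A (T ⊗[k] M) e) (g' := act₁ s)
      (fun v => LinearMap.lTensor_tmul _ _ _ _), hA.algebra.act₁_lTensor_one]
  rfl

omit H in
include hA in
theorem mulPart_one_cons (u : A ⊗[k] (T ⊗[k] (A ⊗[k] (T ⊗[k] M)))) :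
    mulPart μ δ s (e ⊗ₜ 𝐜 u) = rightPart c δ s u := by
  rw [mulPart_apply, LinearMap.lTensor_tmul, LinearMap.lTensor_tmul,
    hA.algebra.act₁_one_tmul]
  rfl

include hA in
/-- The Rota-Baxter identity on `A ⊗ T`. -/
theorem mulPart_rotaBaxter (u : A ⊗[k] (T ⊗[k] (A ⊗[k] (T ⊗[k] M)))) :
    mulPart μ δ s (e ⊗ₜ 𝐜 ((A ◁ T ◁ TensorProduct.mk k A (T ⊗[k] M) e) ((A ◁ T ◁ 𝐜) u))) =
      e ⊗ₜ 𝐜 (leftPart c s u) + e ⊗ₜ 𝐜 (rightPart c δ s u) +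
        lam • e ⊗ₜ 𝐜 (mulPart μ δ s u) := by
  rw [mulPart_apply, LinearMap.lTensor_tmul, LinearMap.lTensor_tmul, hA.algebra.act₁_one_tmul,
    act₁_lTensor, act₁_lTensor, H.delta_unit hA, LinearMap.lTensor_tmul, H.act_shuffle_cons_eq,
    recPart_apply, map_add, map_add, map_smul, TensorProduct.tmul_add, TensorProduct.tmul_add,
    TensorProduct.tmul_smul]

end IsShuffleSystem

/-! ### Transport to the mixable shuffle algebra -/

section ShaModel

variable {V : Type*} [AddCommGroup V] [Module k V] {θ : A ⊗[k] T ≃ₗ[k] V} {γ : V →ₗ[k] T}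
  {mV : V ⊗[k] V →ₗ[k] V} {βV : V ⊗[k] V →ₗ[k] V ⊗[k] V} {PV : V →ₗ[k] V} {ιV : A →ₗ[k] V}

/-- A description of the product, braiding, operator and embedding of the mixable shuffle algebra
`V ≃ A ⊗ T` in terms of a shuffle system on `T`. -/
structure IsShaModel (μ : A ⊗[k] A →ₗ[k] A) (e : A) (o : T) (c : A ⊗[k] T →ₗ[k] T)
    (δ : T ⊗[k] A →ₗ[k] A ⊗[k] T) (B : T ⊗[k] T →ₗ[k] T ⊗[k] T) (s : T ⊗[k] T →ₗ[k] T)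
    (θ : A ⊗[k] T ≃ₗ[k] V) (γ : V →ₗ[k] T) (mV : V ⊗[k] V →ₗ[k] V)
    (βV : V ⊗[k] V →ₗ[k] V ⊗[k] V) (PV : V →ₗ[k] V) (ιV : A →ₗ[k] V) : Prop where
  incl : ∀ w, γ (θ w) = c w
  mul : ∀ a x b y, mV (θ (a ⊗ₜ x) ⊗ₜ θ (b ⊗ₜ y)) =
    θ (act₁ μ ((A ◁ A ◁ s) (a ⊗ₜ act₂ δ (x ⊗ₜ (b ⊗ₜ y)))))
  braid : TensorProduct.map γ γ ∘ₗ βV = B ∘ₗ TensorProduct.map γ γ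
  op : ∀ w, PV (θ w) = θ (e ⊗ₜ c w)
  embed : ∀ a, ιV a = θ (a ⊗ₜ o)

namespace IsShaModel

local notation "𝛉" => act₁ (LinearEquiv.toLinearMap θ)

variable (S : IsShaModel μ e o c δ B s θ γ mV βV PV ιV)

omit S in
theorem theta_surjective : Function.Surjective
    (act₁ θ.toLinearMap : A ⊗[k] (T ⊗[k] M) →ₗ[k] V ⊗[k] M) :=
  (LinearMap.rTensor_surjective M θ.surjective).comp (TensorProduct.assoc k A T M).symm.surjective

omit S in
theorem exists_theta₂ (v : V ⊗[k] (V ⊗[k] M)) : ∃ u, v = 𝛉 ((A ◁ T ◁ 𝛉) u) := by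
  obtain ⟨w, rfl⟩ := theta_surjective (θ := θ) v
  obtain ⟨u, rfl⟩ := LinearMap.lTensor_surjective A
    (LinearMap.lTensor_surjective T (theta_surjective (θ := θ) (M := M))) w
  exact ⟨u, rfl⟩

omit S in
theorem exists_theta₃ (v : V ⊗[k] (V ⊗[k] (V ⊗[k] M))) :
    ∃ u, v = 𝛉 ((A ◁ T ◁ 𝛉) ((A ◁ T ◁ A ◁ T ◁ 𝛉) u)) := by
  obtain ⟨w, rfl⟩ := exists_theta₂ (θ := θ) v
  obtain ⟨u, rfl⟩ := LinearMap.lTensor_surjective A (LinearMap.lTensor_surjective T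
    (LinearMap.lTensor_surjective A (LinearMap.lTensor_surjective T
      (theta_surjective (θ := θ) (M := M))))) w
  exact ⟨u, rfl⟩

include S

theorem act_incl (u : A ⊗[k] (T ⊗[k] M)) : γ.rTensor M (𝛉 u) = 𝐜 u := by
  suffices h : γ.rTensor M ∘ₗ act₁ θ.toLinearMap = act₁ c from LinearMap.congr_fun h u
  ext a x m
  simp [act₁_tmul, S.incl]

theorem act_op (u : A ⊗[k] (T ⊗[k] M)) : PV.rTensor M (𝛉 u) = 𝛉 (e ⊗ₜ 𝐜 u) := by
  suffices h : PV.rTensor M ∘ₗ act₁ θ.toLinearMap =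
      act₁ θ.toLinearMap ∘ₗ TensorProduct.mk k A (T ⊗[k] M) e ∘ₗ act₁ c from
    LinearMap.congr_fun h u
  ext a x m
  simp [act₁_tmul, S.op]

theorem act_mul (u : A ⊗[k] (T ⊗[k] (A ⊗[k] (T ⊗[k] M)))) :
    act₁ mV (𝛉 ((A ◁ T ◁ 𝛉) u)) = 𝛉 (mulPart μ δ s u) := by
  suffices h : act₁ mV ∘ₗ act₁ θ.toLinearMap ∘ₗ (A ◁ T ◁ act₁ θ.toLinearMap (M := M)) =
      act₁ θ.toLinearMap ∘ₗ mulPart μ δ s from LinearMap.congr_fun h u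
  ext a x b y m
  simp only [TensorProduct.AlgebraTensorModule.curry_apply, LinearMap.restrictScalars_self,
    TensorProduct.curry_apply, LinearMap.comp_apply, LinearMap.lTensor_tmul, act₂_tmul, act₁_tmul,
    LinearEquiv.coe_coe, S.mul, mulPart_apply]
  induction δ (x ⊗ₜ b) with
  | zero => simp
  | add p q hp hq => simp only [TensorProduct.add_tmul, TensorProduct.tmul_add, map_add, hp, hq]
  | tmul b x => simp [act₁_tmul]

variable (H : IsShuffleSystem lam μ σ o c δ ε B s) (hA : IsBraidedCommUnitalAlgebra μ e σ)
  (hσ : σ ∘ₗ σ = LinearMap.id)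

include H

/-- The model only says that the inclusion in T intertwines `βV` with B. This determines `βV`, since
the inclusion becomes c under θ and c is injective. -/
theorem act_braid (u : A ⊗[k] (T ⊗[k] (A ⊗[k] (T ⊗[k] M)))) :
    act₂ βV (𝛉 ((A ◁ T ◁ 𝛉) u)) = 𝛉 ((A ◁ T ◁ 𝛉) (braidPart σ δ ε B u)) := by
  have h₁ : ∀ v : A ⊗[k] (T ⊗[k] (A ⊗[k] (T ⊗[k] M))),
      γ.rTensor (T ⊗[k] M) ((V ◁ γ.rTensor M) (𝛉 ((A ◁ T ◁ 𝛉) v))) = (T ◁ 𝐜) (𝐜 v) := fun v => by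
    rw [← act₁_lTensor, whisker₂₁ A (whisker₂₁ T S.act_incl), S.act_incl, act₁_lTensor]
  obtain ⟨v, hv⟩ := exists_theta₂ (θ := θ) (act₂ βV (𝛉 ((A ◁ T ◁ 𝛉) u)))
  have h₂ := act₂_map_of_comp_eq S.braid (𝛉 ((A ◁ T ◁ 𝛉) u))
  rw [hv, h₁, h₁, H.braid_cons_cons] at h₂
  rw [hv, H.act_cons_injective (H.lTensor_cons_injective T h₂)]

theorem act_braid_three (u : A ⊗[k] (T ⊗[k] (A ⊗[k] (T ⊗[k] (A ⊗[k] (T ⊗[k] M)))))) :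
    act₂ βV (𝛉 ((A ◁ T ◁ 𝛉) ((A ◁ T ◁ A ◁ T ◁ 𝛉) u))) =
      𝛉 ((A ◁ T ◁ 𝛉) ((A ◁ T ◁ A ◁ T ◁ 𝛉) (braidPart σ δ ε B u))) := by
  rw [S.act_braid H, braidPart_lTensor]

theorem lTensor_act_braid (u : A ⊗[k] (T ⊗[k] (A ⊗[k] (T ⊗[k] (A ⊗[k] (T ⊗[k] M)))))) :
    (V ◁ act₂ βV) (𝛉 ((A ◁ T ◁ 𝛉) ((A ◁ T ◁ A ◁ T ◁ 𝛉) u))) =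
      𝛉 ((A ◁ T ◁ 𝛉) ((A ◁ T ◁ A ◁ T ◁ 𝛉) ((A ◁ T ◁ braidPart σ δ ε B) u))) := by
  rw [← act₁_lTensor, whisker₃₃ A (whisker₃₃ T (S.act_braid H))]

omit H in
theorem act_mul_three (u : A ⊗[k] (T ⊗[k] (A ⊗[k] (T ⊗[k] (A ⊗[k] (T ⊗[k] M)))))) :
    act₁ mV (𝛉 ((A ◁ T ◁ 𝛉) ((A ◁ T ◁ A ◁ T ◁ 𝛉) u))) =
      𝛉 ((A ◁ T ◁ 𝛉) (mulPart μ δ s u)) := by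
  rw [S.act_mul, mulPart_lTensor]

omit H in
theorem lTensor_act_mul (u : A ⊗[k] (T ⊗[k] (A ⊗[k] (T ⊗[k] (A ⊗[k] (T ⊗[k] M)))))) :
    (V ◁ act₁ mV) (𝛉 ((A ◁ T ◁ 𝛉) ((A ◁ T ◁ A ◁ T ◁ 𝛉) u))) =
      𝛉 ((A ◁ T ◁ 𝛉) ((A ◁ T ◁ mulPart μ δ s) u)) := by
  rw [← act₁_lTensor, whisker₃₂ A (whisker₃₂ T S.act_mul)]

omit H S in
theorem lTensor_unit (u : A ⊗[k] (T ⊗[k] M)) :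
    (V ◁ TensorProduct.mk k V M (θ (e ⊗ₜ o))) (𝛉 u) =
      𝛉 ((A ◁ T ◁ 𝛉) ((A ◁ T ◁ TensorProduct.mk k A (T ⊗[k] M) e)
        ((A ◁ T ◁ TensorProduct.mk k T M o) u))) := by
  rw [← act₁_lTensor]
  congr 1
  suffices h' : (A ◁ T ◁ act₁ θ.toLinearMap) ∘ₗ (A ◁ T ◁ TensorProduct.mk k A (T ⊗[k] M) e) ∘ₗ
      (A ◁ T ◁ TensorProduct.mk k T M o) = (A ◁ T ◁ TensorProduct.mk k V M (θ (e ⊗ₜ o))) from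
    (LinearMap.congr_fun h' u).symm
  simp only [← LinearMap.lTensor_comp]
  congr 2

omit H S in
theorem unit_tmul (u : V ⊗[k] M) (v : A ⊗[k] (T ⊗[k] M)) (hv : u = 𝛉 v) :
    θ (e ⊗ₜ o) ⊗ₜ u = 𝛉 ((A ◁ T ◁ 𝛉) (e ⊗ₜ[k] (o ⊗ₜ[k] v))) := by
  subst hv
  simp [act₁_tmul]

omit H in
theorem act_op_left (u : A ⊗[k] (T ⊗[k] (A ⊗[k] (T ⊗[k] M)))) :
    PV.rTensor (V ⊗[k] M) (𝛉 ((A ◁ T ◁ 𝛉) u)) = 𝛉 ((A ◁ T ◁ 𝛉) (e ⊗ₜ 𝐜 u)) := by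
  rw [S.act_op, act₁_lTensor, LinearMap.lTensor_tmul]

omit H in
theorem lTensor_act_op (u : A ⊗[k] (T ⊗[k] (A ⊗[k] (T ⊗[k] M)))) :
    (V ◁ PV.rTensor M) (𝛉 ((A ◁ T ◁ 𝛉) u)) =
      𝛉 ((A ◁ T ◁ 𝛉) ((A ◁ T ◁ TensorProduct.mk k A (T ⊗[k] M) e) ((A ◁ T ◁ 𝐜) u))) := by
  rw [← act₁_lTensor, whisker₂₃ A (g' := T ◁ TensorProduct.mk k A (T ⊗[k] M) e)
    (whisker₂₃ T (g' := TensorProduct.mk k A (T ⊗[k] M) e) S.act_op)]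

include hA hσ

/-- The mixable shuffle algebra is a strongly braided commutative Rota-Baxter algebra. -/
theorem isStronglyBraidedCommRotaBaxter :
    IsStronglyBraidedCommRotaBaxter lam mV (θ (e ⊗ₜ o)) βV PV := by
  apply isStronglyBraidedCommRotaBaxter_of_act
  · intro v
    obtain ⟨u, rfl⟩ := exists_theta₃ (θ := θ) v
    rw [S.act_mul_three, S.lTensor_act_mul, S.act_mul, S.act_mul, H.mulPart_assoc hA]
  · intro v
    obtain ⟨u, rfl⟩ := theta_surjective (θ := θ) v
    rw [unit_tmul _ u rfl, S.act_mul, H.mulPart_one_tmul hA]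
  · intro v
    obtain ⟨u, rfl⟩ := theta_surjective (θ := θ) v
    rw [lTensor_unit, S.act_mul, H.mulPart_lTensor_one hA]
  · intro v
    obtain ⟨u, rfl⟩ := exists_theta₃ (θ := θ) v
    rw [S.act_braid_three H, S.lTensor_act_braid H, S.act_braid_three H, S.lTensor_act_braid H,
      S.act_braid_three H, S.lTensor_act_braid H, H.braidPart_yang_baxter hA]
  · intro v
    obtain ⟨u, rfl⟩ := exists_theta₃ (θ := θ) v
    rw [S.act_mul_three, S.act_braid H, S.lTensor_act_braid H, S.act_braid_three H,
      S.lTensor_act_mul, H.braidPart_mulPart hA hσ]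
  · intro v
    obtain ⟨u, rfl⟩ := exists_theta₃ (θ := θ) v
    rw [S.lTensor_act_mul, S.act_braid H, S.act_braid_three H, S.lTensor_act_braid H,
      S.act_mul_three, H.braidPart_lTensor_mulPart hA hσ]
  · intro v
    obtain ⟨u, rfl⟩ := theta_surjective (θ := θ) v
    rw [lTensor_unit, S.act_braid H, H.braidPart_lTensor_one hA, unit_tmul _ u rfl]
  · intro v
    obtain ⟨u, rfl⟩ := theta_surjective (θ := θ) v
    rw [lTensor_unit, unit_tmul _ u rfl, S.act_braid H, H.braidPart_one_tmul hA hσ]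
  · intro v
    obtain ⟨u, rfl⟩ := exists_theta₂ (θ := θ) v
    rw [S.act_braid H, S.act_mul, S.act_mul, H.mulPart_braidPart hA hσ]
  · intro v
    obtain ⟨u, rfl⟩ := exists_theta₂ (θ := θ) v
    rw [S.lTensor_act_op, S.act_op_left, S.act_op_left, S.act_mul, S.act_mul, S.act_mul,
      S.act_mul, S.act_op, S.act_op, S.act_op, H.mulPart_rotaBaxter hA,
      H.mulPart_lTensor_one_cons hA, IsShuffleSystem.mulPart_one_cons hA, map_add, map_add, map_smul]
  · intro v
    obtain ⟨u, rfl⟩ := exists_theta₂ (θ := θ) v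
    rw [S.act_op_left, S.act_braid H, S.act_braid H, S.lTensor_act_op,
      H.braidPart_one_cons hA hσ]
  · intro v
    obtain ⟨u, rfl⟩ := exists_theta₂ (θ := θ) v
    rw [S.lTensor_act_op, S.act_braid H, S.act_braid H, S.act_op_left,
      H.braidPart_lTensor_one_cons hA hσ]

omit hA hσ in
/-- The embedding of `A` is a homomorphism of braided algebras. -/
theorem isBraidedAlgebraHom : IsBraidedAlgebraHom μ e σ mV (θ (e ⊗ₜ o)) βV ιV where
  map_mul a b := by
    rw [S.embed, S.embed, S.embed, S.mul, H.act_delta_one]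
    simp [H.one_shuffle, act₁_tmul]
  map_one := S.embed e
  map_braid := by
    apply comp_eq_of_act₂_map
    have h₁ : ∀ u : A ⊗[k] (A ⊗[k] k), ιV.rTensor (V ⊗[k] k) ((A ◁ ιV.rTensor k) u) =
        𝛉 ((A ◁ T ◁ 𝛉) ((A ◁ TensorProduct.mk k T (A ⊗[k] (T ⊗[k] k)) o)
          ((A ◁ A ◁ TensorProduct.mk k T k o) u))) := fun u => by
      suffices h : ιV.rTensor (V ⊗[k] k) ∘ₗ (A ◁ ιV.rTensor k) = act₁ θ.toLinearMap ∘ₗ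
          (A ◁ T ◁ act₁ θ.toLinearMap) ∘ₗ (A ◁ TensorProduct.mk k T (A ⊗[k] (T ⊗[k] k)) o) ∘ₗ
            (A ◁ A ◁ TensorProduct.mk k T k o) from LinearMap.congr_fun h u
      ext a b
      simp [act₁_tmul, S.embed]
    have h₂ : ∀ v : A ⊗[k] (A ⊗[k] k), (A ◁ 𝛆) ((A ◁ A ◁ T ◁ TensorProduct.mk k T k o)
        ((A ◁ A ◁ TensorProduct.mk k T k o) v)) =
        (A ◁ TensorProduct.mk k T (A ⊗[k] (T ⊗[k] k)) o)
          ((A ◁ A ◁ TensorProduct.mk k T k o) v) := fun v => by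
      rw [lTensor_act₂, whisker₂₁ A (f' := TensorProduct.mk k T _ o) H.act_eps_one]
      exact whisker₂₂ A (f := T ◁ A ◁ TensorProduct.mk k T k o)
        (g := TensorProduct.mk k T (A ⊗[k] k) o) (f' := TensorProduct.mk k T _ o)
        (fun _ => LinearMap.lTensor_tmul _ _ _ _) v
    intro u
    -- Elements of A have tail o, through which δ, B and ε pass trivially; only σ on the letters
    -- remains.
    rw [h₁, S.act_braid H, h₁, braidPart_apply, H.lTensor_delta_one, act₂_lTensor, act₂_lTensor,
      whisker₂₁ A (whisker₂₁ A (f := act₂ B) (g := TensorProduct.mk k T (T ⊗[k] k) o)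
        H.braid_one_tmul), h₂]

end IsShaModel

end ShaModel

/-! ### The extension of a homomorphism to A ⊗ T -/

section Universal

variable {R : Type*} [AddCommGroup R] [Module k R] {μR : R ⊗[k] R →ₗ[k] R} {eR : R}
  {τ : R ⊗[k] R →ₗ[k] R ⊗[k] R} {PR : R →ₗ[k] R} {φ : A →ₗ[k] R} {ρ : T →ₗ[k] R}

local notation "𝐩" => act₁ μR
local notation "𝛕" => act₂ τ
local notation "𝛗" => LinearMap.rTensor _ φ
local notation "𝛒" => LinearMap.rTensor _ ρ
local notation "𝐍" => LinearMap.rTensor _ PR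

/-- The map `a ⊗ x ↦ φ(a) ρ(x)`. -/
noncomputable def extendPart (μR : R ⊗[k] R →ₗ[k] R) (φ : A →ₗ[k] R) (ρ : T →ₗ[k] R) :
    A ⊗[k] (T ⊗[k] M) →ₗ[k] R ⊗[k] M :=
  act₁ μR ∘ₗ φ.rTensor (R ⊗[k] M) ∘ₗ (A ◁ ρ.rTensor M)

theorem extendPart_apply (u : A ⊗[k] (T ⊗[k] M)) :
    extendPart μR φ ρ u = 𝐩 (𝛗 ((A ◁ 𝛒) u)) := rfl

theorem extendPart_lTensor (g : M →ₗ[k] N) (u : A ⊗[k] (T ⊗[k] M)) :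
    extendPart μR φ ρ ((A ◁ T ◁ g) u) = (R ◁ g) (extendPart μR φ ρ u) := by
  rw [extendPart_apply, whisker₂₂ A (rTensor_lTensor ρ g), rTensor_lTensor, act₁_lTensor,
    extendPart_apply]

namespace IsShuffleSystem

variable (H : IsShuffleSystem lam μ σ o c δ ε B s) (hA : IsBraidedCommUnitalAlgebra μ e σ)
  (hσ : σ ∘ₗ σ = LinearMap.id)
  (hR : IsStronglyBraidedCommRotaBaxter lam μR eR τ PR)
  (hφ : IsBraidedAlgebraHom μ e σ μR eR τ φ)
  (hρo : ρ o = eR) (hρc : ∀ a x, ρ (c (a ⊗ₜ x)) = PR (μR (φ a ⊗ₜ ρ x)))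

include hρc in
omit H in
theorem act_rho_cons (u : A ⊗[k] (T ⊗[k] M)) : 𝛒 (𝐜 u) = 𝐍 (extendPart μR φ ρ u) := by
  suffices h : ρ.rTensor M ∘ₗ act₁ c = PR.rTensor M ∘ₗ extendPart μR φ ρ from
    LinearMap.congr_fun h u
  ext a x m
  simp [extendPart_apply, act₁_tmul, hρc]

include hρc in
omit H in
theorem lTensor_rho_cons (X : Type*) [AddCommGroup X] [Module k X]
    (u : X ⊗[k] (A ⊗[k] (T ⊗[k] M))) :
    (X ◁ 𝛒) ((X ◁ 𝐜) u) = (X ◁ 𝐍) ((X ◁ extendPart μR φ ρ) u) :=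
  whisker₂₂ X (act_rho_cons hρc) u

include hρo in
omit H in
theorem act_rho_one (m : M) : 𝛒 (o ⊗ₜ m) = eR ⊗ₜ m := by
  rw [LinearMap.rTensor_tmul, hρo]

include hρo in
omit H in
theorem lTensor_rho_one (X : Type*) [AddCommGroup X] [Module k X] (u : X ⊗[k] M) :
    (X ◁ 𝛒) ((X ◁ TensorProduct.mk k T M o) u) = (X ◁ TensorProduct.mk k R M eR) u :=
  whisker₂₁ X (f' := TensorProduct.mk k R M eR) (act_rho_one hρo) u

include hR in
omit H in
/-- Moving an element of `R` through a product `φ(a) ρ(x)`. -/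
theorem tau_extendPart {X : Type*} [AddCommGroup X] [Module k X] {ξ : X →ₗ[k] R}
    (u : X ⊗[k] (A ⊗[k] (T ⊗[k] M))) :
    𝛕 (ξ.rTensor _ ((X ◁ extendPart μR φ ρ) u)) =
      𝐩 ((R ◁ 𝛕) (𝛕 (ξ.rTensor _ ((X ◁ 𝛗) ((X ◁ A ◁ 𝛒) u))))) := by
  rw [rTensor_lTensor]
  simp only [extendPart, LinearMap.lTensor_comp, LinearMap.comp_apply]
  rw [hR.act₂_lTensor_act₁, rTensor_lTensor, rTensor_lTensor]

include H hR hφ hρo hρc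

/-- The recursion of ρ produces P_R, a product and a value of φ. These pass through τ by the right
weak condition, the braiding axiom and `hφ` respectively. In `tau_phi_rho` the left weak condition
plays the corresponding role. -/
theorem tau_rho_phi (u : T ⊗[k] (A ⊗[k] M)) :
    𝛕 (𝛒 ((T ◁ 𝛗) u)) = 𝛗 ((A ◁ 𝛒) (𝛅 u)) := by
  refine H.ext₁ (F := act₂ τ ∘ₗ ρ.rTensor _ ∘ₗ (T ◁ φ.rTensor _))
    (G := φ.rTensor _ ∘ₗ (A ◁ ρ.rTensor _) ∘ₗ act₂ δ) (fun m => ?_) (fun u ih => ?_) u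
  · simp only [LinearMap.comp_apply, LinearMap.lTensor_tmul]
    rw [act_rho_one hρo, hR.act₂_one_tmul, H.act_delta_one, lTensor_rho_one hρo, rTensor_lTensor]
  · simp only [LinearMap.lTensor_comp, LinearMap.comp_apply] at ih ⊢
    rw [← act₁_lTensor, act_rho_cons hρc, hR.act₂_rTensor, extendPart_apply, hR.act₂_act₁,
      ← rTensor_lTensor φ (𝛕), ih, hφ.act₂_map, H.act_delta_cons, lTensor_rho_cons hρc]
    simp only [extendPart, LinearMap.lTensor_comp, LinearMap.comp_apply]
    rw [act₂_lTensor, rTensor_lTensor φ (PR.rTensor M), rTensor_lTensor φ (𝐩)]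

theorem tau_phi_rho (u : A ⊗[k] (T ⊗[k] M)) :
    𝛕 (𝛗 ((A ◁ 𝛒) u)) = 𝛒 ((T ◁ 𝛗) (𝛆 u)) := by
  refine H.ext_letter (F := act₂ τ ∘ₗ φ.rTensor _ ∘ₗ (A ◁ ρ.rTensor _))
    (G := ρ.rTensor _ ∘ₗ (T ◁ φ.rTensor _) ∘ₗ act₂ ε) (fun m => ?_) (fun u ih => ?_) u
  · simp only [LinearMap.comp_apply]
    rw [lTensor_rho_one hρo, rTensor_lTensor, hR.act₂_lTensor_one, H.act_eps_one,
      LinearMap.lTensor_tmul, act_rho_one hρo]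
  · simp only [LinearMap.lTensor_comp, LinearMap.comp_apply] at ih ⊢
    rw [lTensor_rho_cons hρc, rTensor_lTensor, hR.act₂_lTensor_rTensor, tau_extendPart hR,
      hφ.act₂_map, ← rTensor_lTensor φ (𝛕)]
    rw [act₂_lTensor, ih, H.act_eps_cons, ← act₁_lTensor, act_rho_cons hρc, extendPart_apply]

theorem tau_rho_rho (u : T ⊗[k] (T ⊗[k] M)) :
    𝛕 (𝛒 ((T ◁ 𝛒) u)) = 𝛒 ((T ◁ 𝛒) (𝐁 u)) := by
  refine H.ext_snd (F := act₂ τ ∘ₗ ρ.rTensor _ ∘ₗ (T ◁ ρ.rTensor _))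
    (G := ρ.rTensor _ ∘ₗ (T ◁ ρ.rTensor _) ∘ₗ act₂ B) (fun m => ?_) (fun u ih => ?_) u
  · simp only [LinearMap.comp_apply]
    rw [lTensor_rho_one hρo, rTensor_lTensor, hR.act₂_lTensor_one, H.act_braid_one,
      LinearMap.lTensor_tmul, act_rho_one hρo]
  · simp only [LinearMap.lTensor_comp, LinearMap.comp_apply] at ih ⊢
    rw [lTensor_rho_cons hρc, rTensor_lTensor, hR.act₂_lTensor_rTensor, tau_extendPart hR,
      H.tau_rho_phi hR hφ hρo hρc, ← rTensor_lTensor φ (𝛕)]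
    rw [act₂_lTensor, ih, H.act_braid_cons, ← act₁_lTensor, act_rho_cons hρc, extendPart_apply]

/-- The map `a ⊗ x ↦ φ(a) ρ(x)` is compatible with the braidings. -/
theorem tau_extendPart_extendPart (u : A ⊗[k] (T ⊗[k] (A ⊗[k] (T ⊗[k] M)))) :
    𝛕 (extendPart μR φ ρ ((A ◁ T ◁ extendPart μR φ ρ) u)) =
      extendPart μR φ ρ ((A ◁ T ◁ extendPart μR φ ρ) (braidPart σ δ ε B u)) := by
  have h₁ : ∀ w : T ⊗[k] (A ⊗[k] (T ⊗[k] M)), 𝛕 (𝛒 ((T ◁ extendPart μR φ ρ) w)) =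
      extendPart μR φ ρ ((A ◁ T ◁ 𝛒) (((A ◁ 𝐁) ∘ₗ 𝛅) w)) := fun w => by
    rw [tau_extendPart hR, H.tau_rho_phi hR hφ hρo hρc, ← rTensor_lTensor φ (𝛕), act₂_lTensor,
      whisker₃₃ A (H.tau_rho_rho hR hφ hρo hρc), extendPart_apply, LinearMap.comp_apply]
  have h₂ : ∀ w : A ⊗[k] (A ⊗[k] (T ⊗[k] (R ⊗[k] M))), 𝛕 (𝛗 ((A ◁ extendPart μR φ ρ) w)) =
      extendPart μR φ ρ ((A ◁ T ◁ 𝛗) ((A ◁ 𝛆) (𝛔 w))) := fun w => by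
    rw [tau_extendPart hR, hφ.act₂_map, ← rTensor_lTensor φ (𝛕), act₂_lTensor,
      whisker₃₃ A (H.tau_phi_rho hR hφ hρo hρc), extendPart_apply]
  rw [extendPart_apply, hR.act₂_act₁, ← rTensor_lTensor φ (𝛕), whisker₃₃ A h₁, h₂,
    ← extendPart_lTensor, act₂_lTensor, lTensor_act₂, braidPart_apply, LinearMap.lTensor_comp,
    LinearMap.comp_apply, act₂_lTensor]
  simp only [extendPart, LinearMap.lTensor_comp, LinearMap.comp_apply]

/-- In φ(a)ρ(x)φ(b)ρ(y) the middle factors are exchanged by μ_R τ = μ_R, and `tau_rho_phi` turns τ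
into δ. Multiplicativity of ρ on the tails is the hypothesis `h`, because the lemma is used inside
the induction of `rho_shuffle`. -/
theorem extendPart_mulPart_of (u : A ⊗[k] (T ⊗[k] (A ⊗[k] (T ⊗[k] M))))
    (h : (A ◁ A ◁ 𝛒) ((A ◁ A ◁ 𝐬) ((A ◁ 𝛅) u)) =
      (A ◁ A ◁ 𝐩) ((A ◁ A ◁ 𝛒) ((A ◁ A ◁ T ◁ 𝛒) ((A ◁ 𝛅) u)))) :
    extendPart μR φ ρ (mulPart μ δ s u) =
      𝐩 (extendPart μR φ ρ ((A ◁ T ◁ extendPart μR φ ρ) u)) := by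
  have hT : ∀ y : R ⊗[k] (R ⊗[k] (R ⊗[k] (R ⊗[k] M))),
      𝐩 (𝐩 ((R ◁ R ◁ 𝐩) ((R ◁ 𝛕) y))) = 𝐩 ((R ◁ 𝐩) ((R ◁ 𝐩) y)) := fun y => by
    rw [hR.algebra.act₁_act₁, ← whisker₂₂ R hR.algebra.act₁_act₁, whisker₂₁ R hR.act₁_act₂]
  rw [mulPart_apply, extendPart_apply, ← act₁_lTensor, h, ← hφ.act₁_map, ← lTensor_act₂]
  have h₃ : ∀ z : A ⊗[k] (T ⊗[k] (A ⊗[k] (R ⊗[k] M))),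
      (A ◁ 𝛗) ((A ◁ A ◁ 𝛒) ((A ◁ 𝛅) z)) = (A ◁ 𝛕) ((A ◁ 𝛒) ((A ◁ T ◁ 𝛗) z)) := fun z =>
    (whisker₃₃ A (H.tau_rho_phi hR hφ hρo hρc) z).symm
  rw [whisker₂₂ A (rTensor_lTensor φ (act₁ μR)), h₃, rTensor_lTensor φ (R ◁ 𝐩),
    rTensor_lTensor φ (𝛕), hT, whisker₂₂ R hR.algebra.act₁_act₁, extendPart_apply,
    hR.algebra.act₁_act₁]
  simp only [extendPart, LinearMap.lTensor_comp, LinearMap.comp_apply]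
  rw [whisker₂₂ A (rTensor_lTensor ρ (act₁ μR)), rTensor_lTensor φ (R ◁ 𝐩)]

/-- A product of two values of P_R expands by the Rota-Baxter identity in R, whose terms match the
three summands of the recursion one by one (`e₁`, `e₂`, `e₃`). -/
theorem rho_shuffle (u : T ⊗[k] (T ⊗[k] M)) : 𝛒 (𝐬 u) = 𝐩 (𝛒 ((T ◁ 𝛒) u)) := by
  refine H.ext₂ (F := ρ.rTensor M ∘ₗ act₁ s)
    (G := act₁ μR ∘ₗ ρ.rTensor _ ∘ₗ (T ◁ ρ.rTensor M)) (fun u => ?_) (fun u => ?_)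
    (fun u ihx ihy ihxy => ?_) u
  · simp only [LinearMap.comp_apply, LinearMap.lTensor_tmul]
    rw [H.act_one_shuffle, act_rho_one hρo, hR.algebra.act₁_one_tmul]
  · simp only [LinearMap.comp_apply]
    rw [H.act_shuffle_one, lTensor_rho_one hρo, rTensor_lTensor, hR.algebra.act₁_lTensor_one]
  · simp only [LinearMap.lTensor_comp, LinearMap.comp_apply] at ihx ihy ihxy ⊢
    have e₁ : extendPart μR φ ρ (leftPart c s u) =
        𝐩 ((R ◁ 𝐍) (extendPart μR φ ρ ((A ◁ T ◁ extendPart μR φ ρ) u))) := by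
      rw [leftPart, LinearMap.comp_apply, extendPart_apply, ihx,
        whisker₂₂ A (lTensor_rho_cons hρc T), rTensor_lTensor φ (𝐩),
        ← hR.algebra.act₁_act₁, ← extendPart_apply, extendPart_lTensor]
    have e₂ : extendPart μR φ ρ (rightPart c δ s u) =
        𝐩 (𝐍 (extendPart μR φ ρ ((A ◁ T ◁ extendPart μR φ ρ) u))) := by
      simp only [rightPart, LinearMap.comp_apply]
      rw [extendPart_apply, ihy, ← act_rho_cons hρc, act₁_lTensor, ← act₂_lTensor,
        rTensor_lTensor φ (𝐩), ← hR.algebra.act₁_act₁,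
        ← H.tau_rho_phi hR hφ hρo hρc, hR.act₁_act₂, hR.algebra.act₁_act₁,
        ← rTensor_lTensor ρ (𝐩)]
      simp only [extendPart, LinearMap.lTensor_comp, LinearMap.comp_apply]
    have e₃ := H.extendPart_mulPart_of hR hφ hρo hρc u ihxy
    rw [H.act_shuffle_cons_eq, act_rho_cons hρc, lTensor_rho_cons hρc, ← act₁_lTensor,
      rTensor_lTensor, act_rho_cons hρc, ← rTensor_lTensor PR (PR.rTensor M), hR.act₁_rTensor_rTensor, recPart_apply]
    simp only [map_add, map_smul, e₁, e₂, e₃]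

/-- The map `a ⊗ x ↦ φ(a) ρ(x)` is multiplicative. -/
theorem extendPart_mulPart (u : A ⊗[k] (T ⊗[k] (A ⊗[k] (T ⊗[k] M)))) :
    extendPart μR φ ρ (mulPart μ δ s u) =
      𝐩 (extendPart μR φ ρ ((A ◁ T ◁ extendPart μR φ ρ) u)) :=
  H.extendPart_mulPart_of hR hφ hρo hρc u
    (whisker₂₃ A (whisker₂₃ A (H.rho_shuffle hR hφ hρo hρc)) _)

end IsShuffleSystem

end Universal

/-! ### Existence and uniqueness of the extension -/

section UniversalProperty

variable {V : Type*} [AddCommGroup V] [Module k V] {θ : A ⊗[k] T ≃ₗ[k] V} {γ : V →ₗ[k] T}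
  {mV : V ⊗[k] V →ₗ[k] V} {βV : V ⊗[k] V →ₗ[k] V ⊗[k] V} {PV : V →ₗ[k] V} {ιV : A →ₗ[k] V}
variable {R : Type*} [AddCommGroup R] [Module k R] {μR : R ⊗[k] R →ₗ[k] R} {eR : R}
  {τ : R ⊗[k] R →ₗ[k] R ⊗[k] R} {PR : R →ₗ[k] R} {φ : A →ₗ[k] R} {ρ : T →ₗ[k] R}

/-- The map `V → R` with `θ(a ⊗ x) ↦ φ(a) ρ(x)`. -/
noncomputable def extend (θ : A ⊗[k] T ≃ₗ[k] V) (μR : R ⊗[k] R →ₗ[k] R) (φ : A →ₗ[k] R)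
    (ρ : T →ₗ[k] R) : V →ₗ[k] R :=
  μR ∘ₗ TensorProduct.map φ ρ ∘ₗ θ.symm.toLinearMap

theorem extend_tmul (a : A) (x : T) :
    extend θ μR φ ρ (θ (a ⊗ₜ x)) = μR (φ a ⊗ₜ ρ x) := by
  simp [extend]

theorem act_extend (u : A ⊗[k] (T ⊗[k] M)) :
    (extend θ μR φ ρ).rTensor M (act₁ θ.toLinearMap u) = extendPart μR φ ρ u := by
  suffices h : (extend θ μR φ ρ).rTensor M ∘ₗ act₁ θ.toLinearMap = extendPart μR φ ρ from
    LinearMap.congr_fun h u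
  ext a x m
  simp [act₁_tmul, extendPart_apply, extend_tmul]

theorem act_extend_extend (u : A ⊗[k] (T ⊗[k] (A ⊗[k] (T ⊗[k] M)))) :
    (extend θ μR φ ρ).rTensor (R ⊗[k] M) ((V ◁ (extend θ μR φ ρ).rTensor M)
      (act₁ θ.toLinearMap ((A ◁ T ◁ act₁ θ.toLinearMap) u))) =
      extendPart μR φ ρ ((A ◁ T ◁ extendPart μR φ ρ) u) := by
  rw [← act₁_lTensor, act_extend, whisker₂₁ A (whisker₂₁ T act_extend)]

namespace IsShaModel

variable (S : IsShaModel μ e o c δ B s θ γ mV βV PV ιV)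
  (H : IsShuffleSystem lam μ σ o c δ ε B s) (hA : IsBraidedCommUnitalAlgebra μ e σ)
  (hR : IsStronglyBraidedCommRotaBaxter lam μR eR τ PR)
  (hφ : IsBraidedAlgebraHom μ e σ μR eR τ φ)
  (hρo : ρ o = eR) (hρc : ∀ a x, ρ (c (a ⊗ₜ x)) = PR (μR (φ a ⊗ₜ ρ x)))

include S H hR hφ hρo hρc

theorem isBraidedRotaBaxterHom_extend :
    IsBraidedRotaBaxterHom mV (θ (e ⊗ₜ o)) βV PV μR eR τ PR (extend θ μR φ ρ) where
  map_mul := fun x y => eq_of_tmul_one (by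
    obtain ⟨u, hu⟩ := exists_theta₂ (θ := θ) (x ⊗ₜ[k] (y ⊗ₜ[k] (1 : k)))
    rw [← LinearMap.rTensor_tmul, ← act₁_tmul, hu, S.act_mul, act_extend,
      H.extendPart_mulPart hR hφ hρo hρc, ← act_extend_extend (θ := θ), ← hu,
      LinearMap.lTensor_tmul, LinearMap.rTensor_tmul, LinearMap.rTensor_tmul, act₁_tmul])
  map_one := by rw [extend_tmul, hφ.map_one, hρo, hR.algebra.one_mul]
  map_braid := comp_eq_of_act₂_map fun v => by
    obtain ⟨u, rfl⟩ := exists_theta₂ (θ := θ) v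
    rw [act_extend_extend, S.act_braid H, act_extend_extend,
      H.tau_extendPart_extendPart hR hφ hρo hρc]
  map_op := by
    have h : ρ ∘ₗ c = PR ∘ₗ extend θ μR φ ρ ∘ₗ θ.toLinearMap :=
      TensorProduct.ext' fun a x => by simp [hρc, extend_tmul]
    refine LinearMap.ext fun v => ?_
    obtain ⟨w, rfl⟩ := θ.surjective v
    have hw := LinearMap.congr_fun h w
    simp only [LinearMap.comp_apply, LinearEquiv.coe_coe] at hw ⊢
    rw [S.op, extend_tmul, hφ.map_one, hR.algebra.one_mul, hw]

include hA

/-- The universal property of the mixable shuffle algebra. -/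
theorem existsUnique_isBraidedRotaBaxterHom :
    ∃! ψ : V →ₗ[k] R,
      IsBraidedRotaBaxterHom mV (θ (e ⊗ₜ o)) βV PV μR eR τ PR ψ ∧ ψ ∘ₗ ιV = φ := by
  refine ⟨extend θ μR φ ρ, ⟨S.isBraidedRotaBaxterHom_extend H hR hφ hρo hρc, ?_⟩, ?_⟩
  · refine LinearMap.ext fun a => ?_
    rw [LinearMap.comp_apply, S.embed, extend_tmul, hρo, hR.algebra.mul_one]
  · rintro ψ ⟨hψ, hι⟩
    -- a ⊗ x is the product of a ⊗ o = ι(a) and e ⊗ x, so ψ is known once it is known on e ⊗ T.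
    have hmul : ∀ a x, ψ (θ (a ⊗ₜ x)) = μR (φ a ⊗ₜ ψ (θ (e ⊗ₜ x))) := fun a x => by
      have h := S.mul a o e x
      simp only [H.act_delta_one, LinearMap.lTensor_tmul, TensorProduct.mk_apply, act₁_tmul,
        H.one_shuffle, hA.algebra.mul_one] at h
      rw [← h, hψ.map_mul, ← S.embed, ← LinearMap.comp_apply, hι]
    -- On e ⊗ T the map ψ obeys the recursion of ρ, because e ⊗ c(w) is a value of P.
    have hρ : ∀ x, ψ (θ (e ⊗ₜ x)) = ρ x := fun x => by
      induction x using H.induction with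
      | hadd x y hx hy => rw [TensorProduct.tmul_add, map_add, map_add, map_add, hx, hy]
      | hsmul r x hx => rw [TensorProduct.tmul_smul, map_smul, map_smul, map_smul, hx]
      | hone => rw [hψ.map_one, hρo]
      | hcons a x ih =>
        rw [← S.op, ← LinearMap.comp_apply, hψ.map_op, LinearMap.comp_apply, hmul, ih, hρc]
    refine LinearMap.ext fun v => ?_
    obtain ⟨w, rfl⟩ := θ.surjective v
    induction w with
    | zero => simp
    | add x y hx hy => simp only [map_add, hx, hy]
    | tmul a x => rw [hmul, hρ, extend_tmul]

end IsShaModel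

end UniversalProperty

end ShuffleSystem

/-! ### The tensor space of A as a shuffle system -/

section Concrete

variable {k : Type*} [CommRing k] {A : Type*} [AddCommGroup A] [Module k A]
  {N : Type*} [AddCommMonoid N] [Module k N]

local infixr:81 " ◁ " => LinearMap.lTensor

local notation "tpow" => DirectSum.lof k ℕ (fun n : ℕ => ⨂[k]^n A)
local notation "spow" => DirectSum.lof k ℕ (fun n : ℕ => ⨂[k]^(n + 1) A)

/-- Induction over the homogeneous elements of `T(A)`. -/
theorem tensorSpace_induction {p : TensorSpace k A → Prop} (hadd : ∀ x y, p x → p y → p (x + y))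
    (hlof : ∀ n x, p (tpow n x)) (x : TensorSpace k A) : p x := by
  induction x using DirectSum.induction_on with
  | zero => simpa using hlof 0 0
  | of n x => simpa only [DirectSum.lof_eq_of] using hlof n x
  | add x y hx hy => exact hadd x y hx hy

theorem sha_induction {p : Sha k A → Prop} (hadd : ∀ x y, p x → p y → p (x + y))
    (hlof : ∀ n x, p (spow n x)) (x : Sha k A) : p x := by
  induction x using DirectSum.induction_on with
  | zero => simpa using hlof 0 0
  | of n x => simpa only [DirectSum.lof_eq_of] using hlof n x
  | add x y hx hy => exact hadd x y hx hy

theorem consT_tmul_lof (n : ℕ) (a : A) (x : ⨂[k]^n A) :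
    consT k A (a ⊗ₜ tpow n x) = tpow (n + 1) (cons k A n (a ⊗ₜ x)) := by
  simp [consT, TensorProduct.directSumRight_tmul_lof]

theorem consSha_tmul_lof (n : ℕ) (a : A) (x : ⨂[k]^n A) :
    consSha k A (a ⊗ₜ tpow n x) = spow n (cons k A n (a ⊗ₜ x)) := by
  simp [consSha, TensorProduct.directSumRight_tmul_lof]

theorem consT_lTensor_lof (n : ℕ) (w : A ⊗[k] (⨂[k]^n A)) :
    consT k A ((A ◁ tpow n) w) = tpow (n + 1) (cons k A n w) := by
  suffices h : consT k A ∘ₗ (A ◁ tpow n) = tpow (n + 1) ∘ₗ (cons k A n).toLinearMap from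
    LinearMap.congr_fun h w
  exact TensorProduct.ext' fun a x => by simp [consT_tmul_lof]

theorem consSha_lTensor_lof (n : ℕ) (w : A ⊗[k] (⨂[k]^n A)) :
    consSha k A ((A ◁ tpow n) w) = spow n (cons k A n w) := by
  suffices h : consSha k A ∘ₗ (A ◁ tpow n) = spow n ∘ₗ (cons k A n).toLinearMap from
    LinearMap.congr_fun h w
  exact TensorProduct.ext' fun a x => by simp [consSha_tmul_lof]

/-- Induction over the homogeneous elements of `A ⊗ T(A)`. -/
theorem tmul_tensorSpace_induction {p : A ⊗[k] TensorSpace k A → Prop}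
    (hadd : ∀ x y, p x → p y → p (x + y)) (hlof : ∀ n w, p ((A ◁ tpow n) w))
    (w : A ⊗[k] TensorSpace k A) : p w := by
  induction w with
  | zero => simpa using hlof 0 0
  | add x y hx hy => exact hadd x y hx hy
  | tmul a x =>
    induction x using tensorSpace_induction with
    | hadd x y hx hy => rw [TensorProduct.tmul_add]; exact hadd _ _ hx hy
    | hlof n x => simpa using hlof n (a ⊗ₜ x)

/-- Splitting off the first tensor factor. -/
noncomputable def uncons : TensorSpace k A →ₗ[k] A ⊗[k] TensorSpace k A :=
  DirectSum.toModule k ℕ _ fun n => match n with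
    -- Any value would do here: prepending a letter never lands in degree zero.
    | 0 => 0
    | n + 1 => (A ◁ tpow n) ∘ₗ (cons k A n).symm.toLinearMap

theorem uncons_comp_consT : uncons ∘ₗ consT k A = LinearMap.id := by
  refine LinearMap.ext fun w => ?_
  induction w using tmul_tensorSpace_induction with
  | hadd x y hx hy => rw [map_add, map_add, hx, hy]
  | hlof n w =>
    rw [LinearMap.comp_apply, consT_lTensor_lof, uncons, DirectSum.toModule_lof]
    simp

variable (k A) in
/-- The identification `A ⊗ T(A) ≃ ⊕_{n ≥ 1} A^{⊗n}`. -/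
noncomputable def shaEquiv : A ⊗[k] TensorSpace k A ≃ₗ[k] Sha k A :=
  LinearEquiv.ofLinearMap (consSha k A)
    (DirectSum.toModule k ℕ _ fun n => (A ◁ tpow n) ∘ₗ (cons k A n).symm.toLinearMap)
    (DirectSum.linearMap_ext k fun n => LinearMap.ext fun x => by
      simp [consSha_lTensor_lof])
    (LinearMap.ext fun w => by
      induction w using tmul_tensorSpace_induction with
      | hadd x y hx hy => rw [map_add, map_add, hx, hy]
      | hlof n w => simp [consSha_lTensor_lof])

theorem shaEquiv_apply (w : A ⊗[k] TensorSpace k A) : shaEquiv k A w = consSha k A w := rfl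

variable (k A) in
/-- The inclusion `⊕_{n ≥ 1} A^{⊗n} → ⊕_{n ≥ 0} A^{⊗n}`. -/
noncomputable def shaIncl : Sha k A →ₗ[k] TensorSpace k A :=
  DirectSum.toModule k ℕ _ fun n => tpow (n + 1)

theorem shaIncl_lof (n : ℕ) (x : ⨂[k]^(n + 1) A) : shaIncl k A (spow n x) = tpow (n + 1) x := by
  simp [shaIncl]

theorem shaIncl_consSha (w : A ⊗[k] TensorSpace k A) :
    shaIncl k A (consSha k A w) = consT k A w := by
  induction w using tmul_tensorSpace_induction with
  | hadd x y hx hy => simp only [map_add, hx, hy]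
  | hlof n w => rw [consSha_lTensor_lof, shaIncl_lof, consT_lTensor_lof]

variable (k A) in
/-- The unit of `T(A)`. -/
noncomputable def tensorOne : TensorSpace k A :=
  tpow 0 ((PiTensorProduct.isEmptyEquiv (Fin 0)).symm 1)

theorem lof_zero (x : ⨂[k]^0 A) :
    tpow 0 x = PiTensorProduct.isEmptyEquiv (R := k) (s := fun _ => A) (Fin 0) x • tensorOne k A := by
  rw [tensorOne, ← map_smul, ← map_smul, smul_eq_mul, mul_one, LinearEquiv.symm_apply_apply]

theorem tensorSpace_eq_top (S : Submodule k (TensorSpace k A)) (h₀ : tensorOne k A ∈ S)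
    (h : ∀ a x, x ∈ S → consT k A (a ⊗ₜ x) ∈ S) : S = ⊤ := by
  have hlof : ∀ n x, tpow n x ∈ S := fun n => by
    induction n with
    | zero => intro x; rw [lof_zero]; exact S.smul_mem _ h₀
    | succ n ih =>
      intro x
      obtain ⟨w, rfl⟩ := (cons k A n).surjective x
      induction w with
      | zero => simp
      | add x y hx hy => simpa only [map_add] using S.add_mem hx hy
      | tmul a x => rw [← consT_tmul_lof]; exact h a _ (ih x)
  refine (Submodule.eq_top_iff').2 fun x => ?_
  induction x using tensorSpace_induction with
  | hadd x y hx hy => exact S.add_mem hx hy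
  | hlof n x => exact hlof n x

/-- The component of degree `n` of `tensorFold`. -/
noncomputable def powFold (n₀ : N) (f : A ⊗[k] N →ₗ[k] N) : (n : ℕ) → (⨂[k]^n A) →ₗ[k] N
  | 0 => LinearMap.toSpanSingleton k N n₀ ∘ₗ
      (PiTensorProduct.isEmptyEquiv (R := k) (s := fun _ => A) (Fin 0)).toLinearMap
  | n + 1 => f ∘ₗ (A ◁ powFold n₀ f n) ∘ₗ (cons k A n).symm.toLinearMap

/-- The linear map on `T(A)` defined by recursion on the first tensor factor. -/
noncomputable def tensorFold (n₀ : N) (f : A ⊗[k] N →ₗ[k] N) : TensorSpace k A →ₗ[k] N :=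
  DirectSum.toModule k ℕ _ (powFold n₀ f)

theorem tensorFold_one (n₀ : N) (f : A ⊗[k] N →ₗ[k] N) :
    tensorFold n₀ f (tensorOne k A) = n₀ := by
  rw [tensorFold, tensorOne, DirectSum.toModule_lof]
  simp [powFold]

theorem tensorFold_cons (n₀ : N) (f : A ⊗[k] N →ₗ[k] N) (a : A) (x : TensorSpace k A) :
    tensorFold n₀ f (consT k A (a ⊗ₜ x)) = f (a ⊗ₜ tensorFold n₀ f x) := by
  induction x using tensorSpace_induction with
  | hadd x y hx hy => simp only [TensorProduct.tmul_add, map_add, hx, hy]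
  | hlof n x =>
    rw [consT_tmul_lof, tensorFold, DirectSum.toModule_lof, DirectSum.toModule_lof]
    simp [powFold]

/-- The linear map on `T(A) ⊗ T(A)` with the given components. -/
noncomputable def tensorLift₂ (f : (m n : ℕ) → (⨂[k]^m A) ⊗[k] (⨂[k]^n A) →ₗ[k] N) :
    TensorSpace k A ⊗[k] TensorSpace k A →ₗ[k] N :=
  DirectSum.toModule k (ℕ × ℕ) N (fun p => f p.1 p.2) ∘ₗ
    (TensorProduct.directSum k k (fun m : ℕ => ⨂[k]^m A) (fun n : ℕ => ⨂[k]^n A)).toLinearMap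

theorem tensorLift₂_lof (f : (m n : ℕ) → (⨂[k]^m A) ⊗[k] (⨂[k]^n A) →ₗ[k] N) (m n : ℕ)
    (x : ⨂[k]^m A) (y : ⨂[k]^n A) :
    tensorLift₂ f (tpow m x ⊗ₜ tpow n y) = f m n (x ⊗ₜ y) := by
  rw [tensorLift₂, LinearMap.comp_apply, LinearEquiv.coe_coe,
    TensorProduct.directSum_lof_tmul_lof, DirectSum.toModule_lof]

theorem shaLift₂_lof (f : (m n : ℕ) → (⨂[k]^(m + 1) A) ⊗[k] (⨂[k]^(n + 1) A) →ₗ[k] N) (m n : ℕ)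
    (x : ⨂[k]^(m + 1) A) (y : ⨂[k]^(n + 1) A) :
    shaLift₂ f (spow m x ⊗ₜ spow n y) = f m n (x ⊗ₜ y) := by
  rw [shaLift₂, LinearMap.comp_apply, LinearEquiv.coe_coe,
    TensorProduct.directSum_lof_tmul_lof, DirectSum.toModule_lof]

section Maps

variable (lam : k) (μ : A ⊗[k] A →ₗ[k] A) (σ : A ⊗[k] A →ₗ[k] A ⊗[k] A)

/-- The braiding `T(A) ⊗ A → A ⊗ T(A)`. -/
noncomputable def tensorDelta : TensorSpace k A ⊗[k] A →ₗ[k] A ⊗[k] TensorSpace k A :=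
  DirectSum.toModule k ℕ _ (fun n => (A ◁ tpow n) ∘ₗ betaOne σ n) ∘ₗ
    (TensorProduct.directSumLeft k k (fun n : ℕ => ⨂[k]^n A) A).toLinearMap

/-- The braiding `A ⊗ A^{⊗n} → A^{⊗n} ⊗ A`. -/
noncomputable def powEps : (n : ℕ) → A ⊗[k] (⨂[k]^n A) →ₗ[k] (⨂[k]^n A) ⊗[k] A
  | 0 => (TensorProduct.comm k A (⨂[k]^0 A)).toLinearMap
  | n + 1 => act₁ (cons k A n).toLinearMap ∘ₗ (A ◁ powEps n) ∘ₗ act₂ σ ∘ₗ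
      (A ◁ (cons k A n).symm.toLinearMap)

/-- The braiding `A ⊗ T(A) → T(A) ⊗ A`. -/
noncomputable def tensorEps : A ⊗[k] TensorSpace k A →ₗ[k] TensorSpace k A ⊗[k] A :=
  DirectSum.toModule k ℕ _ (fun n => (tpow n).rTensor A ∘ₗ powEps σ n) ∘ₗ
    (TensorProduct.directSumRight k k A (fun n : ℕ => ⨂[k]^n A)).toLinearMap

/-- The braiding of `T(A)`. -/
noncomputable def tensorBraid :
    TensorSpace k A ⊗[k] TensorSpace k A →ₗ[k] TensorSpace k A ⊗[k] TensorSpace k A :=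
  tensorLift₂ fun m n => TensorProduct.map (tpow n) (tpow m) ∘ₗ beta σ m n

/-- The quasi-shuffle product of `T(A)`. -/
noncomputable def tensorShuffle : TensorSpace k A ⊗[k] TensorSpace k A →ₗ[k] TensorSpace k A :=
  tensorLift₂ (quasiShuffle lam μ σ)

variable {lam μ σ}

theorem tensorDelta_lof (n : ℕ) (x : ⨂[k]^n A) (a : A) :
    tensorDelta σ (tpow n x ⊗ₜ a) = (A ◁ tpow n) (betaOne σ n (x ⊗ₜ a)) := by
  rw [tensorDelta, LinearMap.comp_apply, LinearEquiv.coe_coe,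
    TensorProduct.directSumLeft_tmul_lof, DirectSum.toModule_lof, LinearMap.comp_apply]

theorem tensorEps_lof (n : ℕ) (a : A) (x : ⨂[k]^n A) :
    tensorEps σ (a ⊗ₜ tpow n x) = (tpow n).rTensor A (powEps σ n (a ⊗ₜ x)) := by
  rw [tensorEps, LinearMap.comp_apply, LinearEquiv.coe_coe,
    TensorProduct.directSumRight_tmul_lof, DirectSum.toModule_lof, LinearMap.comp_apply]

theorem betaOne_cons (n : ℕ) (a : A) (x : ⨂[k]^n A) (b : A) :
    betaOne σ (n + 1) (cons k A n (a ⊗ₜ x) ⊗ₜ b) =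
      (A ◁ (cons k A n).toLinearMap) (act₂ σ (a ⊗ₜ betaOne σ n (x ⊗ₜ b))) := by
  simp [betaOne, act₂]

theorem powEps_cons (n : ℕ) (a b : A) (x : ⨂[k]^n A) :
    powEps σ (n + 1) (a ⊗ₜ cons k A n (b ⊗ₜ x)) =
      act₁ (cons k A n).toLinearMap ((A ◁ powEps σ n) (act₂ σ (a ⊗ₜ (b ⊗ₜ x)))) := by
  simp [powEps]

theorem beta_cons (m n : ℕ) (x : ⨂[k]^m A) (b : A) (y : ⨂[k]^n A) :
    beta σ m (n + 1) (x ⊗ₜ cons k A n (b ⊗ₜ y)) =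
      act₁ (cons k A n).toLinearMap ((A ◁ beta σ m n) (act₂ (betaOne σ m) (x ⊗ₜ (b ⊗ₜ y)))) := by
  simp [beta, act₁, act₂]

theorem midBraid_cons (m n : ℕ) (a : A) (x : ⨂[k]^m A) (b : A) (y : ⨂[k]^n A) :
    midBraid σ m n (cons k A m (a ⊗ₜ x) ⊗ₜ cons k A n (b ⊗ₜ y)) =
      (TensorProduct.assoc k A A ((⨂[k]^m A) ⊗[k] (⨂[k]^n A))).symm
        (a ⊗ₜ act₂ (betaOne σ m) (x ⊗ₜ (b ⊗ₜ y))) := by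
  simp [midBraid, act₂]

theorem quasiShuffle_zero_left (n : ℕ) (x : ⨂[k]^0 A) (y : ⨂[k]^n A) :
    quasiShuffle lam μ σ 0 n (x ⊗ₜ y) =
      PiTensorProduct.isEmptyEquiv (R := k) (s := fun _ => A) (Fin 0) x • tpow n y := by
  rw [quasiShuffle]
  simp

theorem quasiShuffle_zero_right (m : ℕ) (x : ⨂[k]^m A) (y : ⨂[k]^0 A) :
    quasiShuffle lam μ σ m 0 (x ⊗ₜ y) =
      PiTensorProduct.isEmptyEquiv (R := k) (s := fun _ => A) (Fin 0) y • tpow m x := by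
  cases m with
  | zero =>
    rw [quasiShuffle_zero_left, lof_zero, lof_zero, smul_comm]
  | succ m =>
    rw [quasiShuffle]
    simp

/-- On homogeneous words the globally defined δ and * reduce to their components. Here and in
`lTensor_quasiShuffle` the componentwise recursion is rewritten in terms of the global maps. -/
theorem map_quasiShuffle (m n : ℕ) (a : A) (x : ⨂[k]^m A) (b : A) (y : ⨂[k]^n A) :
    TensorProduct.map μ (quasiShuffle lam μ σ m n)
      (midBraid σ m n (cons k A m (a ⊗ₜ x) ⊗ₜ cons k A n (b ⊗ₜ y))) =
    act₁ μ ((A ◁ A ◁ tensorShuffle lam μ σ)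
      (a ⊗ₜ act₂ (tensorDelta σ) (tpow m x ⊗ₜ (b ⊗ₜ tpow n y)))) := by
  rw [midBraid_cons, act₂_tmul, act₂_tmul, tensorDelta_lof]
  induction betaOne σ m (x ⊗ₜ b) with
  | zero => simp
  | add p q hp hq => simp only [TensorProduct.add_tmul, TensorProduct.tmul_add, map_add, hp, hq]
  | tmul c z => simp [act₁_tmul, tensorShuffle, tensorLift₂_lof]

theorem lTensor_quasiShuffle (m n : ℕ) (x : ⨂[k]^m A) (b : A) (y : ⨂[k]^n A) :
    (A ◁ quasiShuffle lam μ σ m n) (act₂ (betaOne σ m) (x ⊗ₜ (b ⊗ₜ y))) =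
    (A ◁ tensorShuffle lam μ σ) (act₂ (tensorDelta σ) (tpow m x ⊗ₜ (b ⊗ₜ tpow n y))) := by
  rw [act₂_tmul, act₂_tmul, tensorDelta_lof]
  induction betaOne σ m (x ⊗ₜ b) with
  | zero => simp
  | add p q hp hq => simp only [TensorProduct.add_tmul, map_add, hp, hq]
  | tmul c z => simp [tensorShuffle, tensorLift₂_lof]

theorem quasiShuffle_cons (m n : ℕ) (a : A) (x : ⨂[k]^m A) (b : A) (y : ⨂[k]^n A) :
    quasiShuffle lam μ σ (m + 1) (n + 1) (cons k A m (a ⊗ₜ x) ⊗ₜ cons k A n (b ⊗ₜ y)) =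
      consT k A (a ⊗ₜ quasiShuffle lam μ σ m (n + 1) (x ⊗ₜ cons k A n (b ⊗ₜ y))) +
      consT k A ((A ◁ quasiShuffle lam μ σ (m + 1) n)
        (act₂ (betaOne σ (m + 1)) (cons k A m (a ⊗ₜ x) ⊗ₜ (b ⊗ₜ y)))) +
      lam • consT k A (TensorProduct.map μ (quasiShuffle lam μ σ m n)
        (midBraid σ m n (cons k A m (a ⊗ₜ x) ⊗ₜ cons k A n (b ⊗ₜ y)))) := by
  rw [quasiShuffle]
  simp [act₂]

variable (lam μ σ) in
/-- The tensor space of `A` is a shuffle system. -/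
theorem isShuffleSystem_tensorSpace :
    IsShuffleSystem lam μ σ (tensorOne k A) (consT k A) (tensorDelta σ) (tensorEps σ)
      (tensorBraid σ) (tensorShuffle lam μ σ) where
  eq_top := tensorSpace_eq_top
  exists_leftInverse := ⟨uncons, uncons_comp_consT⟩
  delta_one a := by simp [tensorOne, tensorDelta_lof, betaOne]
  delta_cons a x b := by
    induction x using tensorSpace_induction with
    | hadd x y hx hy =>
      simp only [TensorProduct.tmul_add, TensorProduct.add_tmul, map_add, hx, hy]
    | hlof n x =>
      rw [consT_tmul_lof, tensorDelta_lof, betaOne_cons, tensorDelta_lof,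
        ← LinearMap.lTensor_tmul A (A ◁ tpow n), act₂_lTensor]
      exact (whisker₂₂ A (g' := (cons k A n).toLinearMap) (consT_lTensor_lof n) _).symm
  eps_one a := by simp [tensorOne, tensorEps_lof, powEps]
  eps_cons a b x := by
    induction x using tensorSpace_induction with
    | hadd x y hx hy =>
      simp only [TensorProduct.tmul_add, map_add, hx, hy]
    | hlof n x =>
      rw [consT_tmul_lof, tensorEps_lof, powEps_cons, act₂_tmul, act₂_tmul]
      induction σ (a ⊗ₜ b) with
      | zero => simp
      | add p q hp hq => simp only [TensorProduct.add_tmul, map_add, hp, hq]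
      | tmul b a =>
        simp only [TensorProduct.assoc_tmul, LinearMap.lTensor_tmul, tensorEps_lof]
        induction powEps σ n (a ⊗ₜ x) with
        | zero => simp
        | add p q hp hq => simp only [TensorProduct.tmul_add, map_add, hp, hq]
        | tmul y c => simp [act₁_tmul, consT_tmul_lof]
  braid_one x := by
    induction x using tensorSpace_induction with
    | hadd x y hx hy => simp only [TensorProduct.tmul_add, TensorProduct.add_tmul, map_add, hx, hy]
    | hlof n x => rw [tensorOne, tensorBraid, tensorLift₂_lof]; simp [beta]
  braid_cons x b y := by
    induction y using tensorSpace_induction with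
    | hadd x y hx hy => simp only [TensorProduct.tmul_add, map_add, hx, hy]
    | hlof n y =>
    induction x using tensorSpace_induction with
    | hadd x y hx hy => simp only [TensorProduct.add_tmul, map_add, hx, hy]
    | hlof m x =>
      rw [consT_tmul_lof, tensorBraid, tensorLift₂_lof, LinearMap.comp_apply, beta_cons, act₂_tmul,
        act₂_tmul, tensorDelta_lof]
      induction betaOne σ m (x ⊗ₜ b) with
      | zero => simp
      | add p q hp hq => simp only [TensorProduct.add_tmul, map_add, hp, hq]
      | tmul b x =>
        simp only [TensorProduct.assoc_tmul, LinearMap.lTensor_tmul, tensorLift₂_lof,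
          LinearMap.comp_apply]
        induction beta σ m n (x ⊗ₜ y) with
        | zero => simp
        | add p q hp hq => simp only [TensorProduct.tmul_add, map_add, hp, hq]
        | tmul y c => simp [act₁_tmul, consT_tmul_lof]
  one_shuffle x := by
    induction x using tensorSpace_induction with
    | hadd x y hx hy => rw [TensorProduct.tmul_add, map_add, hx, hy]
    | hlof n x =>
      rw [tensorOne, tensorShuffle, tensorLift₂_lof, quasiShuffle_zero_left,
        LinearEquiv.apply_symm_apply, one_smul]
  shuffle_one x := by
    induction x using tensorSpace_induction with
    | hadd x y hx hy => rw [TensorProduct.add_tmul, map_add, hx, hy]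
    | hlof n x =>
      rw [tensorOne, tensorShuffle, tensorLift₂_lof, quasiShuffle_zero_right,
        LinearEquiv.apply_symm_apply, one_smul]
  shuffle_cons a x b y := by
    induction y using tensorSpace_induction with
    | hadd x y hx hy =>
      simp only [TensorProduct.tmul_add, map_add, hx, hy, smul_add]
      abel
    | hlof n y =>
    induction x using tensorSpace_induction with
    | hadd x y hx hy =>
      simp only [TensorProduct.tmul_add, TensorProduct.add_tmul, map_add, hx, hy, smul_add]
      abel
    | hlof m x =>
      rw [LinearMap.lTensor_tmul, ← map_quasiShuffle, consT_tmul_lof, consT_tmul_lof,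
        ← lTensor_quasiShuffle, tensorShuffle, tensorLift₂_lof, tensorLift₂_lof, quasiShuffle_cons]

variable (lam μ σ) in
/-- The mixable shuffle algebra in terms of the shuffle system on the tensor space. -/
theorem isShaModel_sha (e : A) :
    IsShaModel μ e (tensorOne k A) (consT k A) (tensorDelta σ) (tensorBraid σ)
      (tensorShuffle lam μ σ) (shaEquiv k A) (shaIncl k A) (shaMul lam μ σ) (shaBraid σ) (shaP e)
      (shaι k A) where
  incl := shaIncl_consSha
  mul a x b y := by
    induction y using tensorSpace_induction with
    | hadd x y hx hy => simp only [TensorProduct.tmul_add, map_add, hx, hy]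
    | hlof n y =>
    induction x using tensorSpace_induction with
    | hadd x y hx hy => simp only [TensorProduct.tmul_add, TensorProduct.add_tmul, map_add, hx, hy]
    | hlof m x =>
      rw [← map_quasiShuffle, shaEquiv_apply, shaEquiv_apply, shaEquiv_apply, consSha_tmul_lof,
        consSha_tmul_lof, shaMul, shaLift₂_lof, LinearMap.comp_apply, LinearMap.comp_apply]
  braid := TensorProduct.ext' fun x y => by
    induction y using sha_induction with
    | hadd x y hx hy => simp only [TensorProduct.tmul_add, map_add, hx, hy]
    | hlof n y =>
    induction x using sha_induction with
    | hadd x y hx hy => simp only [TensorProduct.add_tmul, map_add, hx, hy]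
    | hlof m x =>
      rw [LinearMap.comp_apply, LinearMap.comp_apply, shaBraid, shaLift₂_lof,
        TensorProduct.map_tmul, shaIncl_lof, shaIncl_lof, tensorBraid, tensorLift₂_lof,
        LinearMap.comp_apply, LinearMap.comp_apply]
      induction beta σ (m + 1) (n + 1) (x ⊗ₜ y) with
      | zero => simp
      | add p q hp hq => simp only [map_add, hp, hq]
      | tmul y x => simp [shaIncl_lof]
  op w := by
    induction w using tmul_tensorSpace_induction with
    | hadd x y hx hy => simp only [TensorProduct.tmul_add, map_add, hx, hy]
    | hlof n w =>
      rw [shaEquiv_apply, shaEquiv_apply, consSha_lTensor_lof, consT_lTensor_lof,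
        consSha_tmul_lof, shaP, DirectSum.toModule_lof]
      rfl
  embed a := by
    rw [shaEquiv_apply, tensorOne, consSha_tmul_lof, shaι, LinearMap.comp_apply,
      PiTensorProduct.isEmptyEquiv_symm_apply, one_smul, cons_tmul_tprod, LinearEquiv.coe_coe,
      PiTensorProduct.subsingletonEquiv_symm_apply']
    congr 2
    ext i
    rw [Subsingleton.elim i 0, Fin.cons_zero]

end Maps

end Concrete

end BraidedRB

theorem theorem2p3 {k : Type*} [Field k] [CharZero k] (lam : k)
    {A : Type*} [AddCommGroup A] [Module k A]
    (μ : A ⊗[k] A →ₗ[k] A) (e : A) (σ : A ⊗[k] A →ₗ[k] A ⊗[k] A)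
    (hA : BraidedRB.IsBraidedCommUnitalAlgebra μ e σ) (hσ : σ ∘ₗ σ = LinearMap.id) :
    BraidedRB.IsStronglyBraidedCommRotaBaxter lam (BraidedRB.shaMul lam μ σ)
      (BraidedRB.shaι k A e) (BraidedRB.shaBraid σ) (BraidedRB.shaP e) ∧
    BraidedRB.IsBraidedAlgebraHom μ e σ
      (BraidedRB.shaMul lam μ σ) (BraidedRB.shaι k A e) (BraidedRB.shaBraid σ)
      (BraidedRB.shaι k A) ∧
    ∀ {R : Type*} [AddCommGroup R] [Module k R]
      (μR : R ⊗[k] R →ₗ[k] R) (eR : R) (τ : R ⊗[k] R →ₗ[k] R ⊗[k] R) (PR : R →ₗ[k] R),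
      BraidedRB.IsStronglyBraidedCommRotaBaxter lam μR eR τ PR →
      ∀ φ : A →ₗ[k] R, BraidedRB.IsBraidedAlgebraHom μ e σ μR eR τ φ →
        ∃! ψ : BraidedRB.Sha k A →ₗ[k] R,
          BraidedRB.IsBraidedRotaBaxterHom
            (BraidedRB.shaMul lam μ σ) (BraidedRB.shaι k A e) (BraidedRB.shaBraid σ)
            (BraidedRB.shaP e) μR eR τ PR ψ ∧
          ψ ∘ₗ BraidedRB.shaι k A = φ := by
  have H := BraidedRB.isShuffleSystem_tensorSpace lam μ σ
  have S := BraidedRB.isShaModel_sha lam μ σ e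
  -- The unit j(e) has to appear as e ⊗ 1 in A ⊗ T, the form used in the model.
  rw [S.embed e]
  refine ⟨S.isStronglyBraidedCommRotaBaxter H hA hσ, S.isBraidedAlgebraHom H, ?_⟩
  intro R _ _ μR eR τ PR hR φ hφ
  -- The recursion ρ(c(a ⊗ x)) = P_R(φ(a)ρ(x)) is the one forced by uniqueness; folding with it from
  -- `eR` gives ρ.
  let f : A ⊗[k] R →ₗ[k] R := PR ∘ₗ μR ∘ₗ φ.rTensor R
  exact S.existsUnique_isBraidedRotaBaxterHom H hA hR hφ (BraidedRB.tensorFold_one eR f)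
    fun a x => by rw [BraidedRB.tensorFold_cons]; simp [f]
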